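/- Let $K$ be a non-archimedean local field (for example $K=\mathbb{Q}_p$), let $\epsilon>0$, and let $B_\epsilon=\{x\in K: |x|<\epsilon\}$. Let $C^{\mathrm{an}}(B_\epsilon)$ be the space of locally analytic functions $f:B_\epsilon\to K$ and $C^1(B_\epsilon)$ the space of strictly differentiable functions $f:B_\epsilon\to K$. For $f:B_\epsilon\to K$ let $\mathrm{Lip}(f)=\sup_{v_1\ne v_2}|f(v_1)-f(v_2)|/|v_1-v_2|$, and put $$\mathrm{Diff}^{\mathrm{an}}(B_\epsilon)=\{\mathrm{id}+f:\ f\in C^{\mathrm{an}}(B_\epsilon),\ f(0)=0,\ \mathrm{Lip}(f)<1\},$$ $$\mathrm{Diff}^{1}(B_\epsilon)=\{\mathrm{id}+f:\ f\in C^{1}(B_\epsilon),\ f(0)=0,\ \mathrm{Lip}(f)<1\}.$$ Conventions. For $r>0$ let $A_r$ be the Banach space of functions on $B_\epsilon$ that on each disc $\{y\in B_\epsilon:|y-a|<r\}$, $a\in B_\epsilon$, are given by a power series $\sum_j c_j(y-a)^j$ with $|c_j|r^j\le M$ for all $j$, where $M$ does not depend on $a$; the norm is the least such $M$. The space $C^{\mathrm{an}}(B_\epsilon)=\bigcup_{r>0}A_r$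 carries the locally convex inductive limit topology, that is, the topology of all ultrametric seminorms that are continuous on each $A_r$, and $C^{\mathrm{an}}_0(B_\epsilon)=\{f\in C^{\mathrm{an}}(B_\epsilon): f(0)=0\}$ carries the subspace topology. A map $F:U\to E'$ from an open subset $U$ of a locally convex $K$-space $E$ to a locally convex $K$-space $E'$ is called locally analytic if it is continuous and if for every $x\in U$ and every continuous linear map $i:V\to E$ from an ultrametric $K$-Banach space $V$ there are a continuous linear map $j:W\to E'$ from an ultrametric $K$-Banach space $W$ and a map $g:V\to W$, given near $0$ by a convergent power series, with $F(x+i(v))=F(x)+j(g(v))$ for all $v\in V$ near $0$. A Lie group modelled on $E$ is a group and Hausdorff topological group with an atlas of charts onto open subsets of $E$ such that the transition maps, the multiplication and the inversion are locally analytic in the charts. Then: 1. Every element of $\mathrm{Diff}^{\mathrm{an}}(B_\epsilon)$ is a bijection of $B_\epsilon$ onto itself that is locally analytic with locally analytic inverse, and $\mathrm{Diff}^{\mathrm{an}}(B_\epsilon)$ is a group under composition. The map $\varphi\mapsto\varphi-\mathrm{id}$ is a bijection of $\mathrm{Diff}^{\mathrm{an}}(B_\epsilon)$ onto an open subset of $C^{\mathrm{an}}_0(B_\epsilon)$,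 and with this map as single global chart $\mathrm{Diff}^{\mathrm{an}}(B_\epsilon)$ is a Lie group modelled on the infinite-dimensional space $C^{\mathrm{an}}_0(B_\epsilon)$. For every $L$ with $0<L<1$ the elements $\mathrm{id}+f$ with $\mathrm{Lip}(f)\le L$ form an open subgroup. 2. Every element of $\mathrm{Diff}^{1}(B_\epsilon)$ is a bijection of $B_\epsilon$ onto itself that is strictly differentiable with strictly differentiable inverse, and $\mathrm{Diff}^{1}(B_\epsilon)$ is a group under composition. For every $L$ with $0\le L<1$ the elements $\mathrm{id}+f$ with $\mathrm{Lip}(f)\le L$ form a subgroup. -/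

import Mathlib

open Metric Topology NNReal

universe u v w

namespace PadicDiff

/-! ### Locally analytic maps and Lie groups over a non-archimedean field -/

section LieGroups

/-- Locally analytic maps between (possibly infinite-dimensional) locally convex `K`-vector spaces,
in the convenient sense. A map `f` is locally analytic on the open set `U` if it is continuous on
`U` and if, near each point `x` of `U` and along each Banach space `V` mapping continuously and
linearly to `E`, it is given by a convergent power series with values in some Banach space `W`
mapping continuously and linearly to `F`. If `E` and `F` are ultrametric Banach
spaces (for example `K ^ m` and `K ^ n` with `K` complete), this says that `f` is given near each point of `U` by a
convergent power series. -/
def LocallyAnalyticOn (K : Type u) [NontriviallyNormedField K]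
    {E : Type v} [AddCommGroup E] [Module K E] [TopologicalSpace E]
    {F : Type w} [AddCommGroup F] [Module K F] [TopologicalSpace F]
    (f : E → F) (U : Set E) : Prop :=
  ContinuousOn f U ∧
  ∀ x ∈ U, ∀ (V : Type v) [NormedAddCommGroup V] [NormedSpace K V] [CompleteSpace V]
    [IsUltrametricDist V] (i : V →L[K] E),
    ∃ (W : Type w) (_ : NormedAddCommGroup W) (_ : NormedSpace K W) (_ : CompleteSpace W)
      (_ : IsUltrametricDist W) (j : W →L[K] F) (g : V → W),
      AnalyticAt K g 0 ∧ ∀ᶠ y in 𝓝 (0 : V), f (x + i y) = f x + j (g y)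

/-- A Lie group over `K` modelled on the topological vector space `E`: a Hausdorff space with an
atlas of charts with values in open subsets of `E` and locally analytic transition maps, and a
group structure whose multiplication and inversion are continuous, and locally analytic when read
in the charts of the atlas. -/
structure IsAnalyticLieGroup (K : Type u) [NontriviallyNormedField K]
    (E : Type v) [AddCommGroup E] [Module K E] [TopologicalSpace E]
    [IsTopologicalAddGroup E] [ContinuousSMul K E]
    (G : Type w) [Group G] [TopologicalSpace G] [ChartedSpace E G] : Prop where
  t2 : T2Space G
  topologicalGroup : IsTopologicalGroup G
  compatible : ∀ e₁ ∈ atlas E G, ∀ e₂ ∈ atlas E G,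
    LocallyAnalyticOn K (fun z : E => e₂ (e₁.symm z)) {z | z ∈ e₁.target ∧ e₁.symm z ∈ e₂.source}
  mul : ∀ e₁ ∈ atlas E G, ∀ e₂ ∈ atlas E G, ∀ e₃ ∈ atlas E G,
    LocallyAnalyticOn K (fun z : E × E => e₃ (e₁.symm z.1 * e₂.symm z.2))
      {z | z.1 ∈ e₁.target ∧ z.2 ∈ e₂.target ∧ e₁.symm z.1 * e₂.symm z.2 ∈ e₃.source}
  inv : ∀ e₁ ∈ atlas E G, ∀ e₂ ∈ atlas E G,
    LocallyAnalyticOn K (fun z : E => e₂ (e₁.symm z)⁻¹)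
      {z | z ∈ e₁.target ∧ (e₁.symm z)⁻¹ ∈ e₂.source}

end LieGroups

/-! ### Functions on the ball -/

section Functions

variable (K : Type u) [NontriviallyNormedField K] (ε : ℝ)

/-- The ball `{x : K | ‖x‖ < ε}`. -/
abbrev Ball : Type u := ↥(ball (0 : K) ε)

variable {K ε}

/-- Extension by zero of a function on the ball. -/
noncomputable def extZero (f : Ball K ε → K) : K → K := Function.extend Subtype.val f 0

theorem extZero_zero : extZero (0 : Ball K ε → K) = 0 := Function.extend_zero _

theorem extZero_add (f g : Ball K ε → K) : extZero (f + g) = extZero f + extZero g := by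
  have h := Function.extend_add (Subtype.val : Ball K ε → K) f g (0 : K → K) 0
  simpa [extZero] using h

theorem extZero_smul (c : K) (f : Ball K ε → K) : extZero (c • f) = c • extZero f := by
  have h := Function.extend_smul c (Subtype.val : Ball K ε → K) f (0 : K → K)
  simpa [extZero] using h

/-- `f` is given by a convergent power series near each point of the ball. -/
def LocallyAnalytic (f : Ball K ε → K) : Prop :=
  AnalyticOnNhd K (extZero f) (ball 0 ε)

/-- `f` is strictly differentiable at each point of the ball. -/
def StrictlyDifferentiable (f : Ball K ε → K) : Prop :=
  ∀ x ∈ ball (0 : K) ε, ∃ D : K →L[K] K, HasStrictFDerivAt (extZero f) D x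

variable (K ε)

/-- The space of locally analytic functions on the ball. -/
def locAnSubmodule : Submodule K (Ball K ε → K) where
  carrier := {f | LocallyAnalytic f}
  zero_mem' := by
    show AnalyticOnNhd K (extZero 0) _
    rw [extZero_zero]
    exact fun _ _ => analyticAt_const
  add_mem' {f g} hf hg := by
    show AnalyticOnNhd K (extZero (f + g)) _
    rw [extZero_add]
    exact fun x hx => (hf x hx).add (hg x hx)
  smul_mem' c f hf := by
    show AnalyticOnNhd K (extZero (c • f)) _
    rw [extZero_smul]
    exact fun x hx => analyticAt_const.smul (hf x hx)

/-- The space of locally analytic functions on the ball, as a type of its own (so that it does not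
inherit the topology of pointwise convergence). -/
def LocAn : Type u := ↥(locAnSubmodule K ε)

noncomputable instance : AddCommGroup (LocAn K ε) :=
  inferInstanceAs (AddCommGroup ↥(locAnSubmodule K ε))

noncomputable instance : Module K (LocAn K ε) :=
  inferInstanceAs (Module K ↥(locAnSubmodule K ε))

variable {K ε}

/-- The function underlying an element of `LocAn K ε`. -/
def LocAn.toFun (f : LocAn K ε) : Ball K ε → K := f.1

/-- On each disc of radius `r`, the function `f` is the sum of a power series
`∑ c j * (y - a) ^ j` with `‖c j‖ * r ^ j ≤ M` for all `j`. For fixed `r > 0`, the functions with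
this property for some `M` form a Banach space, whose norm is the least such `M`. -/
def BoundedOnDiscs (f : Ball K ε → K) (r M : ℝ) : Prop :=
  ∀ a : Ball K ε, ∃ c : ℕ → K, (∀ j, ‖c j‖ * r ^ j ≤ M) ∧
    ∀ y : Ball K ε, ‖(y : K) - a‖ < r → HasSum (fun j => c j * ((y : K) - a) ^ j) (f y)

variable (K ε)

/-- The ultrametric seminorms on the space of locally analytic functions whose restriction to
each of the Banach spaces of `BoundedOnDiscs` is continuous. -/
def IndLimSeminorm : Type u :=
  {q : Seminorm K (LocAn K ε) // (∀ f g, q (f + g) ≤ max (q f) (q g)) ∧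
    ∀ r : ℝ, 0 < r → ∃ C : ℝ, ∀ (f : LocAn K ε) (M : ℝ), BoundedOnDiscs f.toFun r M → q f ≤ C * M}

instance : Nonempty (IndLimSeminorm K ε) :=
  ⟨⟨0, fun _ _ => by simp, fun _ _ => ⟨0, fun _ _ _ => by simp⟩⟩⟩

/-- The family of all these seminorms. -/
def indLimSeminormFamily : SeminormFamily K (LocAn K ε) (IndLimSeminorm K ε) := fun q => q.1

/-- The locally convex inductive limit topology on the space of locally analytic functions. -/
noncomputable instance : TopologicalSpace (LocAn K ε) :=
  (indLimSeminormFamily K ε).moduleFilterBasis.topology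

instance : IsTopologicalAddGroup (LocAn K ε) :=
  (indLimSeminormFamily K ε).moduleFilterBasis.isTopologicalAddGroup

instance : ContinuousSMul K (LocAn K ε) :=
  (indLimSeminormFamily K ε).moduleFilterBasis.continuousSMul

/-- The space of locally analytic functions on the ball that vanish at `0`, with the
subspace topology. -/
def LocAnZero : Submodule K (LocAn K ε) where
  carrier := {f | ∀ x : Ball K ε, (x : K) = 0 → f.toFun x = 0}
  zero_mem' _ _ := rfl
  add_mem' {f g} hf hg x hx := by
    show f.toFun x + g.toFun x = 0
    rw [hf x hx, hg x hx, add_zero]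
  smul_mem' c f hf x hx := by
    show c * f.toFun x = 0
    rw [hf x hx, mul_zero]

/-- The maps `id + f` on the ball, with `f` locally analytic, `f 0 = 0` and with Lipschitz constant
smaller than `1`. -/
def DiffAn : Set (Ball K ε → K) :=
  {φ | ∃ f : Ball K ε → K, LocallyAnalytic f ∧ (∃ L : ℝ≥0, L < 1 ∧ LipschitzWith L f) ∧
    (∀ x : Ball K ε, (x : K) = 0 → f x = 0) ∧ ∀ x, φ x = x + f x}

/-- The maps `id + f` on the ball, with `f` strictly differentiable, `f 0 = 0` and with Lipschitz
constant smaller than `1`. -/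
def DiffOne : Set (Ball K ε → K) :=
  {φ | ∃ f : Ball K ε → K, StrictlyDifferentiable f ∧ (∃ L : ℝ≥0, L < 1 ∧ LipschitzWith L f) ∧
    (∀ x : Ball K ε, (x : K) = 0 → f x = 0) ∧ ∀ x, φ x = x + f x}

end Functions

end PadicDiff

/-! Over an ultrametric field a map id + f with Lip(f) < 1 is an isometry, and the fixed point
theorem for x ↦ y - f(x) makes it a bijection of the ball. Bounds Lip ≤ L pass to composites and
inverses by the strong triangle inequality, so the group statements reduce to closure of the
regularity class. In the C¹ case this is the chain rule together with the inverse function theorem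
at the derivative 1 + D, |D| < 1.

In the analytic case everything rests on bounds on discs. The ball is compact, so each locally
analytic f lies in some A_r. On small discs of radius s the non-constant part of such an f is a
series bounded by s itself (`BoundedOnDiscs.slopeBdd`), and then substitution loses neither radius
nor bound. Inverses are limits of iterates with common bounds. Bounded sets of series are compact
for pointwise convergence, so the bounds survive the limit (`bddOnDisc_of_tendsto`,
`SlopeBdd.disp_inv`).

The inductive limit has compact steps. On a ball of A_r pointwise convergence implies convergence in
the limit topology (`tendsto_of_pointwise`), and a map that is continuous on all such balls is
continuous (`continuousOn_of_pointwise`). For the latter, `exists_absorbing_addSubgroup` fits an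
absorbing lattice into a set that is open on each step, and the gauge of a lattice is one of the
defining seminorms (`mem_nhds_zero_of_absorbing`).

For local analyticity, Baire's theorem factors a continuous linear map from a Banach space through
some A_r (`exists_factorization`). Between these spaces f ∘ (b + x), with b constant on discs, is
the sum of x^k times the k-th Taylor coefficient of f at b: a power series in x, linear in f
(`fn_subst`). Multiplication is of this form. Inversion follows from the inverse function theorem
(`exists_analytic_inverse`) after a nearby diffeomorphism is written as (id + w) ∘ σ with w small.
-/

namespace PadicDiff

open Filter

/-! ### Power series on one disc: bounds, uniqueness, sums and products. -/

section Discs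

variable {K : Type u} [NontriviallyNormedField K] {ε : ℝ}

/-- On the disc of radius `r` about `a`, the function `f` is the sum of a power series
`∑ c j * (y - a) ^ j` with `‖c j‖ * r ^ j ≤ M` for all `j`. -/
def BddOnDisc (f : Ball K ε → K) (a : Ball K ε) (r M : ℝ) : Prop :=
  ∃ c : ℕ → K, (∀ j, ‖c j‖ * r ^ j ≤ M) ∧
    ∀ y : Ball K ε, ‖(y : K) - a‖ < r → HasSum (fun j => c j * ((y : K) - a) ^ j) (f y)

variable {f g : Ball K ε → K} {a b : Ball K ε} {r s M N : ℝ}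

theorem hasSum_congr_term {ι : Type*} {F G : ι → K} {z : K} (h : HasSum F z)
    (hFG : ∀ i, G i = F i) : HasSum G z :=
  (funext hFG : G = F) ▸ h

theorem hasSum_zero_pow (c : ℕ → K) : HasSum (fun j => c j * (0 : K) ^ j) (c 0) :=
  hasSum_congr_term (hasSum_ite_eq (0 : ℕ) (c 0)) fun j => by
    split_ifs with hj <;> simp [hj]

theorem norm_coeff_mul_pow_le {c : K} {j : ℕ} {t : K} (hr : 0 < r)
    (hc : ‖c‖ * r ^ j ≤ M) :
    ‖c * t ^ j‖ ≤ M * (‖t‖ / r) ^ j := by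
  rw [norm_mul, norm_pow, div_pow]
  calc ‖c‖ * ‖t‖ ^ j = (‖c‖ * r ^ j) * (‖t‖ ^ j / r ^ j) := by field_simp
    _ ≤ _ := by gcongr

theorem summable_geometric_bound {t : K} (hr : 0 < r) (ht : ‖t‖ < r) :
    Summable fun j : ℕ => M * (‖t‖ / r) ^ j :=
  (summable_geometric_of_lt_one (by positivity) ((div_lt_one hr).2 ht)).mul_left M

theorem BddOnDisc.nonneg (hr : 0 < r) (h : BddOnDisc f a r M) : 0 ≤ M := by
  obtain ⟨c, hc, -⟩ := h
  exact le_trans (by positivity) (hc 0)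

theorem BddOnDisc.mono (h : BddOnDisc f a r M) (hs : 0 < s) (hsr : s ≤ r) (hMN : M ≤ N) :
    BddOnDisc f a s N := by
  obtain ⟨c, hc, hf⟩ := h
  exact ⟨c, fun j => (by gcongr : ‖c j‖ * s ^ j ≤ ‖c j‖ * r ^ j).trans ((hc j).trans hMN),
    fun y hy => hf y (hy.trans_le hsr)⟩

theorem BddOnDisc.congr (h : BddOnDisc f a r M)
    (hfg : ∀ y : Ball K ε, ‖(y : K) - a‖ < r → f y = g y) : BddOnDisc g a r M := by
  obtain ⟨c, hc, hf⟩ := h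
  exact ⟨c, hc, fun y hy => hfg y hy ▸ hf y hy⟩

theorem bddOnDisc_const (c : K) : BddOnDisc (fun _ => c) a r ‖c‖ := by
  refine ⟨fun j => if j = 0 then c else 0, fun j => ?_, fun y _ => ?_⟩
  · by_cases hj : j = 0 <;> simp [hj]
  · refine hasSum_congr_term (hasSum_ite_eq (0 : ℕ) c) fun j => ?_
    by_cases hj : j = 0 <;> simp [hj]

theorem BddOnDisc.smul (c : K) (h : BddOnDisc f a r M) : BddOnDisc (c • f) a r (‖c‖ * M) := by
  obtain ⟨d, hd, hf⟩ := h
  refine ⟨fun j => c * d j, fun j => ?_, fun y hy => ?_⟩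
  · rw [norm_mul, mul_assoc]
    gcongr
    exact hd j
  · simpa [mul_assoc] using (hf y hy).mul_left c

theorem BddOnDisc.neg (h : BddOnDisc f a r M) : BddOnDisc (-f) a r M := by
  have := h.smul (-1)
  simpa using this

/-- Subtracting the value at the centre removes exactly the constant coefficient, so the new bound
is needed only from index 1 on. The hypothesis `h1` speaks of every expansion because the one inside
`BddOnDisc` is hidden by an existential. -/
theorem bddOnDisc_sub_const (hr : 0 < r) (ha : BddOnDisc f a r M)
    (h1 : ∀ c : ℕ → K, (∀ y : Ball K ε, ‖(y : K) - a‖ < r →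
      HasSum (fun j => c j * ((y : K) - a) ^ j) (f y)) → ∀ j, 1 ≤ j → ‖c j‖ * r ^ j ≤ N)
    (hN : 0 ≤ N) : BddOnDisc (fun y => f y - f a) a r N := by
  obtain ⟨c, hc, hf⟩ := ha
  have h0 : f a = c 0 := by
    have h2 := hf a (by simpa using hr)
    rw [sub_self] at h2
    exact h2.unique (hasSum_zero_pow c)
  refine ⟨fun j => if j = 0 then 0 else c j, fun j => ?_, fun y hy => ?_⟩
  · by_cases hj : j = 0
    · simpa [hj] using hN
    · simpa [hj] using h1 c hf j (Nat.one_le_iff_ne_zero.2 hj)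
  · rw [h0]
    refine hasSum_congr_term ((hf y hy).sub (hasSum_ite_eq (0 : ℕ) (c 0))) fun j => ?_
    by_cases hj : j = 0 <;> simp [hj]

theorem extZero_apply (f : Ball K ε → K) (y : Ball K ε) : extZero f (y : K) = f y :=
  Subtype.val_injective.extend_apply f 0 y

theorem hasFPowerSeriesAt_extZero (hr : 0 < r) {c : ℕ → K}
    (hc : ∀ y : Ball K ε, ‖(y : K) - a‖ < r → HasSum (fun j => c j * ((y : K) - a) ^ j) (f y)) :
    HasFPowerSeriesAt (extZero f) (FormalMultilinearSeries.ofScalars K c) (a : K) := by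
  rw [hasFPowerSeriesAt_iff]
  have h1 : ∀ᶠ z : K in 𝓝 0, (a : K) + z ∈ ball (0 : K) ε := by
    have : Tendsto (fun z : K => (a : K) + z) (𝓝 0) (𝓝 a) := by
      have : Continuous fun z : K => (a : K) + z := by fun_prop
      simpa using this.tendsto 0
    exact this (isOpen_ball.mem_nhds a.2)
  filter_upwards [h1, ball_mem_nhds (0 : K) hr] with z hz hzr
  have h2 := hc ⟨(a : K) + z, hz⟩ (by simpa using hzr)
  have h3 : extZero f ((a : K) + z) = f ⟨(a : K) + z, hz⟩ := extZero_apply f ⟨(a : K) + z, hz⟩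
  rw [h3]
  refine hasSum_congr_term h2 fun n => ?_
  rw [smul_eq_mul, mul_comm, FormalMultilinearSeries.coeff_ofScalars, add_sub_cancel_left]

/-- The ball is open, so both sequences expand the extension by zero near the centre, and the
identity principle for power series applies. This allows bounds obtained from different expansions
to be compared. -/
theorem coeff_unique (hr : 0 < r) {c d : ℕ → K}
    (hc : ∀ y : Ball K ε, ‖(y : K) - a‖ < r → HasSum (fun j => c j * ((y : K) - a) ^ j) (f y))
    (hd : ∀ y : Ball K ε, ‖(y : K) - a‖ < r → HasSum (fun j => d j * ((y : K) - a) ^ j) (f y)) :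
    c = d := by
  have h := (hasFPowerSeriesAt_extZero hr hc).eq_formalMultilinearSeries
    (hasFPowerSeriesAt_extZero hr hd)
  funext n
  have h2 := congrArg (fun p : FormalMultilinearSeries K K K => p.coeff n) h
  simpa using h2

variable [IsUltrametricDist K]

theorem BddOnDisc.add (hr : 0 < r) (hf : BddOnDisc f a r M) (hg : BddOnDisc g a r M) :
    BddOnDisc (f + g) a r M := by
  obtain ⟨c, hc, hf⟩ := hf
  obtain ⟨d, hd, hg⟩ := hg
  refine ⟨fun j => c j + d j, fun j => ?_, fun y hy => ?_⟩
  · calc ‖c j + d j‖ * r ^ j ≤ max ‖c j‖ ‖d j‖ * r ^ j := by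
          gcongr
          exact IsUltrametricDist.norm_add_le_max _ _
      _ = max (‖c j‖ * r ^ j) (‖d j‖ * r ^ j) := max_mul_of_nonneg _ _ (by positivity)
      _ ≤ M := max_le (hc j) (hd j)
  · simpa [add_mul] using (hf y hy).add (hg y hy)

theorem BddOnDisc.sub (hr : 0 < r) (hf : BddOnDisc f a r M) (hg : BddOnDisc g a r M) :
    BddOnDisc (f - g) a r M := by
  rw [sub_eq_add_neg]
  exact hf.add hr hg.neg

/-- Finite partial sums obey the bound by the strong triangle inequality, and a closed bound passes
to the limit. -/
theorem norm_hasSum_le {ι : Type*} {F : ι → K} {z : K} (h : HasSum F z) (hM : 0 ≤ M)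
    (hF : ∀ i, ‖F i‖ ≤ M) : ‖z‖ ≤ M :=
  le_of_tendsto h.norm (Eventually.of_forall fun _ =>
    IsUltrametricDist.norm_sum_le_of_forall_le_of_nonneg hM fun i _ => hF i)

theorem BddOnDisc.norm_le (hr : 0 < r) (h : BddOnDisc f a r M) {y : Ball K ε}
    (hy : ‖(y : K) - a‖ < r) : ‖f y‖ ≤ M := by
  have hM := h.nonneg hr
  obtain ⟨c, hc, hf⟩ := h
  refine norm_hasSum_le (hf y hy) hM fun j => (norm_coeff_mul_pow_le hr (hc j)).trans ?_
  exact mul_le_of_le_one_right hM (pow_le_one₀ (by positivity) ((div_le_one hr).2 hy.le))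

theorem bddOnDisc_sum {ι : Type*} (t : Finset ι) {F : ι → Ball K ε → K} (hr : 0 < r) (hM : 0 ≤ M)
    (hF : ∀ i ∈ t, BddOnDisc (F i) a r M) : BddOnDisc (∑ i ∈ t, F i) a r M := by
  classical
  induction t using Finset.induction_on with
  | empty =>
    have := (bddOnDisc_const (a := a) (r := r) (0 : K)).mono hr le_rfl (N := M) (by simpa using hM)
    rw [Finset.sum_empty]
    exact this
  | insert i t hi ih =>
    rw [Finset.sum_insert hi]
    exact (hF i (by simp)).add hr (ih fun j hj => hF j (by simp [hj]))

variable [CompleteSpace K]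

/-- The coefficients are those of the Cauchy product. An ultrametric sum is no larger than its
largest term, so the bounds multiply without a combinatorial factor. -/
theorem BddOnDisc.mul (hr : 0 < r) (hf : BddOnDisc f a r M) (hg : BddOnDisc g a r N) :
    BddOnDisc (f * g) a r (M * N) := by
  have hM := hf.nonneg hr
  have hN := hg.nonneg hr
  obtain ⟨c, hc, hf⟩ := hf
  obtain ⟨d, hd, hg⟩ := hg
  refine ⟨fun n => ∑ kl ∈ Finset.HasAntidiagonal.antidiagonal n, c kl.1 * d kl.2, fun n => ?_, fun y hy => ?_⟩
  · rw [← le_div_iff₀ (by positivity)]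
    refine IsUltrametricDist.norm_sum_le_of_forall_le_of_nonneg (by positivity) fun kl hkl => ?_
    rw [le_div_iff₀ (by positivity), norm_mul, ← Finset.HasAntidiagonal.mem_antidiagonal.1 hkl, pow_add]
    calc ‖c kl.1‖ * ‖d kl.2‖ * (r ^ kl.1 * r ^ kl.2)
        = (‖c kl.1‖ * r ^ kl.1) * (‖d kl.2‖ * r ^ kl.2) := by ring
      _ ≤ M * N := by
        gcongr
        exacts [hc _, hd _]
  · have hs1 : Summable fun j => ‖c j * ((y : K) - a) ^ j‖ :=
      (summable_geometric_bound hr hy).of_nonneg_of_le (fun _ => norm_nonneg _)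
        fun j => norm_coeff_mul_pow_le hr (hc j)
    have hs2 : Summable fun j => ‖d j * ((y : K) - a) ^ j‖ :=
      (summable_geometric_bound hr hy).of_nonneg_of_le (fun _ => norm_nonneg _)
        fun j => norm_coeff_mul_pow_le hr (hd j)
    have h1 := tsum_mul_tsum_eq_tsum_sum_antidiagonal_of_summable_norm hs1 hs2
    have h2 := (summable_norm_sum_mul_antidiagonal_of_summable_norm hs1 hs2).of_norm.hasSum
    rw [← h1, (hf y hy).tsum_eq, (hg y hy).tsum_eq] at h2
    refine hasSum_congr_term h2 fun n => ?_
    rw [Finset.sum_mul]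
    refine Finset.sum_congr rfl fun kl hkl => ?_
    rw [← Finset.HasAntidiagonal.mem_antidiagonal.1 hkl, pow_add]
    ring

theorem BddOnDisc.pow (hr : 0 < r) (hf : BddOnDisc f a r M) (n : ℕ) :
    BddOnDisc (f ^ n) a r (M ^ n) := by
  induction n with
  | zero =>
    have h := bddOnDisc_const (a := a) (r := r) (1 : K)
    rw [norm_one] at h
    rw [pow_zero, pow_zero]
    exact h
  | succ n ih => simpa only [pow_succ] using ih.mul hr hf

end Discs


/-! ### Increments of a power series on a disc and change of centre. -/

section Discs

variable {K : Type u} [NontriviallyNormedField K] {ε : ℝ}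
variable {f g : Ball K ε → K} {a b : Ball K ε} {r s M N : ℝ}
variable [IsUltrametricDist K]

theorem BddOnDisc.norm_sub_le (hr : 0 < r) (h : BddOnDisc f a r M) {y : Ball K ε}
    (hy : ‖(y : K) - a‖ < r) : ‖f y - f a‖ ≤ M / r * ‖(y : K) - a‖ := by
  have hM := h.nonneg hr
  obtain ⟨c, hc, hf⟩ := h
  have h0 := hf a (by simpa using hr)
  rw [sub_self] at h0
  refine norm_hasSum_le ((hf y hy).sub h0) (by positivity) fun j => ?_
  rcases j with _ | j
  · simp
    positivity
  · rw [zero_pow (Nat.succ_ne_zero j), mul_zero, sub_zero]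
    refine (norm_coeff_mul_pow_le hr (hc _)).trans ?_
    rw [pow_succ]
    have h1 : (‖(y : K) - a‖ / r) ^ j ≤ 1 := pow_le_one₀ (by positivity) ((div_le_one hr).2 hy.le)
    calc M * ((‖(y : K) - a‖ / r) ^ j * (‖(y : K) - a‖ / r))
        ≤ M * (1 * (‖(y : K) - a‖ / r)) := by gcongr
      _ = _ := by ring

variable [CompleteSpace K]

/-- A bounded power series on a disc can be expanded about any other point of the disc, with the
same bound. -/
theorem BddOnDisc.recenter (hr : 0 < r) (h : BddOnDisc f a r M) (hb : ‖(b : K) - a‖ < r) :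
    BddOnDisc f b r M := by
  have hM := h.nonneg hr
  obtain ⟨c, hc, hf⟩ := h
  -- Binomial coefficients have norm at most 1, which is why recentring costs nothing in the bound.
  have hnat : ∀ n : ℕ, ‖(n : K)‖ ≤ 1 := fun n => IsUltrametricDist.norm_natCast_le_one K n
  have hbound : ∀ (k i : ℕ), ‖c (k + i) * ((k + i).choose k : K)‖ * r ^ (k + i) ≤ M := by
    intro k i
    refine le_trans ?_ (hc (k + i))
    rw [norm_mul]
    gcongr
    exact mul_le_of_le_one_right (norm_nonneg _) (hnat _)
  have hterm : ∀ (k i : ℕ) (t : K),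
      ‖c (k + i) * ((k + i).choose k : K) * ((b : K) - a) ^ i * t ^ k‖ ≤
        M * ((‖t‖ / r) ^ k * (‖(b : K) - a‖ / r) ^ i) := by
    intro k i t
    have := hbound k i
    rw [norm_mul, norm_mul, norm_pow, norm_pow, div_pow, div_pow]
    calc ‖c (k + i) * ((k + i).choose k : K)‖ * ‖(b : K) - a‖ ^ i * ‖t‖ ^ k
        = (‖c (k + i) * ((k + i).choose k : K)‖ * r ^ (k + i)) *
          (‖t‖ ^ k / r ^ k * (‖(b : K) - a‖ ^ i / r ^ i)) := by
            rw [pow_add]; field_simp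
      _ ≤ _ := by gcongr
  have hgeo : ∀ t : K, ‖t‖ < r → Summable fun i : ℕ => (‖t‖ / r) ^ i := fun t ht =>
    summable_geometric_of_lt_one (by positivity) ((div_lt_one hr).2 ht)
  set d : ℕ → K := fun k => ∑' i, c (k + i) * ((k + i).choose k : K) * ((b : K) - a) ^ i with hd
  have hrow : ∀ k, Summable fun i => c (k + i) * ((k + i).choose k : K) * ((b : K) - a) ^ i := by
    intro k
    refine Summable.of_norm_bounded (((hgeo _ hb).mul_left (M / r ^ k))) fun i => ?_
    rw [norm_mul, norm_pow, div_pow, div_mul_div_comm, le_div_iff₀ (by positivity)]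
    calc _ = (‖c (k + i) * ((k + i).choose k : K)‖ * r ^ (k + i)) * ‖(b : K) - a‖ ^ i := by
          rw [pow_add]; ring
      _ ≤ _ := by
        gcongr
        exact hbound k i
  refine ⟨d, fun k => ?_, fun y hy => ?_⟩
  · rw [← le_div_iff₀ (by positivity)]
    refine norm_hasSum_le (hrow k).hasSum (by positivity) fun i => ?_
    rw [le_div_iff₀ (by positivity)]
    refine le_trans ?_ (hbound k i)
    rw [norm_mul, norm_pow, pow_add, mul_assoc, mul_comm (r ^ k)]
    gcongr
  · have hya : ‖(y : K) - a‖ < r := by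
      have : (y : K) - a = (y - b) + (b - a) := by ring
      rw [this]
      exact (IsUltrametricDist.norm_add_le_max _ _).trans_lt (max_lt hy hb)
    set G : ℕ × ℕ → K := fun p => c (p.1 + p.2) * ((p.1 + p.2).choose p.1 : K) *
      ((b : K) - a) ^ p.2 * ((y : K) - b) ^ p.1 with hG
    -- The double series is dominated by a product of two geometric series. Summed by rows it is the
    -- expansion about `b`; summed by antidiagonals it is the series about `a`, by the binomial
    -- theorem.
    have hsum : Summable G := by
      have h1 : Summable fun p : ℕ × ℕ =>
          (‖(y : K) - b‖ / r) ^ p.1 * (‖(b : K) - a‖ / r) ^ p.2 :=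
        (hgeo _ hy).mul_of_nonneg (hgeo _ hb) (fun _ => by positivity) (fun _ => by positivity)
      exact Summable.of_norm_bounded (h1.mul_left M) fun p => hterm p.1 p.2 _
    have h2 : HasSum (fun k => d k * ((y : K) - b) ^ k) (∑' p, G p) :=
      hsum.hasSum.prod_fiberwise fun k => (hrow k).hasSum.mul_right _
    have h3 : HasSum (fun j => c j * ((y : K) - a) ^ j) (∑' p, G p) := by
      have h4 := (Finset.HasAntidiagonal.sigmaAntidiagonalEquivProd (A := ℕ)).hasSum_iff.2
        hsum.hasSum
      refine h4.sigma fun j => ?_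
      have h5 : c j * ((y : K) - a) ^ j = ∑ p ∈ Finset.HasAntidiagonal.antidiagonal j, G p := by
        have h6 : (y : K) - a = (y - b) + (b - a) := by ring
        rw [h6, (Commute.all _ _).add_pow', Finset.mul_sum]
        refine Finset.sum_congr rfl fun p hp => ?_
        rw [hG, ← Finset.HasAntidiagonal.mem_antidiagonal.1 hp, nsmul_eq_mul]
        ring
      rw [h5]
      exact Finset.hasSum _ _
    rw [(hf y hya).unique h3]
    exact h2


end Discs

/-! ### Compactness of bounded sets of coefficients and closedness under pointwise limits. -/

section Compactness

variable {K : Type u} [NontriviallyNormedField K] {ε : ℝ}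
variable {f g : Ball K ε → K} {a b : Ball K ε} {r s M N : ℝ}

/-- The coefficient sequences with `‖c j‖ * r ^ j ≤ M`. -/
def coeffSet (K : Type u) [NontriviallyNormedField K] (r M : ℝ) : Set (ℕ → K) :=
  {c | ∀ j, ‖c j‖ * r ^ j ≤ M}

theorem isCompact_coeffSet [ProperSpace K] (hr : 0 < r) : IsCompact (coeffSet K r M) := by
  have : coeffSet K r M = Set.pi Set.univ fun j => closedBall (0 : K) (M / r ^ j) := by
    ext c
    simp [coeffSet, le_div_iff₀ (pow_pos hr _)]
  rw [this]
  exact isCompact_univ_pi fun j => isCompact_closedBall _ _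

/-- The functions on a disc with given coefficients. -/
noncomputable def evalDisc (a : Ball K ε) (r : ℝ) (c : ℕ → K)
    (y : {y : Ball K ε // ‖(y : K) - a‖ < r}) : K :=
  ∑' j, c j * ((y.1 : K) - a) ^ j

variable [CompleteSpace K]

theorem hasSum_evalDisc (hr : 0 < r) {c : ℕ → K} (hc : c ∈ coeffSet K r M)
    (y : {y : Ball K ε // ‖(y : K) - a‖ < r}) :
    HasSum (fun j => c j * ((y.1 : K) - a) ^ j) (evalDisc a r c y) :=
  (Summable.of_norm_bounded (summable_geometric_bound (M := M) hr y.2)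
    fun j => norm_coeff_mul_pow_le hr (hc j)).hasSum

/-- One geometric series dominates all the series with coefficients in `coeffSet`, so
coefficientwise convergence gives pointwise convergence on the disc. -/
theorem continuousOn_evalDisc (hr : 0 < r) (a : Ball K ε) :
    ContinuousOn (evalDisc a r) (coeffSet K r M) := by
  refine continuousOn_pi.2 fun y => ?_
  refine continuousOn_tsum (fun j => ?_) (summable_geometric_bound (M := M) hr y.2)
    fun j c hc => norm_coeff_mul_pow_le hr (hc j)
  fun_prop

theorem bddOnDisc_iff_mem_image (hr : 0 < r) :
    BddOnDisc f a r M ↔ (fun y : {y : Ball K ε // ‖(y : K) - a‖ < r} => f y.1) ∈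
      evalDisc a r '' coeffSet K r M := by
  constructor
  · rintro ⟨c, hc, hf⟩
    exact ⟨c, hc, funext fun y => (hf y.1 y.2).tsum_eq⟩
  · rintro ⟨c, hc, hf⟩
    refine ⟨c, hc, fun y hy => ?_⟩
    have := congrFun hf ⟨y, hy⟩
    simp only at this
    rw [← this]
    exact hasSum_evalDisc hr hc ⟨y, hy⟩

/-- The functions on the disc with a given bound are the continuous image of a compact set of
coefficients, hence closed in the topology of pointwise convergence. No uniformity of the
convergence is needed. -/
theorem bddOnDisc_of_tendsto [ProperSpace K] (hr : 0 < r) {ι : Type*} {l : Filter ι} [NeBot l]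
    {F : ι → Ball K ε → K} (hF : ∀ᶠ i in l, BddOnDisc (F i) a r M)
    (h : ∀ y : Ball K ε, ‖(y : K) - a‖ < r → Tendsto (fun i => F i y) l (𝓝 (f y))) :
    BddOnDisc f a r M := by
  rw [bddOnDisc_iff_mem_image hr]
  have hcl : IsClosed (evalDisc a r '' coeffSet K r M) :=
    ((isCompact_coeffSet hr).image_of_continuousOn (continuousOn_evalDisc hr a)).isClosed
  refine hcl.mem_of_tendsto (b := l) (f := fun i y => F i y.1) ?_ ?_
  · exact tendsto_pi_nhds.2 fun y => h y.1 y.2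
  · exact hF.mono fun i hi => (bddOnDisc_iff_mem_image hr).1 hi

variable [IsUltrametricDist K]

/-- Substitution of one series into another: each `c j • x ^ j` is bounded by `M`, hence so are the
partial sums, and the pointwise limit inherits the bound. No rearrangement of a double series is
involved. -/
theorem bddOnDisc_hasSum [ProperSpace K] {x : Ball K ε → K} (hr : 0 < r)
    {c : ℕ → K} (hM : 0 ≤ M) (hc : ∀ j, ‖c j‖ * s ^ j ≤ M) (hx : BddOnDisc x a r s)
    (hf : ∀ y : Ball K ε, ‖(y : K) - a‖ < r → HasSum (fun j => c j * x y ^ j) (f y)) :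
    BddOnDisc f a r M := by
  refine bddOnDisc_of_tendsto (l := atTop)
    (F := fun n : ℕ => ∑ j ∈ Finset.range n, c j • x ^ j) hr (Eventually.of_forall fun n => ?_)
    fun y hy => ?_
  · exact bddOnDisc_sum _ hr hM fun j _ => ((hx.pow hr j).smul (c j)).mono hr le_rfl (hc j)
  · simpa using (hf y hy).tendsto_sum_nat

end Compactness


/-! ### Uniform radii and bounds over the whole ball, and substitution. -/

section Analytic

variable {K : Type u} [NontriviallyNormedField K] {ε : ℝ}
variable {f g : Ball K ε → K} {a b : Ball K ε} {r s M N : ℝ}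

theorem BoundedOnDiscs.mono (h : BoundedOnDiscs f r M) (hs : 0 < s) (hsr : s ≤ r) (hMN : M ≤ N) :
    BoundedOnDiscs f s N :=
  fun a => BddOnDisc.mono (h a) hs hsr hMN

theorem BoundedOnDiscs.locallyAnalytic (hr : 0 < r) (h : BoundedOnDiscs f r M) :
    LocallyAnalytic f := by
  intro x hx
  obtain ⟨c, -, hf⟩ := h ⟨x, hx⟩
  exact ⟨_, hasFPowerSeriesAt_extZero (a := ⟨x, hx⟩) hr hf⟩

theorem bddOnDisc_of_analyticAt (h : AnalyticAt K (extZero f) (a : K)) :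
    ∃ r > 0, ∃ M, BddOnDisc f a r M := by
  obtain ⟨p, hp⟩ := h
  have hrad := hp.radius_pos
  obtain ⟨δ, hδ, hsum⟩ := Metric.eventually_nhds_iff.1 (hasFPowerSeriesAt_iff.1 hp)
  obtain ⟨t, ht0, ht⟩ := ENNReal.lt_iff_exists_nnreal_btwn.1 hrad
  obtain ⟨C, -, hC⟩ := p.norm_mul_pow_le_of_lt_radius ht
  have ht0' : (0 : ℝ) < t := by exact_mod_cast ht0
  -- The series represents `f` within distance `δ`, and its coefficients satisfy the bound at radius
  -- `t`, which lies below the radius of convergence.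
  refine ⟨min δ t, lt_min hδ ht0', C, p.coeff, fun j => ?_, fun y hy => ?_⟩
  · refine le_trans ?_ (hC j)
    rw [FormalMultilinearSeries.norm_apply_eq_norm_coef]
    have h0 : (0 : ℝ) ≤ min δ t := (lt_min hδ ht0').le
    gcongr
    exact min_le_right _ _
  · have h1 := @hsum ((y : K) - a) (by simpa using hy.trans_le (min_le_left _ _))
    rw [add_sub_cancel, extZero_apply] at h1
    exact hasSum_congr_term h1 fun n => by rw [smul_eq_mul, mul_comm]

theorem BoundedOnDiscs.neg (hf : BoundedOnDiscs f r M) : BoundedOnDiscs (-f) r M :=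
  fun a => BddOnDisc.neg (hf a)

theorem bddOnDisc_sub_self (hr : 0 < r) :
    BddOnDisc (fun y : Ball K ε => (y : K) - a) a r r := by
  refine ⟨fun j => if j = 1 then 1 else 0, fun j => ?_, fun y _ => ?_⟩
  · by_cases hj : j = 1
    · simp [hj]
    · simp [hj, hr.le]
  · refine hasSum_congr_term (hasSum_ite_eq (1 : ℕ) ((y : K) - a)) fun j => ?_
    by_cases hj : j = 1 <;> simp [hj]

/-- Around each point, the non-constant part of `f` is a power series bounded by the radius. -/
def SlopeBdd (f : Ball K ε → K) (r : ℝ) : Prop :=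
  ∀ a, BddOnDisc (fun y => f y - f a) a r r

theorem norm_sub_le_of_lipschitzWith {L : ℝ≥0} (hf : LipschitzWith L f) (x y : Ball K ε) :
    ‖f x - f y‖ ≤ L * ‖(x : K) - y‖ := by
  have := hf.dist_le_mul x y
  rwa [dist_eq_norm, Subtype.dist_eq, dist_eq_norm] at this

theorem lipschitzWith_of_norm_sub_le {L : ℝ≥0}
    (h : ∀ x y : Ball K ε, ‖f x - f y‖ ≤ L * ‖(x : K) - y‖) : LipschitzWith L f :=
  LipschitzWith.of_dist_le_mul fun x y => by
    rw [dist_eq_norm, Subtype.dist_eq, dist_eq_norm]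
    exact h x y

/-- The linear coefficient is the derivative, so the Lipschitz constant bounds it by 1. For j ≥ 2
one has |c_j| s^j ≤ M (s/r)^j ≤ M (s/r)², and this is at most s precisely because M s ≤ r². A bound
equal to the radius is what substitution into another series of that radius requires. -/
theorem BoundedOnDiscs.slopeBdd {L : ℝ≥0} (hr : 0 < r) (hf : BoundedOnDiscs f r M)
    (hL : L ≤ 1) (hLip : LipschitzWith L f) (hs : 0 < s) (hsr : s ≤ r) (hMs : M * s ≤ r ^ 2) :
    SlopeBdd f s := by
  intro a
  have hM : 0 ≤ M := BddOnDisc.nonneg hr (hf a)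
  obtain ⟨d, hd, hfd⟩ := hf a
  refine bddOnDisc_sub_const hs (BddOnDisc.mono (hf a) hs hsr le_rfl) (fun c hc j hj => ?_) hs.le
  obtain rfl : c = d := coeff_unique hs hc fun y hy => hfd y (hy.trans_le hsr)
  rcases hj.eq_or_lt with rfl | hj
  · have h1 := (hasFPowerSeriesAt_extZero hr hfd).hasDerivAt
    have h2 : LipschitzOnWith L (extZero f) (ball 0 ε) := by
      refine LipschitzOnWith.of_dist_le_mul fun x hx y hy => ?_
      have := hLip.dist_le_mul ⟨x, hx⟩ ⟨y, hy⟩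
      rwa [← extZero_apply f ⟨x, hx⟩, ← extZero_apply f ⟨y, hy⟩] at this
    have h3 := h1.le_of_lipschitzOn (isOpen_ball.mem_nhds a.2) h2
    have h4 : ‖c 1‖ ≤ 1 := by
      have h5 : (FormalMultilinearSeries.ofScalars K c 1 : (Fin 1 → K) → K) (fun _ => 1) = c 1 :=
        FormalMultilinearSeries.coeff_ofScalars
      rw [h5] at h3
      exact h3.trans (by exact_mod_cast hL)
    rw [pow_one]
    exact mul_le_of_le_one_left hs.le h4
  · obtain ⟨k, rfl⟩ := Nat.exists_eq_add_of_le hj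
    have h1 := hd (1 + 1 + k)
    have h2 : s ^ k ≤ r ^ k := by gcongr
    have h3 : ‖c (1 + 1 + k)‖ * s ^ (1 + 1 + k) * r ^ 2 ≤ M * s ^ 2 := by
      calc ‖c (1 + 1 + k)‖ * s ^ (1 + 1 + k) * r ^ 2
          = (‖c (1 + 1 + k)‖ * s ^ k * r ^ 2) * s ^ 2 := by ring
        _ ≤ (‖c (1 + 1 + k)‖ * r ^ k * r ^ 2) * s ^ 2 := by gcongr
        _ = (‖c (1 + 1 + k)‖ * r ^ (1 + 1 + k)) * s ^ 2 := by ring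
        _ ≤ M * s ^ 2 := by gcongr
    have h4 : M * s ^ 2 ≤ s * r ^ 2 := by nlinarith
    exact le_of_mul_le_mul_right (h3.trans h4) (by positivity)

variable [IsUltrametricDist K]

instance [ProperSpace K] : CompactSpace (Ball K ε) :=
  isCompact_iff_compactSpace.1
    (isCompact_of_isClosed_isBounded (IsUltrametricDist.isClosed_ball _ _) isBounded_ball)

/-- Each point has a disc with a bounded series, recentring extends the bound to every centre in
that disc, and finitely many such discs cover the compact ball. -/
theorem LocallyAnalytic.exists_boundedOnDiscs [ProperSpace K] (hf : LocallyAnalytic f) :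
    ∃ r > 0, ∃ M, BoundedOnDiscs f r M := by
  have key : ∃ r > 0, ∃ M, ∀ a ∈ (Set.univ : Set (Ball K ε)), BddOnDisc f a r M := by
    refine isCompact_univ.induction_on (p := fun S : Set (Ball K ε) =>
      ∃ r > 0, ∃ M, ∀ a ∈ S, BddOnDisc f a r M) ⟨1, one_pos, 0, by simp⟩ ?_ ?_ ?_
    · rintro S T hST ⟨r, hr, M, h⟩
      exact ⟨r, hr, M, fun a ha => h a (hST ha)⟩
    · rintro S T ⟨r, hr, M, h⟩ ⟨s, hs, N, h'⟩
      refine ⟨min r s, lt_min hr hs, max M N, fun a ha => ?_⟩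
      rcases ha with ha | ha
      · exact (h a ha).mono (lt_min hr hs) (min_le_left _ _) (le_max_left _ _)
      · exact (h' a ha).mono (lt_min hr hs) (min_le_right _ _) (le_max_right _ _)
    · intro x _
      obtain ⟨r, hr, M, h⟩ := bddOnDisc_of_analyticAt (hf x x.2)
      refine ⟨ball x r, mem_nhdsWithin_of_mem_nhds (ball_mem_nhds x hr), r, hr, M, fun a ha => ?_⟩
      exact h.recenter hr (by simpa [Subtype.dist_eq, dist_eq_norm] using ha)
  obtain ⟨r, hr, M, h⟩ := key
  exact ⟨r, hr, M, fun a => h a (Set.mem_univ a)⟩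

theorem BoundedOnDiscs.add (hr : 0 < r) (hf : BoundedOnDiscs f r M) (hg : BoundedOnDiscs g r M) :
    BoundedOnDiscs (f + g) r M :=
  fun a => BddOnDisc.add hr (hf a) (hg a)

theorem BddOnDisc.comp [ProperSpace K] {u : Ball K ε → Ball K ε} (hr : 0 < r) (hs : 0 < s)
    (hf : BddOnDisc f (u a) s M) (hu : BddOnDisc (fun y => (u y : K) - u a) a r s)
    (hmaps : ∀ y : Ball K ε, ‖(y : K) - a‖ < r → ‖(u y : K) - u a‖ < s) :
    BddOnDisc (fun y => f (u y)) a r M := by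
  have hM := hf.nonneg hs
  obtain ⟨c, hc, hf⟩ := hf
  exact bddOnDisc_hasSum hr hM hc hu fun y hy => hf (u y) (hmaps y hy)

theorem SlopeBdd.boundedOnDiscs (hr : 0 < r) (hf : SlopeBdd f r) (hM : ∀ a, ‖f a‖ ≤ M) :
    BoundedOnDiscs f r (max r M) := by
  intro a
  have h1 := (hf a).mono hr le_rfl (le_max_left r M)
  have h2 := (bddOnDisc_const (a := a) (r := r) (f a)).mono hr le_rfl
    ((hM a).trans (le_max_right r M))
  exact (h1.add hr h2).congr fun y _ => by simp

theorem SlopeBdd.add_id (hr : 0 < r) (hf : SlopeBdd f r) : SlopeBdd (fun y => (y : K) + f y) r :=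
  fun a => ((bddOnDisc_sub_self hr).add hr (hf a)).congr fun y _ => by simp; ring

theorem BoundedOnDiscs.norm_le (hr : 0 < r) (hf : BoundedOnDiscs f r M) (a : Ball K ε) :
    ‖f a‖ ≤ M :=
  BddOnDisc.norm_le hr (hf a) (by simpa using hr)

theorem BoundedOnDiscs.comp [ProperSpace K] {u : Ball K ε → Ball K ε} (hr : 0 < r) (hrs : r ≤ s)
    (hf : BoundedOnDiscs f s M) (hu : SlopeBdd (fun y => (u y : K)) r)
    (hmaps : ∀ x y : Ball K ε, ‖(u x : K) - u y‖ ≤ ‖(x : K) - y‖) :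
    BoundedOnDiscs (fun y => f (u y)) r M := fun a =>
  BddOnDisc.comp hr (hr.trans_le hrs) (hf (u a)) ((hu a).mono hr le_rfl hrs)
    fun y hy => (hmaps y a).trans_lt (hy.trans_le hrs)

end Analytic


/-! ### Contractive perturbations of the identity and their groups. -/

section Permutations

variable {K : Type u} [NontriviallyNormedField K] {ε : ℝ}

/-- The displacement `σ - id` of a permutation of the ball. -/
def disp (σ : Equiv.Perm (Ball K ε)) : Ball K ε → K := fun x => (σ x : K) - x

/-- The function `f` has Lipschitz constant smaller than `1` and vanishes at `0`. -/
def IsContr (f : Ball K ε → K) : Prop :=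
  (∃ L : ℝ≥0, L < 1 ∧ LipschitzWith L f) ∧ ∀ x : Ball K ε, (x : K) = 0 → f x = 0

variable {f : Ball K ε → K} {σ τ : Equiv.Perm (Ball K ε)} {r s M : ℝ} {L : ℝ≥0}

theorem norm_coe_lt (x : Ball K ε) : ‖(x : K)‖ < ε :=
  mem_ball_zero_iff.1 x.2

theorem coe_apply_eq_add_disp (σ : Equiv.Perm (Ball K ε)) (x : Ball K ε) :
    (σ x : K) = x + disp σ x := by
  simp [disp]

theorem disp_one : disp (1 : Equiv.Perm (Ball K ε)) = 0 := by
  funext x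
  simp [disp]

theorem disp_mul (σ τ : Equiv.Perm (Ball K ε)) :
    disp (σ * τ) = disp τ + fun x => disp σ (τ x) := by
  funext x
  simp [disp]

theorem disp_inv (σ : Equiv.Perm (Ball K ε)) : disp σ⁻¹ = -fun x => disp σ (σ⁻¹ x) := by
  funext x
  simp [disp]

theorem perm_apply_inv_self (σ : Equiv.Perm (Ball K ε)) (x : Ball K ε) : σ (σ⁻¹ x) = x :=
  σ.apply_symm_apply x

theorem disp_injective : Function.Injective (disp : Equiv.Perm (Ball K ε) → Ball K ε → K) := by
  intro σ τ h
  ext x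
  rw [coe_apply_eq_add_disp, coe_apply_eq_add_disp, h]

theorem norm_le_of_lipschitzWith (hf : LipschitzWith L f) (hL : L ≤ 1)
    (h0 : ∀ x : Ball K ε, (x : K) = 0 → f x = 0) (x : Ball K ε) : ‖f x‖ ≤ ‖(x : K)‖ := by
  have hε : 0 < ε := (norm_nonneg _).trans_lt (norm_coe_lt x)
  have h := norm_sub_le_of_lipschitzWith hf x ⟨0, by simpa using hε⟩
  rw [h0 ⟨0, _⟩ rfl, sub_zero, sub_zero] at h
  exact h.trans (mul_le_of_le_one_left (norm_nonneg _) (by exact_mod_cast hL))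

theorem IsContr.norm_le (hf : IsContr f) (x : Ball K ε) : ‖f x‖ ≤ ‖(x : K)‖ :=
  let ⟨⟨_, hL, hLip⟩, h0⟩ := hf
  norm_le_of_lipschitzWith hLip hL.le h0 x

theorem IsContr.norm_lt (hf : IsContr f) (x : Ball K ε) : ‖f x‖ < ε :=
  (hf.norm_le x).trans_lt (norm_coe_lt x)

theorem IsContr.disp_one : IsContr (disp (1 : Equiv.Perm (Ball K ε))) := by
  rw [PadicDiff.disp_one]
  exact ⟨⟨0, one_pos, LipschitzWith.const 0⟩, fun _ _ => rfl⟩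

theorem apply_eq_of_coe_eq_zero (h0 : ∀ x : Ball K ε, (x : K) = 0 → disp σ x = 0) {x : Ball K ε}
    (hx : (x : K) = 0) : σ x = x :=
  Subtype.ext (by rw [coe_apply_eq_add_disp, h0 x hx, add_zero])

theorem IsContr.slopeBdd (hr : 0 < r) (hf : IsContr f) (hb : BoundedOnDiscs f r M) (hs : 0 < s)
    (hsr : s ≤ r) (hMs : M * s ≤ r ^ 2) : SlopeBdd f s :=
  let ⟨⟨_, hL, hLip⟩, _⟩ := hf
  hb.slopeBdd hr hL.le hLip hs hsr hMs

variable [IsUltrametricDist K]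

/-- For x ≠ y the increment of f is strictly smaller than that of the identity, so the larger one
determines the norm of the sum: id + f is an isometry. -/
theorem norm_add_sub_add_eq (hL : L < 1) (hf : LipschitzWith L f) (x y : Ball K ε) :
    ‖((x : K) + f x) - (y + f y)‖ = ‖(x : K) - y‖ := by
  have h1 : ((x : K) + f x) - (y + f y) = (x - y) + (f x - f y) := by ring
  rw [h1]
  rcases eq_or_ne x y with rfl | hxy
  · simp
  have h2 := norm_sub_le_of_lipschitzWith hf x y
  have h3 : 0 < ‖(x : K) - y‖ := norm_pos_iff.2 (sub_ne_zero.2 (Subtype.coe_injective.ne hxy))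
  have h4 : ‖f x - f y‖ < ‖(x : K) - y‖ :=
    h2.trans_lt (mul_lt_of_lt_one_left h3 (by exact_mod_cast hL))
  rw [IsUltrametricDist.norm_add_eq_max_of_norm_ne_norm h4.ne', max_eq_left h4.le]

theorem IsContr.norm_add_sub_add_eq (hf : IsContr f) (x y : Ball K ε) :
    ‖((x : K) + f x) - (y + f y)‖ = ‖(x : K) - y‖ :=
  let ⟨⟨_, hL, hLip⟩, _⟩ := hf
  PadicDiff.norm_add_sub_add_eq hL hLip x y

theorem IsContr.norm_apply_sub_apply (hσ : IsContr (disp σ)) (x y : Ball K ε) :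
    ‖(σ x : K) - σ y‖ = ‖(x : K) - y‖ := by
  simpa only [← coe_apply_eq_add_disp] using hσ.norm_add_sub_add_eq x y

theorem add_mem_ball {x y : K} (hx : ‖x‖ < ε) (hy : ‖y‖ < ε) : x + y ∈ ball (0 : K) ε := by
  rw [mem_ball_zero_iff]
  exact (IsUltrametricDist.norm_add_le_max _ _).trans_lt (max_lt hx hy)

/-- Injectivity is the isometry property. A preimage of y is the fixed point of the contraction x ↦
y - f x; the ball is complete because it is closed in an ultrametric space. -/
theorem IsContr.exists_perm [CompleteSpace K] (hf : IsContr f) :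
    ∃ σ : Equiv.Perm (Ball K ε), disp σ = f := by
  have : CompleteSpace (Ball K ε) :=
    (IsUltrametricDist.isClosed_ball (0 : K) ε).isComplete.completeSpace_coe
  let F : Ball K ε → Ball K ε := fun x =>
    ⟨x + f x, add_mem_ball (norm_coe_lt x) (hf.norm_lt x)⟩
  have hinj : Function.Injective F := by
    intro x y hxy
    have h1 := hf.norm_add_sub_add_eq x y
    have h2 : (x : K) + f x = y + f y := congrArg Subtype.val hxy
    rw [h2, sub_self, norm_zero] at h1
    exact Subtype.ext (sub_eq_zero.1 (norm_eq_zero.1 h1.symm))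
  have hsurj : Function.Surjective F := by
    intro y
    obtain ⟨⟨L, hL, hLip⟩, h0⟩ := hf
    let T : Ball K ε → Ball K ε := fun x =>
      ⟨y + -f x, add_mem_ball (norm_coe_lt y)
        (by rw [norm_neg]; exact IsContr.norm_lt ⟨⟨L, hL, hLip⟩, h0⟩ x)⟩
    have hT : ContractingWith L T := by
      refine ⟨hL, LipschitzWith.of_dist_le_mul fun a b => ?_⟩
      rw [Subtype.dist_eq, dist_eq_norm, Subtype.dist_eq, dist_eq_norm]
      have h1 : ((T a : K) - T b) = f b - f a := by
        show (y : K) + -f a - (y + -f b) = f b - f a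
        ring
      rw [h1, norm_sub_rev]
      exact norm_sub_le_of_lipschitzWith hLip a b
    have : Nonempty (Ball K ε) := ⟨y⟩
    refine ⟨ContractingWith.fixedPoint T hT, Subtype.ext ?_⟩
    have h2 := congrArg Subtype.val hT.fixedPoint_isFixedPt.eq
    simp only [T, F] at h2 ⊢
    rw [← eq_add_neg_iff_add_eq]
    exact h2.symm
  refine ⟨Equiv.ofBijective F ⟨hinj, hsurj⟩, ?_⟩
  funext x
  show (x : K) + f x - x = f x
  ring

/-- The displacement of `σ * τ` is that of τ plus that of σ read after the isometry τ. Both summands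
have constant L, and in the ultrametric norm the constants do not add; hence every level L gives a
subgroup. -/
theorem lipschitzWith_disp_mul (hσ : LipschitzWith L (disp σ)) (hτ : LipschitzWith L (disp τ))
    (hL : L < 1) : LipschitzWith L (disp (σ * τ)) := by
  refine lipschitzWith_of_norm_sub_le fun x y => ?_
  have h1 : ‖(τ x : K) - τ y‖ = ‖(x : K) - y‖ := by
    simpa only [← coe_apply_eq_add_disp] using norm_add_sub_add_eq hL hτ x y
  have h2 := norm_sub_le_of_lipschitzWith hσ (τ x) (τ y)
  have h3 := norm_sub_le_of_lipschitzWith hτ x y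
  rw [h1] at h2
  have h4 : disp (σ * τ) x - disp (σ * τ) y =
      (disp τ x - disp τ y) + (disp σ (τ x) - disp σ (τ y)) := by
    rw [disp_mul, Pi.add_apply, Pi.add_apply]
    ring
  rw [h4]
  exact (IsUltrametricDist.norm_add_le_max _ _).trans (max_le h3 h2)

theorem lipschitzWith_disp_inv (hσ : LipschitzWith L (disp σ)) (hL : L < 1) :
    LipschitzWith L (disp σ⁻¹) := by
  refine lipschitzWith_of_norm_sub_le fun x y => ?_
  have h1 : ‖(σ (σ⁻¹ x) : K) - σ (σ⁻¹ y)‖ = ‖((σ⁻¹ x : Ball K ε) : K) - (σ⁻¹ y : Ball K ε)‖ := by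
    simpa only [← coe_apply_eq_add_disp] using norm_add_sub_add_eq hL hσ (σ⁻¹ x) (σ⁻¹ y)
  have h2 := norm_sub_le_of_lipschitzWith hσ (σ⁻¹ x) (σ⁻¹ y)
  rw [← h1, perm_apply_inv_self, perm_apply_inv_self] at h2
  rw [disp_inv, Pi.neg_apply, Pi.neg_apply, neg_sub_neg, norm_sub_rev]
  exact h2

theorem IsContr.disp_mul (hσ : IsContr (disp σ)) (hτ : IsContr (disp τ)) :
    IsContr (disp (σ * τ)) := by
  obtain ⟨⟨L, hL, hLip⟩, h0⟩ := hσ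
  obtain ⟨⟨L', hL', hLip'⟩, h0'⟩ := hτ
  refine ⟨⟨max L L', max_lt hL hL', lipschitzWith_disp_mul (hLip.weaken (le_max_left _ _))
    (hLip'.weaken (le_max_right _ _)) (max_lt hL hL')⟩, fun x hx => ?_⟩
  rw [PadicDiff.disp_mul, Pi.add_apply, apply_eq_of_coe_eq_zero h0' hx, h0 x hx, h0' x hx, add_zero]

theorem IsContr.disp_inv (hσ : IsContr (disp σ)) : IsContr (disp σ⁻¹) := by
  obtain ⟨⟨L, hL, hLip⟩, h0⟩ := hσ
  refine ⟨⟨L, hL, lipschitzWith_disp_inv hLip hL⟩, fun x hx => ?_⟩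
  have h1 : σ⁻¹ x = x := by
    rw [Equiv.Perm.inv_eq_iff_eq, apply_eq_of_coe_eq_zero h0 hx]
  rw [PadicDiff.disp_inv, Pi.neg_apply, h1, h0 x hx, neg_zero]

/-- The permutations `id + f` of the ball with `f 0 = 0`, `f` of Lipschitz constant smaller than
`1`, and `f` subject to a condition `P` that is preserved by the group operations. -/
def diffSubgroup (P : (Ball K ε → K) → Prop) (h1 : P 0)
    (hmul : ∀ σ τ : Equiv.Perm (Ball K ε), IsContr (disp σ) → IsContr (disp τ) →
      P (disp σ) → P (disp τ) → P (disp (σ * τ)))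
    (hinv : ∀ σ : Equiv.Perm (Ball K ε), IsContr (disp σ) → P (disp σ) → P (disp σ⁻¹)) :
    Subgroup (Equiv.Perm (Ball K ε)) where
  carrier := {σ | IsContr (disp σ) ∧ P (disp σ)}
  mul_mem' := fun hσ hτ => ⟨hσ.1.disp_mul hτ.1, hmul _ _ hσ.1 hτ.1 hσ.2 hτ.2⟩
  one_mem' := ⟨IsContr.disp_one, by rw [PadicDiff.disp_one]; exact h1⟩
  inv_mem' := fun hσ => ⟨hσ.1.disp_inv, hinv _ hσ.1 hσ.2⟩

/-- The elements of a group of permutations with displacement of Lipschitz constant at most `L`. -/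
def lipSubgroup (G : Subgroup (Equiv.Perm (Ball K ε))) (L : ℝ≥0) (hL : L < 1) : Subgroup G where
  carrier := {σ | LipschitzWith L (disp σ.1)}
  mul_mem' := fun hσ hτ => lipschitzWith_disp_mul hσ hτ hL
  one_mem' := by
    show LipschitzWith L (disp 1)
    rw [PadicDiff.disp_one]
    exact (LipschitzWith.const 0).weaken zero_le
  inv_mem' := fun hσ => lipschitzWith_disp_inv hσ hL

variable [ProperSpace K]

theorem BoundedOnDiscs.comp_perm (hr : 0 < r) (hrs : r ≤ s) (hf : BoundedOnDiscs f s M)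
    (hσ : IsContr (disp σ)) (hσr : SlopeBdd (disp σ) r) :
    BoundedOnDiscs (fun y => f (σ y)) r M := by
  refine hf.comp hr hrs ?_ fun x y => (hσ.norm_apply_sub_apply x y).le
  simpa only [← coe_apply_eq_add_disp] using hσr.add_id hr

/-- With f the displacement of σ, the inverse is the pointwise limit of the iterates u_{n+1}(y) = y
- f(u_n(y)). Substitution keeps the bound `r` on each iterate, and the bound is closed under
pointwise limits. -/
theorem SlopeBdd.disp_inv (hr : 0 < r) (hσ : IsContr (disp σ)) (hσr : SlopeBdd (disp σ) r) :
    SlopeBdd (disp σ⁻¹) r := by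
  have hcontr := hσ
  obtain ⟨⟨L, hL, hLip⟩, h0⟩ := hσ
  have hL' : (L : ℝ) < 1 := by exact_mod_cast hL
  let step : (Ball K ε → Ball K ε) → Ball K ε → Ball K ε := fun u y =>
    ⟨y + -disp σ (u y), add_mem_ball (norm_coe_lt y)
      (by rw [norm_neg]; exact hcontr.norm_lt _)⟩
  obtain ⟨u, hu0, hu⟩ : ∃ u : ℕ → Ball K ε → Ball K ε, (∀ y, u 0 y = y) ∧
      ∀ (n : ℕ) (y : Ball K ε), (u (n + 1) y : K) = (y : K) - disp σ (u n y) :=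
    ⟨fun n => step^[n] id, fun _ => rfl, fun n y => by
      simp only [Function.iterate_succ_apply']
      exact (sub_eq_add_neg (y : K) _).symm⟩
  have hLipu : ∀ (n : ℕ) (x y : Ball K ε), ‖(u n x : K) - (u n y : K)‖ ≤ ‖(x : K) - y‖ := by
    intro n
    induction n with
    | zero => exact fun x y => by rw [hu0, hu0]
    | succ n ih =>
      intro x y
      have h1 : (u (n + 1) x : K) - (u (n + 1) y : K) =
          (x - y) - (disp σ (u n x) - disp σ (u n y)) := by
        rw [hu, hu]; ring
      rw [h1, sub_eq_add_neg]
      refine (IsUltrametricDist.norm_add_le_max _ _).trans (max_le le_rfl ?_)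
      rw [norm_neg]
      refine (norm_sub_le_of_lipschitzWith hLip _ _).trans ?_
      exact (mul_le_of_le_one_left (norm_nonneg _) hL'.le).trans (ih x y)
  have hslope : ∀ n, SlopeBdd (fun y => (u n y : K)) r := by
    intro n
    induction n with
    | zero => exact fun a => by simpa only [hu0] using bddOnDisc_sub_self hr
    | succ n ih =>
      intro a
      have h1 := BddOnDisc.comp hr hr (hσr (u n a)) (ih a)
        fun y hy => (hLipu n y a).trans_lt hy
      refine ((bddOnDisc_sub_self hr).sub hr h1).congr fun y _ => ?_
      simp only [Pi.sub_apply, hu]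
      ring
  -- The point `σ⁻¹ y` is fixed by the iteration, so each step multiplies the error by at most `L`.
  have hlim : ∀ (n : ℕ) (y : Ball K ε), ‖(u n y : K) - (σ⁻¹ y : Ball K ε)‖ ≤
      L ^ n * ‖(y : K) - (σ⁻¹ y : Ball K ε)‖ := by
    intro n y
    induction n with
    | zero => simp [hu0]
    | succ n ih =>
      have h1 : (u (n + 1) y : K) - (σ⁻¹ y : Ball K ε) =
          disp σ (σ⁻¹ y) - disp σ (u n y) := by
        have h2 := coe_apply_eq_add_disp σ (σ⁻¹ y)
        rw [perm_apply_inv_self] at h2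
        rw [hu, h2]; ring
      rw [h1, norm_sub_rev, pow_succ']
      refine (norm_sub_le_of_lipschitzWith hLip _ _).trans ?_
      rw [mul_assoc]
      gcongr
  have htend : ∀ y : Ball K ε, Tendsto (fun n => (u n y : K)) atTop (𝓝 (σ⁻¹ y : Ball K ε)) := by
    intro y
    rw [tendsto_iff_norm_sub_tendsto_zero]
    refine squeeze_zero (fun _ => norm_nonneg _) (fun n => hlim n y) ?_
    simpa using (tendsto_pow_atTop_nhds_zero_of_lt_one L.2 hL').mul_const
      ‖(y : K) - (σ⁻¹ y : Ball K ε)‖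
  intro a
  have h3 : BddOnDisc (fun y => ((σ⁻¹ y : Ball K ε) : K) - (σ⁻¹ a : Ball K ε)) a r r :=
    bddOnDisc_of_tendsto (l := atTop) (F := fun n y => (u n y : K) - (u n a : K)) hr
      (Eventually.of_forall fun n => hslope n a) fun y _ => (htend y).sub (htend a)
  refine (h3.sub hr (bddOnDisc_sub_self hr)).congr fun y _ => ?_
  simp only [Pi.sub_apply, disp]
  ring

/-- A radius that is small enough for `IsContr.slopeBdd`. -/
theorem exists_radius (hr : 0 < r) (M : ℝ) :
    ∃ s > 0, s < r ∧ ∀ t, 0 < t → t ≤ s → M * t ≤ r ^ 2 := by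
  have hM : 0 < max M 1 := lt_max_of_lt_right one_pos
  refine ⟨min (r / 2) (r ^ 2 / max M 1), by positivity, ?_, fun t ht hts => ?_⟩
  · exact (min_le_left _ _).trans_lt (half_lt_self hr)
  · calc M * t ≤ max M 1 * t := by
          gcongr
          exact le_max_left _ _
      _ ≤ max M 1 * (r ^ 2 / max M 1) := by
          gcongr
          exact hts.trans (min_le_right _ _)
      _ = r ^ 2 := by field_simp

theorem exists_slopeBdd (hf : IsContr f) (ha : LocallyAnalytic f) :
    ∃ r > 0, ∀ s, 0 < s → s ≤ r → SlopeBdd f s := by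
  obtain ⟨r, hr, M, hb⟩ := ha.exists_boundedOnDiscs
  obtain ⟨s, hs, hsr, hMs⟩ := exists_radius hr M
  exact ⟨s, hs, fun t ht hts => hf.slopeBdd hr hb ht (hts.trans hsr.le) (hMs t ht hts)⟩

theorem boundedOnDiscs_disp_inv (hr : 0 < r) (hσ : IsContr (disp σ))
    (hσr : SlopeBdd (disp σ) r) : BoundedOnDiscs (disp σ⁻¹) r (max r ε) :=
  (hσr.disp_inv hr hσ).boundedOnDiscs hr fun a => (hσ.disp_inv.norm_lt a).le

theorem locallyAnalytic_disp_mul (hτ : IsContr (disp τ))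
    (hσa : LocallyAnalytic (disp σ)) (hτa : LocallyAnalytic (disp τ)) :
    LocallyAnalytic (disp (σ * τ)) := by
  obtain ⟨r, hr, M, hb⟩ := hσa.exists_boundedOnDiscs
  obtain ⟨s, hs, hsl⟩ := exists_slopeBdd hτ hτa
  have h1 : SlopeBdd (disp τ) (min r s) := hsl _ (lt_min hr hs) (min_le_right _ _)
  rw [disp_mul]
  exact (locAnSubmodule K ε).add_mem hτa
    ((hb.comp_perm (lt_min hr hs) (min_le_left _ _) hτ h1).locallyAnalytic (lt_min hr hs))

theorem locallyAnalytic_disp_inv (hσ : IsContr (disp σ)) (hσa : LocallyAnalytic (disp σ)) :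
    LocallyAnalytic (disp σ⁻¹) := by
  obtain ⟨s, hs, hsl⟩ := exists_slopeBdd hσ hσa
  exact (boundedOnDiscs_disp_inv hs hσ (hsl s hs le_rfl)).locallyAnalytic hs

/-- The group of locally analytic diffeomorphisms `id + f`. -/
def anSubgroup (K : Type u) [NontriviallyNormedField K] [IsUltrametricDist K] [ProperSpace K]
    (ε : ℝ) : Subgroup (Equiv.Perm (Ball K ε)) :=
  diffSubgroup LocallyAnalytic (locAnSubmodule K ε).zero_mem
    (fun _ _ _ hτ h h' => locallyAnalytic_disp_mul hτ h h')
    fun _ hσ h => locallyAnalytic_disp_inv hσ h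

end Permutations


/-! ### Absorbing lattices inside sets that are open on each compact step. -/

section Absorbing

variable {K : Type u} [NontriviallyNormedField K]

/-- In a topological vector space over a valued field, let `C n` be an increasing sequence of
compact submodules over the valuation ring. A set containing `0` that meets each `C n` in a
relatively open set contains a submodule over the valuation ring that absorbs each `C n`. -/
theorem exists_absorbing_addSubgroup {P : Type v} [AddCommGroup P] [Module K P]
    [TopologicalSpace P] [IsTopologicalAddGroup P] [ContinuousSMul K P]
    {C : ℕ → AddSubgroup P} (hC : ∀ n, IsCompact (C n : Set P)) (hmono : Monotone C)
    (hsmul : ∀ n (c : K), ‖c‖ ≤ 1 → ∀ x ∈ C n, c • x ∈ C n) {O : Set P} (h0 : (0 : P) ∈ O)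
    (hO : ∀ n, ∀ z ∈ O, z ∈ C n → O ∈ 𝓝[C n] z) :
    ∃ V : AddSubgroup P, (∀ c : K, ‖c‖ ≤ 1 → ∀ x ∈ V, c • x ∈ V) ∧ (V : Set P) ⊆ O ∧
      ∀ n, ∃ c : K, c ≠ 0 ∧ ∀ x ∈ C n, c • x ∈ V := by
  -- Stage `n` holds the compact lattices inside both `O` and `C n`; compactness is what permits the
  -- enlargement to the next stage.
  let S : ℕ → Type v := fun n => {D : AddSubgroup P // D ≤ C n ∧ IsCompact (D : Set P) ∧
    (∀ c : K, ‖c‖ ≤ 1 → ∀ x ∈ D, c • x ∈ D) ∧ (D : Set P) ⊆ O}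
  have hstep : ∀ n (D : S n), ∃ D' : S (n + 1), D.1 ≤ D'.1 ∧
      ∃ c : K, c ≠ 0 ∧ ∀ x ∈ C (n + 1), c • x ∈ D'.1 := by
    rintro n ⟨D, hDC, hDc, hDs, hDO⟩
    have hDC' : D ≤ C (n + 1) := hDC.trans (hmono n.le_succ)
    -- Tube argument: z + c • k tends to z as c tends to 0, and `O` is relatively open in `C (n +
    -- 1)`. By compactness one nonzero `c` serves all pairs, so `D` plus the multiple of `C (n + 1)`
    -- by `c` stays in `O`.
    have hev : ∀ᶠ c : K in 𝓝 0, ∀ p ∈ (D : Set P) ×ˢ (C (n + 1) : Set P),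
        ‖c‖ ≤ 1 → p ∈ (D : Set P) ×ˢ (C (n + 1) : Set P) → p.1 + c • p.2 ∈ O := by
      refine (hDc.prod (hC (n + 1))).eventually_forall_of_forall_eventually
        (P := fun c p => ‖c‖ ≤ 1 → p ∈ (D : Set P) ×ˢ (C (n + 1) : Set P) → p.1 + c • p.2 ∈ O) ?_
      rintro ⟨z, k⟩ ⟨hz, hk⟩
      have h1 := mem_nhdsWithin_iff_eventually.1 (hO (n + 1) z (hDO hz) (hDC' hz))
      have h2 : Tendsto (fun q : K × (P × P) => q.2.1 + q.1 • q.2.2) (𝓝 (0, (z, k))) (𝓝 z) := by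
        have h3 : Continuous fun q : K × (P × P) => q.2.1 + q.1 • q.2.2 := by fun_prop
        simpa using h3.tendsto (0, (z, k))
      filter_upwards [h2.eventually h1] with q hq hc hp
      exact hq ((C (n + 1)).add_mem (hDC' hp.1) (hsmul _ _ hc _ hp.2))
    obtain ⟨δ, hδ, hball⟩ := Metric.eventually_nhds_iff.1 hev
    obtain ⟨c, hc0, hc⟩ := NormedField.exists_norm_lt K (lt_min hδ one_pos)
    have hc1 : ‖c‖ ≤ 1 := (hc.trans_le (min_le_right _ _)).le
    have hcδ := hball (y := c) (by simpa using hc.trans_le (min_le_left _ _))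
    let T : AddSubgroup P := (C (n + 1)).map (DistribSMul.toAddMonoidHom P c)
    have hT : ∀ x, x ∈ T ↔ ∃ y ∈ C (n + 1), c • y = x := fun x => AddSubgroup.mem_map
    have hsup : ((D ⊔ T : AddSubgroup P) : Set P) =
        (fun p : P × P => p.1 + c • p.2) '' ((D : Set P) ×ˢ (C (n + 1) : Set P)) := by
      ext x
      simp only [SetLike.mem_coe, AddSubgroup.mem_sup, hT, Set.mem_image, Set.mem_prod,
        Prod.exists]
      constructor
      · rintro ⟨y, hy, z, ⟨w, hw, rfl⟩, rfl⟩
        exact ⟨y, w, ⟨hy, hw⟩, rfl⟩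
      · rintro ⟨y, w, ⟨hy, hw⟩, rfl⟩
        exact ⟨y, hy, _, ⟨w, hw, rfl⟩, rfl⟩
    refine ⟨⟨D ⊔ T, sup_le hDC' ?_, ?_, ?_, ?_⟩, le_sup_left, c, norm_pos_iff.1 hc0, ?_⟩
    · intro x hx
      obtain ⟨y, hy, rfl⟩ := (hT x).1 hx
      exact hsmul _ _ hc1 _ hy
    · rw [hsup]
      exact (hDc.prod (hC (n + 1))).image (by fun_prop)
    · intro d hd x hx
      obtain ⟨y, hy, z, hz, rfl⟩ := AddSubgroup.mem_sup.1 hx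
      obtain ⟨w, hw, rfl⟩ := (hT z).1 hz
      rw [smul_add, smul_comm d c]
      exact AddSubgroup.add_mem_sup (hDs d hd y hy) ((hT _).2 ⟨_, hsmul _ d hd w hw, rfl⟩)
    · rw [hsup]
      rintro _ ⟨p, hp, rfl⟩
      exact hcδ p hp hc1 hp
    · intro x hx
      exact (le_sup_right : T ≤ D ⊔ T) ((hT _).2 ⟨x, hx, rfl⟩)
  choose next hle habs using hstep
  let D0 : S 0 := ⟨⊥, bot_le, by simp, fun c _ x hx => by
    rw [AddSubgroup.mem_bot] at hx ⊢
    rw [hx, smul_zero], by simpa using h0⟩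
  let D : ∀ n, S n := fun n => Nat.rec D0 (fun n D => next n D) n
  have hDmono : Monotone fun n => (D n).1 := monotone_nat_of_le_succ fun n => hle n (D n)
  have hmem : ∀ x, x ∈ (⨆ n, (D n).1) ↔ ∃ n, x ∈ (D n).1 := fun x =>
    AddSubgroup.mem_iSup_of_directed hDmono.directed_le
  refine ⟨⨆ n, (D n).1, fun c hc x hx => ?_, fun x hx => ?_, fun n => ?_⟩
  · obtain ⟨n, hn⟩ := (hmem x).1 hx
    exact (hmem _).2 ⟨n, (D n).2.2.2.1 c hc x hn⟩
  · obtain ⟨n, hn⟩ := (hmem x).1 hx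
    exact (D n).2.2.2.2 hn
  · obtain ⟨c, hc, h⟩ := habs n (D n)
    exact ⟨c, hc, fun x hx => (hmem _).2 ⟨n + 1, h x (hmono n.le_succ hx)⟩⟩

end Absorbing

/-! ### Neighbourhoods of zero and convergence in the inductive limit. -/

section Topology

variable {K : Type u} [NontriviallyNormedField K] {ε : ℝ}

/-- A locally analytic function as an element of `LocAn K ε`. -/
def LocAn.mk (f : Ball K ε → K) (hf : LocallyAnalytic f) : LocAn K ε := ⟨f, hf⟩

theorem LocAn.toFun_mk (f : Ball K ε → K) (hf : LocallyAnalytic f) : (LocAn.mk f hf).toFun = f :=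
  rfl

theorem LocAn.locallyAnalytic (f : LocAn K ε) : LocallyAnalytic f.toFun := f.2

theorem LocAn.toFun_injective : Function.Injective (LocAn.toFun : LocAn K ε → Ball K ε → K) :=
  Subtype.val_injective

theorem LocAn.toFun_add (f g : LocAn K ε) : (f + g).toFun = f.toFun + g.toFun := rfl

theorem LocAn.toFun_sub (f g : LocAn K ε) : (f - g).toFun = f.toFun - g.toFun := rfl

theorem LocAn.toFun_neg (f : LocAn K ε) : (-f).toFun = -f.toFun := rfl

theorem LocAn.toFun_smul (c : K) (f : LocAn K ε) : (c • f).toFun = c • f.toFun := rfl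

theorem withSeminorms_indLimSeminormFamily :
    WithSeminorms (indLimSeminormFamily K ε) := ⟨rfl⟩

theorem exists_norm_between {k : K} (hk : 1 < ‖k‖) {M : ℝ} (hM : 0 < M) :
    ∃ d : K, d ≠ 0 ∧ M ≤ ‖d‖ ∧ ‖d‖ ≤ ‖k‖ * M := by
  obtain ⟨n, hn1, hn2⟩ := exists_mem_Ico_zpow hM hk
  have hk0 : k ≠ 0 := norm_pos_iff.1 (one_pos.trans hk)
  refine ⟨k ^ (n + 1), zpow_ne_zero _ hk0, by rw [norm_zpow]; exact hn2.le, ?_⟩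
  rw [norm_zpow, zpow_add_one₀ (one_pos.trans hk).ne', mul_comm]
  gcongr

theorem BoundedOnDiscs.smul {f : Ball K ε → K} {r M : ℝ} (hf : BoundedOnDiscs f r M) (c : K) :
    BoundedOnDiscs (c • f) r (‖c‖ * M) :=
  fun a => BddOnDisc.smul c (hf a)

variable [IsUltrametricDist K]

theorem BoundedOnDiscs.nonneg {f : Ball K ε → K} {r M : ℝ} (hε : 0 < ε) (hr : 0 < r)
    (hf : BoundedOnDiscs f r M) : 0 ≤ M :=
  (norm_nonneg _).trans (hf.norm_le hr ⟨0, by simpa using hε⟩)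

variable [ProperSpace K]

/-- A submodule over the valuation ring that absorbs the unit ball of each of the Banach spaces
of `BoundedOnDiscs` is a neighbourhood of zero. -/
theorem mem_nhds_zero_of_absorbing (hε : 0 < ε) (V : AddSubgroup (LocAn K ε))
    (hV : ∀ c : K, ‖c‖ ≤ 1 → ∀ f ∈ V, c • f ∈ V)
    (habs : ∀ r > 0, ∃ c : K, c ≠ 0 ∧ ∀ f : LocAn K ε, BoundedOnDiscs f.toFun r 1 → c • f ∈ V) :
    (V : Set (LocAn K ε)) ∈ 𝓝 0 := by
  -- The infimum of `A f` is the gauge of `V`. It is ultrametric because `V` is a module over the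
  -- valuation ring, and absorption bounds it on each A_r. It is therefore a defining seminorm, and
  -- where it is below 1 the function lies in `V`.
  let A : LocAn K ε → Set ℝ := fun f => {t | ∃ c : K, ‖c‖ = t ∧ ∃ g ∈ V, f = c • g}
  let q : LocAn K ε → ℝ := fun f => sInf (A f)
  have hbdd : ∀ f, BddBelow (A f) := fun f => ⟨0, by rintro _ ⟨c, rfl, -⟩; exact norm_nonneg c⟩
  have hscale : ∀ (f : LocAn K ε) (r : ℝ) (M : ℝ) (d : K), d ≠ 0 → M ≤ ‖d‖ → 0 < r →
      BoundedOnDiscs f.toFun r M → BoundedOnDiscs (d⁻¹ • f).toFun r 1 := by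
    intro f r M d hd hMd hr hb
    rw [LocAn.toFun_smul]
    refine (hb.smul d⁻¹).mono hr le_rfl ?_
    rw [norm_inv, inv_mul_le_iff₀ (norm_pos_iff.2 hd), mul_one]
    exact hMd
  have hmemA : ∀ (f : LocAn K ε) (r M : ℝ) (c d : K), c ≠ 0 → d ≠ 0 → M ≤ ‖d‖ → 0 < r →
      (∀ f : LocAn K ε, BoundedOnDiscs f.toFun r 1 → c • f ∈ V) →
      BoundedOnDiscs f.toFun r M → ‖d * c⁻¹‖ ∈ A f := by
    intro f r M c d hc hd hMd hr habs hb
    refine ⟨_, rfl, _, habs _ (hscale f r M d hd hMd hr hb), ?_⟩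
    have h1 : d * c⁻¹ * c * d⁻¹ = 1 := by field_simp
    rw [smul_smul, smul_smul, h1, one_smul]
  have hne : ∀ f, (A f).Nonempty := by
    intro f
    obtain ⟨r, hr, M, hb⟩ := f.locallyAnalytic.exists_boundedOnDiscs
    obtain ⟨c, hc, h⟩ := habs r hr
    obtain ⟨d, hd⟩ := NormedField.exists_lt_norm K (max M 0)
    exact ⟨_, hmemA f r M c d hc (norm_pos_iff.1 ((le_max_right _ _).trans_lt hd))
      ((le_max_left _ _).trans hd.le) hr h hb⟩
  have hle : ∀ (c : K) (g), g ∈ V → q (c • g) ≤ ‖c‖ := fun c g hg =>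
    csInf_le (hbdd _) ⟨c, rfl, g, hg, rfl⟩
  have hlt : ∀ f t, q f < t → ∃ c : K, ‖c‖ < t ∧ ∃ g ∈ V, f = c • g := by
    intro f t ht
    obtain ⟨_, ⟨c, rfl, hc⟩, hct⟩ := exists_lt_of_csInf_lt (hne f) ht
    exact ⟨c, hct, hc⟩
  have hnonneg : ∀ f, 0 ≤ q f := fun f =>
    le_csInf (hne f) (by rintro _ ⟨c, rfl, -⟩; exact norm_nonneg c)
  have hzero : q 0 = 0 := by
    refine le_antisymm ?_ (hnonneg 0)
    simpa using hle 0 0 V.zero_mem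
  have hultra : ∀ f g, q (f + g) ≤ max (q f) (q g) := by
    have key : ∀ (c d : K) (f g : LocAn K ε), ‖c‖ ≤ ‖d‖ → f ∈ V → g ∈ V →
        q (c • f + d • g) ≤ ‖d‖ := by
      intro c d f g hcd hf hg
      rcases eq_or_ne d 0 with rfl | hd
      · have hc : c = 0 := by simpa using hcd
        simp [hc, hzero]
      · have h1 : c • f + d • g = d • ((d⁻¹ * c) • f + g) := by
          rw [smul_add, smul_smul, mul_inv_cancel_left₀ hd]
        rw [h1]
        refine hle _ _ (V.add_mem (hV _ ?_ _ hf) hg)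
        rwa [norm_mul, norm_inv, inv_mul_le_iff₀ (norm_pos_iff.2 hd), mul_one]
    intro f g
    refine le_of_forall_gt fun t ht => ?_
    obtain ⟨c, hc, f', hf', rfl⟩ := hlt f t ((le_max_left _ _).trans_lt ht)
    obtain ⟨d, hd, g', hg', rfl⟩ := hlt g t ((le_max_right _ _).trans_lt ht)
    rcases le_total ‖c‖ ‖d‖ with h | h
    · exact (key c d f' g' h hf' hg').trans_lt hd
    · rw [add_comm]
      exact (key d c g' f' h hg' hf').trans_lt hc
  have hsmul : ∀ (a : K) f, q (a • f) ≤ ‖a‖ * q f := by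
    intro a f
    rcases eq_or_ne a 0 with rfl | ha
    · simp [hzero]
    · rw [← div_le_iff₀' (norm_pos_iff.2 ha)]
      refine le_csInf (hne f) ?_
      rintro _ ⟨c, rfl, g, hg, rfl⟩
      rw [div_le_iff₀' (norm_pos_iff.2 ha), smul_smul, ← norm_mul]
      exact hle _ _ hg
  let Q : Seminorm K (LocAn K ε) := Seminorm.ofSMulLE q hzero
    (fun f g => (hultra f g).trans (max_le_add_of_nonneg (hnonneg f) (hnonneg g))) hsmul
  have hQ : ∀ r : ℝ, 0 < r → ∃ C : ℝ, ∀ (f : LocAn K ε) (M : ℝ),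
      BoundedOnDiscs f.toFun r M → Q f ≤ C * M := by
    intro r hr
    obtain ⟨c, hc, h⟩ := habs r hr
    obtain ⟨k, hk⟩ := NormedField.exists_one_lt_norm K
    -- The factor `‖k‖` pays for rounding `M` up to the norm of a scalar, the factor `‖c⁻¹‖` for the
    -- absorption. No scalar can be chosen when `M = 0`, but then `f` vanishes.
    refine ⟨‖k‖ * ‖c⁻¹‖, fun f M hb => ?_⟩
    show q f ≤ _
    rcases (hb.nonneg hε hr).eq_or_lt with rfl | hM
    · have hf : f = 0 := LocAn.toFun_injective (funext fun a =>
        norm_le_zero_iff.1 (hb.norm_le hr a))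
      rw [hf, hzero, mul_zero]
    · obtain ⟨d, hd, h1, h2⟩ := exists_norm_between hk hM
      refine (csInf_le (hbdd f) (hmemA f r M c d hc hd h1 hr h hb)).trans ?_
      rw [norm_mul, mul_right_comm]
      gcongr
  have hcont : Continuous Q :=
    withSeminorms_indLimSeminormFamily.continuous_seminorm ⟨Q, hultra, hQ⟩
  have hnhds : {f | Q f < 1} ∈ 𝓝 (0 : LocAn K ε) :=
    (isOpen_lt hcont continuous_const).mem_nhds (by simp)
  filter_upwards [hnhds] with f hf
  obtain ⟨c, hc, g, hg, rfl⟩ := hlt f 1 hf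
  exact hV c hc.le g hg

/-- Passing from r to s < r makes all terms from some index J on uniformly small. The sequences with
a large term before J form a compact set, whose image in the functions on the disc is closed and
misses 0; functions close to 0 pointwise therefore avoid it. -/
theorem eventually_bddOnDisc {ι : Type*} {l : Filter ι} {F : ι → Ball K ε → K} {a : Ball K ε}
    {r s M δ : ℝ} (hs : 0 < s) (hsr : s < r) (hδ : 0 < δ)
    (hF : ∀ᶠ i in l, BddOnDisc (F i) a r M)
    (h : ∀ y : Ball K ε, Tendsto (fun i => F i y) l (𝓝 0)) :
    ∀ᶠ i in l, BddOnDisc (F i) a s δ := by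
  have hr : 0 < r := hs.trans hsr
  have hgeo : Tendsto (fun j : ℕ => M * (s / r) ^ j) atTop (𝓝 0) := by
    simpa using (tendsto_pow_atTop_nhds_zero_of_lt_one (by positivity)
      ((div_lt_one hr).2 hsr)).const_mul M
  obtain ⟨J, hJ⟩ := eventually_atTop.1 (hgeo.eventually (gt_mem_nhds hδ))
  have htail : ∀ c ∈ coeffSet K r M, ∀ j, J ≤ j → ‖c j‖ * s ^ j ≤ δ := by
    intro c hc j hj
    refine le_trans ?_ (hJ j hj).le
    rw [div_pow]
    calc ‖c j‖ * s ^ j = (‖c j‖ * r ^ j) * (s ^ j / r ^ j) := by field_simp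
      _ ≤ _ := by
        gcongr
        exact hc j
  let bad : Set (ℕ → K) := coeffSet K r M ∩ ⋃ j ∈ Finset.range J, {c | δ ≤ ‖c j‖ * s ^ j}
  have hbad : IsCompact bad := by
    refine (isCompact_coeffSet hr).inter_right ?_
    refine isClosed_biUnion_finset fun j _ => ?_
    exact isClosed_le continuous_const (by fun_prop)
  have himg : IsClosed (evalDisc a r '' bad) :=
    (hbad.image_of_continuousOn ((continuousOn_evalDisc hr a).mono Set.inter_subset_left)).isClosed
  have h0 : (0 : {y : Ball K ε // ‖(y : K) - a‖ < r} → K) ∉ evalDisc a r '' bad := by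
    rintro ⟨c, ⟨hc, hcb⟩, hc0⟩
    have h1 : c = 0 := by
      refine coeff_unique (f := (0 : Ball K ε → K)) (a := a) hr (fun y hy => ?_) fun y hy => ?_
      · have := hasSum_evalDisc hr hc ⟨y, hy⟩
        rwa [hc0] at this
      · simp
    obtain ⟨j, -, hj⟩ := Set.mem_iUnion₂.1 hcb
    rw [Set.mem_ofPred_eq, h1, Pi.zero_apply, norm_zero, zero_mul] at hj
    exact hδ.not_ge hj
  have htend : Tendsto (fun i (y : {y : Ball K ε // ‖(y : K) - a‖ < r}) => F i y.1) l (𝓝 0) :=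
    tendsto_pi_nhds.2 fun y => h y.1
  filter_upwards [hF, htend.eventually (himg.isOpen_compl.mem_nhds h0)] with i hi hi'
  obtain ⟨c, hc, hcF⟩ := hi
  refine ⟨c, fun j => ?_, fun y hy => hcF y (hy.trans hsr)⟩
  by_contra! hj
  rcases le_or_gt J j with hJj | hJj
  · exact absurd (htail c hc j hJj) hj.not_ge
  · refine hi' ⟨c, ⟨hc, Set.mem_iUnion₂.2 ⟨j, Finset.mem_range.2 hJj, hj.le⟩⟩, ?_⟩
    exact funext fun y => (hcF y.1 y.2).tsum_eq

theorem eventually_boundedOnDiscs {ι : Type*} {l : Filter ι} {F : ι → Ball K ε → K}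
    {r s M δ : ℝ} (hs : 0 < s) (hsr : s < r) (hδ : 0 < δ)
    (hF : ∀ᶠ i in l, BoundedOnDiscs (F i) r M)
    (h : ∀ y : Ball K ε, Tendsto (fun i => F i y) l (𝓝 0)) :
    ∀ᶠ i in l, BoundedOnDiscs (F i) s δ := by
  have key : ∀ᶠ i in l, ∀ a ∈ (Set.univ : Set (Ball K ε)), BddOnDisc (F i) a s δ := by
    refine isCompact_univ.induction_on
      (p := fun S : Set (Ball K ε) => ∀ᶠ i in l, ∀ a ∈ S, BddOnDisc (F i) a s δ) (by simp) ?_ ?_ ?_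
    · exact fun S T hST hT => hT.mono fun i hi a ha => hi a (hST ha)
    · intro S T hS hT
      filter_upwards [hS, hT] with i h1 h2 a ha
      exact ha.elim (h1 a) (h2 a)
    · intro x _
      refine ⟨ball x s, mem_nhdsWithin_of_mem_nhds (ball_mem_nhds x hs), ?_⟩
      filter_upwards [eventually_bddOnDisc hs hsr hδ (hF.mono fun i hi => hi x) h] with i hi a ha
      exact hi.recenter hs (by simpa [Subtype.dist_eq, dist_eq_norm] using ha)
  exact key.mono fun i hi a => hi a (Set.mem_univ a)

/-- On each ball of the Banach spaces of `BoundedOnDiscs`, pointwise convergence implies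
convergence in the inductive limit topology. -/
theorem tendsto_of_pointwise {ι : Type*} {l : Filter ι} {F : ι → LocAn K ε} {f : LocAn K ε}
    {r M : ℝ} (hr : 0 < r) (hF : ∀ᶠ i in l, BoundedOnDiscs (F i).toFun r M)
    (h : ∀ y : Ball K ε, Tendsto (fun i => (F i).toFun y) l (𝓝 (f.toFun y))) :
    Tendsto F l (𝓝 f) := by
  rcases l.eq_or_neBot with rfl | hl
  · exact tendsto_bot
  have hf : BoundedOnDiscs f.toFun r M := fun a =>
    bddOnDisc_of_tendsto hr (hF.mono fun i hi => hi a) fun y _ => h y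
  rw [withSeminorms_indLimSeminormFamily.tendsto_nhds]
  rintro ⟨q, hq, hqC⟩ η hη
  -- The seminorm is estimated at a smaller radius, where bounded pointwise convergence becomes
  -- convergence in norm. The later `|C| + 1` allows for `C ≤ 0`.
  obtain ⟨C, hC⟩ := hqC (r / 2) (half_pos hr)
  have hδ : 0 < η / (|C| + 1) := by positivity
  have h1 := eventually_boundedOnDiscs (F := fun i => (F i - f).toFun) (l := l) (half_pos hr)
    (half_lt_self hr) hδ (hF.mono fun i hi a => BddOnDisc.sub hr (hi a) (hf a))
    fun y => by simpa [LocAn.toFun_sub] using (h y).sub_const (f.toFun y)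
  filter_upwards [h1] with i hi
  calc q (F i - f) ≤ C * (η / (|C| + 1)) := hC _ _ hi
    _ ≤ |C| * (η / (|C| + 1)) := by
      gcongr
      exact le_abs_self C
    _ < (|C| + 1) * (η / (|C| + 1)) := by
      gcongr
      exact lt_add_one _
    _ = η := by field_simp

end Topology


/-! ### A continuity criterion on the space of functions vanishing at 0. -/

section Continuity

variable {K : Type u} [NontriviallyNormedField K] {ε : ℝ}

/-- The function underlying an element of `LocAnZero K ε`. -/
def zfn (f : LocAnZero K ε) : Ball K ε → K := f.1.toFun

theorem zfn_injective : Function.Injective (zfn : LocAnZero K ε → _) :=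
  LocAn.toFun_injective.comp Subtype.val_injective

theorem zfn_add (f g : LocAnZero K ε) : (zfn (f + g)) = zfn f + zfn g := rfl

theorem exists_zfn_eq {r M : ℝ} (hr : 0 < r) {f : Ball K ε → K}
    (hf : BoundedOnDiscs f r M) (h0 : ∀ x : Ball K ε, (x : K) = 0 → f x = 0) :
    ∃ g : LocAnZero K ε, zfn g = f :=
  ⟨⟨LocAn.mk f (hf.locallyAnalytic hr), h0⟩, rfl⟩

variable [IsUltrametricDist K]

/-- The functions that vanish at `0` and lie in the ball of radius `M` of the Banach space of
functions with parameter `r` in the sense of `BoundedOnDiscs`. -/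
def bddZero (K : Type u) [NontriviallyNormedField K] [IsUltrametricDist K] (ε : ℝ) {r M : ℝ}
    (hr : 0 < r) (hM : 0 ≤ M) : AddSubgroup (Ball K ε → K) where
  carrier := {f | BoundedOnDiscs f r M ∧ ∀ x : Ball K ε, (x : K) = 0 → f x = 0}
  add_mem' := fun hf hg => ⟨hf.1.add hr hg.1, fun x hx => by simp [hf.2 x hx, hg.2 x hx]⟩
  zero_mem' := ⟨fun a => (bddOnDisc_const (0 : K)).mono hr le_rfl (by simpa using hM),
    fun _ _ => rfl⟩
  neg_mem' := fun hf => ⟨hf.1.neg, fun x hx => by simp [hf.2 x hx]⟩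

theorem BoundedOnDiscs.sub_const {f : Ball K ε → K} {r M : ℝ} (hr : 0 < r)
    (hf : BoundedOnDiscs f r M) (a : Ball K ε) : BoundedOnDiscs (fun y => f y - f a) r M :=
  fun b => BddOnDisc.sub hr (hf b) ((bddOnDisc_const (f a)).mono hr le_rfl (hf.norm_le hr a))

variable [ProperSpace K]

/-- The set is closed because each disc condition is, and it lies in a product of closed balls of
radius `M`, compact by Tychonoff. -/
theorem isCompact_setOf_boundedOnDiscs {r M : ℝ} (hr : 0 < r) :
    IsCompact {f : Ball K ε → K | BoundedOnDiscs f r M} := by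
  have hcl : IsClosed {f : Ball K ε → K | BoundedOnDiscs f r M} := by
    have h1 : {f : Ball K ε → K | BoundedOnDiscs f r M} =
        ⋂ a : Ball K ε, (fun f (y : {y : Ball K ε // ‖(y : K) - a‖ < r}) => f y.1) ⁻¹'
          (evalDisc a r '' coeffSet K r M) := by
      ext f
      simp only [Set.mem_iInter, Set.mem_preimage, ← bddOnDisc_iff_mem_image hr]
      rfl
    rw [h1]
    refine isClosed_iInter fun a => IsClosed.preimage (by fun_prop) ?_
    exact ((isCompact_coeffSet hr).image_of_continuousOn (continuousOn_evalDisc hr a)).isClosed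
  refine (isCompact_univ_pi fun _ => isCompact_closedBall (0 : K) M).of_isClosed_subset hcl ?_
  intro f hf a _
  simpa using BoundedOnDiscs.norm_le hr hf a

theorem isCompact_bddZero {r M : ℝ} (hr : 0 < r) (hM : 0 ≤ M) :
    IsCompact (bddZero K ε hr hM : Set (Ball K ε → K)) := by
  refine (isCompact_setOf_boundedOnDiscs (M := M) hr).inter_right
    (t := {f | ∀ x : Ball K ε, (x : K) = 0 → f x = 0}) ?_
  simp only [Set.ofPred_forall]
  exact isClosed_iInter fun x => isClosed_iInter fun _ =>
    isClosed_eq (continuous_apply x) continuous_const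

theorem tendsto_locAnZero_of_pointwise {ι : Type*} {l : Filter ι} {F : ι → LocAnZero K ε}
    {f : LocAnZero K ε} {r M : ℝ} (hr : 0 < r) (hF : ∀ᶠ i in l, BoundedOnDiscs (zfn (F i)) r M)
    (h : ∀ y : Ball K ε, Tendsto (fun i => (zfn (F i)) y) l (𝓝 ((zfn f) y))) :
    Tendsto F l (𝓝 f) :=
  tendsto_subtype_rng.2 (tendsto_of_pointwise hr hF h)

/-- A map on an open set of pairs of functions is continuous as soon as it is continuous for
pointwise convergence on each of the balls of `BoundedOnDiscs`. -/
theorem continuousOn_of_pointwise (hε : 0 < ε) {T : Type*} [TopologicalSpace T]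
    {F : LocAnZero K ε × LocAnZero K ε → T} {U : Set (LocAnZero K ε × LocAnZero K ε)}
    (hU : IsOpen U)
    (hF : ∀ r > 0, ∀ M, ∀ z ∈ U, ∀ l : Filter (LocAnZero K ε × LocAnZero K ε),
      (∀ᶠ w in l, w ∈ U ∧ BoundedOnDiscs (zfn w.1) r M ∧ BoundedOnDiscs (zfn w.2) r M) →
      (∀ y : Ball K ε, Tendsto (fun w => (zfn w.1) y) l (𝓝 ((zfn z.1) y))) →
      (∀ y : Ball K ε, Tendsto (fun w => (zfn w.2) y) l (𝓝 ((zfn z.2) y))) →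
      Tendsto F l (𝓝 (F z))) : ContinuousOn F U := by
  intro x hx
  refine ContinuousAt.continuousWithinAt ?_
  obtain ⟨r₁, hr₁, M₁, hb₁⟩ := x.1.1.locallyAnalytic.exists_boundedOnDiscs
  obtain ⟨r₂, hr₂, M₂, hb₂⟩ := x.2.1.locallyAnalytic.exists_boundedOnDiscs
  obtain ⟨r₀, hr₀, M₀, hM₀, hx1, hx2⟩ : ∃ r > 0, ∃ M ≥ 0,
      BoundedOnDiscs (zfn x.1) r M ∧ BoundedOnDiscs (zfn x.2) r M :=
    ⟨min r₁ r₂, lt_min hr₁ hr₂, max M₁ M₂, (hb₁.nonneg hε hr₁).trans (le_max_left _ _),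
      hb₁.mono (lt_min hr₁ hr₂) (min_le_left _ _) (le_max_left _ _),
      hb₂.mono (lt_min hr₁ hr₂) (min_le_right _ _) (le_max_right _ _)⟩
  -- An exhaustion by shrinking radii and growing bounds, chosen so that both components of `x`
  -- satisfy the bounds of every step and translation by `x` stays within a step.
  have hr : ∀ n : ℕ, 0 < r₀ / (n + 1) := fun n => by positivity
  have hrle : ∀ n : ℕ, r₀ / (n + 1) ≤ r₀ := fun n =>
    div_le_self hr₀.le (by linarith [n.cast_nonneg (α := ℝ)])
  have hM : ∀ n : ℕ, 0 ≤ M₀ + n := fun n => by positivity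
  let κ : LocAnZero K ε × LocAnZero K ε → (Ball K ε → K) × (Ball K ε → K) :=
    fun z => ((zfn z.1), (zfn z.2))
  have hκ : Function.Injective κ := fun z w h =>
    Prod.ext (zfn_injective (congrArg Prod.fst h))
      (zfn_injective (congrArg Prod.snd h))
  let C : ℕ → AddSubgroup ((Ball K ε → K) × (Ball K ε → K)) := fun n =>
    (bddZero K ε (hr n) (hM n)).prod (bddZero K ε (hr n) (hM n))
  have hCmem : ∀ n p, p ∈ C n ↔ p.1 ∈ bddZero K ε (hr n) (hM n) ∧ p.2 ∈ bddZero K ε (hr n) (hM n) :=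
    fun n p => AddSubgroup.mem_prod
  have hCκ : ∀ n, ∀ p ∈ C n, ∃ z, κ z = p := by
    intro n p hp
    obtain ⟨h1, h2⟩ := (hCmem n p).1 hp
    obtain ⟨f, hf⟩ := exists_zfn_eq (hr n) h1.1 h1.2
    obtain ⟨g, hg⟩ := exists_zfn_eq (hr n) h2.1 h2.2
    exact ⟨(f, g), Prod.ext hf hg⟩
  intro N hN
  obtain ⟨O, hON, hO, hxO⟩ := mem_nhds_iff.1 hN
  -- The preimage of `O`, moved to the origin and read in the topology of pointwise convergence, in
  -- which the steps `C n` are compact.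
  let O' : Set ((Ball K ε → K) × (Ball K ε → K)) := κ '' {z | x + z ∈ U ∧ F (x + z) ∈ O}
  have h0 : (0 : (Ball K ε → K) × (Ball K ε → K)) ∈ O' :=
    ⟨0, by simpa using ⟨hx, hxO⟩, rfl⟩
  have hopen : ∀ n, ∀ p ∈ O', p ∈ C n → O' ∈ 𝓝[C n] p := by
    rintro n _ ⟨z, ⟨hzU, hzO⟩, rfl⟩ hz
    let l : Filter (LocAnZero K ε × LocAnZero K ε) := comap κ (𝓝[C n] (κ z))
    have hlC : ∀ᶠ w in l, κ w ∈ C n := (eventually_mem_nhdsWithin).comap κ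
    have hltend : Tendsto κ l (𝓝 (κ z)) := tendsto_comap.mono_right nhdsWithin_le_nhds
    have hl1 : ∀ y, Tendsto (fun w : LocAnZero K ε × LocAnZero K ε => (zfn w.1) y) l
        (𝓝 ((zfn z.1) y)) := fun y =>
      ((continuous_apply y).comp continuous_fst).continuousAt.tendsto.comp hltend
    have hl2 : ∀ y, Tendsto (fun w : LocAnZero K ε × LocAnZero K ε => (zfn w.2) y) l
        (𝓝 ((zfn z.2) y)) := fun y =>
      ((continuous_apply y).comp continuous_snd).continuousAt.tendsto.comp hltend
    have hxn1 := hx1.mono (hr n) (hrle n) (by simp : M₀ ≤ M₀ + n)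
    have hxn2 := hx2.mono (hr n) (hrle n) (by simp : M₀ ≤ M₀ + n)
    have hb : ∀ᶠ w in l, BoundedOnDiscs (zfn (x + w).1) (r₀ / (n + 1)) (M₀ + n) ∧
        BoundedOnDiscs (zfn (x + w).2) (r₀ / (n + 1)) (M₀ + n) := hlC.mono fun w hw =>
      ⟨hxn1.add (hr n) ((hCmem n _).1 hw).1.1, hxn2.add (hr n) ((hCmem n _).1 hw).2.1⟩
    have ht1 : ∀ y, Tendsto (fun w => (zfn (x + w).1) y) l (𝓝 ((zfn (x + z).1) y)) := fun y =>
      (hl1 y).const_add ((zfn x.1) y)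
    have ht2 : ∀ y, Tendsto (fun w => (zfn (x + w).2) y) l (𝓝 ((zfn (x + z).2) y)) := fun y =>
      (hl2 y).const_add ((zfn x.2) y)
    have hxw : Tendsto (fun w => x + w) l (𝓝 (x + z)) := by
      rw [nhds_prod_eq]
      exact (tendsto_locAnZero_of_pointwise (hr n) (hb.mono fun _ h => h.1) ht1).prodMk
        (tendsto_locAnZero_of_pointwise (hr n) (hb.mono fun _ h => h.2) ht2)
    have hevU : ∀ᶠ w in l, x + w ∈ U := hxw.eventually (hU.mem_nhds hzU)
    have hFt : Tendsto F (l.map fun w => x + w) (𝓝 (F (x + z))) := by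
      refine hF (r₀ / (n + 1)) (hr n) (M₀ + n) _ hzU _ ?_ ?_ ?_
      · exact eventually_map.2 (hevU.and hb)
      · exact fun y => tendsto_map'_iff.2 (ht1 y)
      · exact fun y => tendsto_map'_iff.2 (ht2 y)
    have hevO : ∀ᶠ w in l, F (x + w) ∈ O :=
      (tendsto_map'_iff.1 hFt).eventually (hO.mem_nhds hzO)
    obtain ⟨t, ht, hsub⟩ := mem_comap.1 (hevU.and hevO)
    filter_upwards [ht, self_mem_nhdsWithin] with p hp hpC
    obtain ⟨w, rfl⟩ := hCκ n p hpC
    exact ⟨w, hsub hp, rfl⟩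
  obtain ⟨V, hVs, hVO, hVabs⟩ := exists_absorbing_addSubgroup (K := K) (C := C)
    (fun n => (isCompact_bddZero (hr n) (hM n)).prod (isCompact_bddZero (hr n) (hM n)))
    (fun m n hmn p hp => by
      have h1 : r₀ / (n + 1) ≤ r₀ / (m + 1) := by gcongr
      have h2 : M₀ + m ≤ M₀ + n := by gcongr
      obtain ⟨⟨h3, h4⟩, h5, h6⟩ := (hCmem m p).1 hp
      exact (hCmem n p).2 ⟨⟨h3.mono (hr n) h1 h2, h4⟩, h5.mono (hr n) h1 h2, h6⟩)
    (fun n c hc p hp => by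
      obtain ⟨⟨h3, h4⟩, h5, h6⟩ := (hCmem n p).1 hp
      have h7 : ‖c‖ * (M₀ + n) ≤ M₀ + n := mul_le_of_le_one_left (hM n) hc
      exact (hCmem n _).2 ⟨⟨(h3.smul c).mono (hr n) le_rfl h7, fun y hy => by simp [h4 y hy]⟩,
        (h5.smul c).mono (hr n) le_rfl h7, fun y hy => by simp [h6 y hy]⟩)
    h0 hopen
  let z₀ : Ball K ε := ⟨0, by simpa using hε⟩
  have hz₀ : ∀ (f : LocAn K ε) (y : Ball K ε), (y : K) = 0 → f.toFun y - f.toFun z₀ = 0 := by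
    intro f y hy
    rw [show y = z₀ from Subtype.ext hy, sub_self]
  -- The criterion for neighbourhoods of zero concerns `LocAn K ε`, while the steps contain only
  -- functions vanishing at 0. Subtracting the value at `z₀` passes from one to the other and
  -- changes nothing on `LocAnZero K ε`. One map per coordinate suffices, since `V` is closed under
  -- addition.
  let κ₁ : LocAn K ε →+ (Ball K ε → K) × (Ball K ε → K) := AddMonoidHom.mk'
    (fun f => (fun y => f.toFun y - f.toFun z₀, 0)) fun f g =>
      Prod.ext (funext fun y => by simp [LocAn.toFun_add]; ring) (by simp)
  let κ₂ : LocAn K ε →+ (Ball K ε → K) × (Ball K ε → K) := AddMonoidHom.mk'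
    (fun f => (0, fun y => f.toFun y - f.toFun z₀)) fun f g =>
      Prod.ext (by simp) (funext fun y => by simp [LocAn.toFun_add]; ring)
  have hκ₁s : ∀ (c : K) f, κ₁ (c • f) = c • κ₁ f := fun c f =>
    Prod.ext (funext fun y => (mul_sub c _ _).symm) (smul_zero c).symm
  have hκ₂s : ∀ (c : K) f, κ₂ (c • f) = c • κ₂ f := fun c f =>
    Prod.ext (smul_zero c).symm (funext fun y => (mul_sub c _ _).symm)
  have hlarge : ∀ r > 0, ∃ n : ℕ, r₀ / (n + 1) ≤ r ∧ 1 ≤ M₀ + n := by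
    intro r hr'
    obtain ⟨n, hn⟩ := exists_nat_ge (max (r₀ / r) 1)
    refine ⟨n, ?_, ?_⟩
    · rw [div_le_iff₀ (by positivity), ← div_le_iff₀' hr']
      exact ((le_max_left _ _).trans hn).trans (by simp)
    · exact ((le_max_right _ _).trans hn).trans (by simpa using hM₀)
  have hbz : ∀ (r : ℝ), 0 < r → ∀ n : ℕ, r₀ / (n + 1) ≤ r → 1 ≤ M₀ + n → ∀ f : LocAn K ε,
      BoundedOnDiscs f.toFun r 1 →
      (fun y => f.toFun y - f.toFun z₀) ∈ bddZero K ε (hr n) (hM n) := fun r hr' n h1 h2 f hf =>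
    ⟨(hf.sub_const hr' z₀).mono (hr n) h1 h2, hz₀ f⟩
  have hV₁ : (V.comap κ₁ : Set (LocAn K ε)) ∈ 𝓝 0 := by
    refine mem_nhds_zero_of_absorbing hε _ (fun c hc f hf => ?_) fun r hr' => ?_
    · show κ₁ (c • f) ∈ V
      rw [hκ₁s]
      exact hVs c hc _ hf
    · obtain ⟨n, h1, h2⟩ := hlarge r hr'
      obtain ⟨c, hc, h⟩ := hVabs n
      refine ⟨c, hc, fun f hf => ?_⟩
      show κ₁ (c • f) ∈ V
      rw [hκ₁s]
      exact h _ ((hCmem n _).2 ⟨hbz r hr' n h1 h2 f hf, AddSubgroup.zero_mem _⟩)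
  have hV₂ : (V.comap κ₂ : Set (LocAn K ε)) ∈ 𝓝 0 := by
    refine mem_nhds_zero_of_absorbing hε _ (fun c hc f hf => ?_) fun r hr' => ?_
    · show κ₂ (c • f) ∈ V
      rw [hκ₂s]
      exact hVs c hc _ hf
    · obtain ⟨n, h1, h2⟩ := hlarge r hr'
      obtain ⟨c, hc, h⟩ := hVabs n
      refine ⟨c, hc, fun f hf => ?_⟩
      show κ₂ (c • f) ∈ V
      rw [hκ₂s]
      exact h _ ((hCmem n _).2 ⟨AddSubgroup.zero_mem _, hbz r hr' n h1 h2 f hf⟩)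
  have hsub : Tendsto (fun z => z - x) (𝓝 x) (𝓝 0) := by
    have h1 : Continuous fun z : LocAnZero K ε × LocAnZero K ε => z - x := by fun_prop
    simpa using h1.tendsto x
  have hp1 : Tendsto (fun z : LocAnZero K ε × LocAnZero K ε => (z.1 : LocAn K ε)) (𝓝 0) (𝓝 0) :=
    (continuous_subtype_val.comp continuous_fst).tendsto 0
  have hp2 : Tendsto (fun z : LocAnZero K ε × LocAnZero K ε => (z.2 : LocAn K ε)) (𝓝 0) (𝓝 0) :=
    (continuous_subtype_val.comp continuous_snd).tendsto 0
  have he1 : ∀ᶠ z in 𝓝 x, κ₁ (z - x).1.1 ∈ V := (hp1.comp hsub).eventually hV₁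
  have he2 : ∀ᶠ z in 𝓝 x, κ₂ (z - x).2.1 ∈ V := (hp2.comp hsub).eventually hV₂
  show ∀ᶠ z in 𝓝 x, F z ∈ N
  filter_upwards [he1, he2] with z hz1 hz2
  have hzV : κ (z - x) = κ₁ (z - x).1.1 + κ₂ (z - x).2.1 := by
    refine Prod.ext (funext fun y => ?_) (funext fun y => ?_)
    · have h1 : (z - x).1.1.toFun z₀ = 0 := (z - x).1.2 z₀ rfl
      show (z - x).1.1.toFun y = ((z - x).1.1.toFun y - (z - x).1.1.toFun z₀) + 0
      rw [h1, sub_zero, add_zero]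
    · have h1 : (z - x).2.1.toFun z₀ = 0 := (z - x).2.2 z₀ rfl
      show (z - x).2.1.toFun y = 0 + ((z - x).2.1.toFun y - (z - x).2.1.toFun z₀)
      rw [h1, sub_zero, zero_add]
  have hzO : κ (z - x) ∈ O' := hVO (by rw [hzV]; exact V.add_mem hz1 hz2)
  obtain ⟨w, ⟨-, hwO⟩, hw⟩ := hzO
  rw [hκ hw, add_sub_cancel] at hwO
  exact hON hwO

end Continuity


/-! ### The Banach algebras A_r and the substitution operator. -/

section BanachAlgebra

variable (K : Type u) [NontriviallyNormedField K] (ε : ℝ)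
variable [IsUltrametricDist K] [ProperSpace K]

/-- The functions on the ball that are given on the discs of radius `r` by uniformly bounded power
series. -/
def anSubalgebra (r : {r : ℝ // 0 < r}) : Subalgebra K (Ball K ε → K) where
  carrier := {f | ∃ M ≥ 0, BoundedOnDiscs f r M}
  mul_mem' := by
    rintro f g ⟨M, hM, hf⟩ ⟨N, hN, hg⟩
    exact ⟨M * N, mul_nonneg hM hN, fun a => BddOnDisc.mul r.2 (hf a) (hg a)⟩
  add_mem' := by
    rintro f g ⟨M, hM, hf⟩ ⟨N, hN, hg⟩
    exact ⟨max M N, hM.trans (le_max_left _ _), (hf.mono r.2 le_rfl (le_max_left _ _)).add r.2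
      (hg.mono r.2 le_rfl (le_max_right _ _))⟩
  algebraMap_mem' := fun c => ⟨‖c‖, norm_nonneg c, fun _ => bddOnDisc_const c⟩

/-- The Banach algebra of the functions on the ball that are given on the discs of radius `r` by
uniformly bounded power series. -/
def AnR (r : {r : ℝ // 0 < r}) : Type u := ↥(anSubalgebra K ε r)

variable {K ε} {r s : {r : ℝ // 0 < r}}

/-- The function underlying an element of `AnR K ε r`. -/
def AnR.fn (f : AnR K ε r) : Ball K ε → K := f.1

/-- An element of `AnR K ε r` from a function. -/
def AnR.mk (f : Ball K ε → K) {M : ℝ} (hM : 0 ≤ M) (hf : BoundedOnDiscs f r M) : AnR K ε r :=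
  ⟨f, M, hM, hf⟩

theorem AnR.fn_mk (f : Ball K ε → K) {M : ℝ} (hM : 0 ≤ M) (hf : BoundedOnDiscs f r M) :
    (AnR.mk f hM hf).fn = f := rfl

theorem AnR.fn_injective : Function.Injective (AnR.fn : AnR K ε r → Ball K ε → K) :=
  Subtype.val_injective

instance instCommRingAnR : CommRing (AnR K ε r) := inferInstanceAs (CommRing (anSubalgebra K ε r))

instance instAlgebraAnR : Algebra K (AnR K ε r) :=
  inferInstanceAs (Algebra K (anSubalgebra K ε r))

theorem AnR.fn_add (f g : AnR K ε r) : (f + g).fn = f.fn + g.fn := rfl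

theorem AnR.fn_mul (f g : AnR K ε r) : (f * g).fn = f.fn * g.fn := rfl

theorem AnR.fn_sub (f g : AnR K ε r) : (f - g).fn = f.fn - g.fn := rfl

theorem AnR.fn_smul (c : K) (f : AnR K ε r) : (c • f).fn = c • f.fn := rfl

theorem AnR.fn_pow (f : AnR K ε r) (n : ℕ) : (f ^ n).fn = f.fn ^ n := rfl

/-- The least bound of the power series representing an element of `AnR K ε r`. -/
noncomputable def AnR.bound (f : AnR K ε r) : ℝ := sInf {M | 0 ≤ M ∧ BoundedOnDiscs f.fn r M}

theorem AnR.bound_nonneg (f : AnR K ε r) : 0 ≤ f.bound :=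
  Real.sInf_nonneg fun _ h => h.1

/-- The infimum is attained: the coefficients on a disc are unique, so the same sequence obeys every
admissible bound. -/
theorem AnR.boundedOnDiscs_bound (f : AnR K ε r) : BoundedOnDiscs f.fn r f.bound := by
  intro a
  obtain ⟨M, hM, hf⟩ := f.2
  obtain ⟨c, hc, hcf⟩ := hf a
  refine ⟨c, fun j => le_csInf ⟨M, hM, hf⟩ ?_, hcf⟩
  rintro N ⟨-, hN⟩
  obtain ⟨d, hd, hdf⟩ := hN a
  rw [coeff_unique (f := f.fn) r.2 hcf hdf]
  exact hd j

theorem AnR.bound_le {f : AnR K ε r} {M : ℝ} (hM : 0 ≤ M) (hf : BoundedOnDiscs f.fn r M) :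
    f.bound ≤ M :=
  csInf_le ⟨0, fun _ h => h.1⟩ ⟨hM, hf⟩

theorem AnR.bound_add_le (f g : AnR K ε r) : (f + g).bound ≤ max f.bound g.bound :=
  AnR.bound_le (f.bound_nonneg.trans (le_max_left _ _))
    ((f.boundedOnDiscs_bound.mono r.2 le_rfl (le_max_left _ _)).add r.2
      (g.boundedOnDiscs_bound.mono r.2 le_rfl (le_max_right _ _)))

/-- The norm on `AnR K ε r`. -/
noncomputable def AnR.ringNorm : RingNorm (AnR K ε r) where
  toFun := AnR.bound
  map_zero' := le_antisymm (AnR.bound_le le_rfl fun a =>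
    (bddOnDisc_const (0 : K)).mono r.2 le_rfl (by simp)) (AnR.bound_nonneg _)
  add_le' f g := (AnR.bound_add_le f g).trans
    (max_le_add_of_nonneg f.bound_nonneg g.bound_nonneg)
  neg' f := by
    have h : ∀ f : AnR K ε r, (-f).bound ≤ f.bound := fun f =>
      AnR.bound_le f.bound_nonneg f.boundedOnDiscs_bound.neg
    refine le_antisymm (h f) ?_
    simpa using h (-f)
  mul_le' f g := AnR.bound_le (mul_nonneg f.bound_nonneg g.bound_nonneg) fun a =>
    BddOnDisc.mul r.2 (f.boundedOnDiscs_bound a) (g.boundedOnDiscs_bound a)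
  eq_zero_of_map_eq_zero' f hf := by
    refine AnR.fn_injective (funext fun a => norm_le_zero_iff.1 ?_)
    rw [← hf]
    exact f.boundedOnDiscs_bound.norm_le r.2 a

noncomputable instance : NormedCommRing (AnR K ε r) :=
  { RingNorm.toNormedRing AnR.ringNorm with mul_comm := mul_comm }

theorem AnR.boundedOnDiscs (f : AnR K ε r) : BoundedOnDiscs f.fn r ‖f‖ := f.boundedOnDiscs_bound

theorem AnR.norm_le {f : AnR K ε r} {M : ℝ} (hM : 0 ≤ M) (hf : BoundedOnDiscs f.fn r M) :
    ‖f‖ ≤ M := AnR.bound_le hM hf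

theorem AnR.norm_fn_le (f : AnR K ε r) (y : Ball K ε) : ‖f.fn y‖ ≤ ‖f‖ :=
  f.boundedOnDiscs.norm_le r.2 y

noncomputable instance : NormedAlgebra K (AnR K ε r) :=
  { instAlgebraAnR with
    norm_smul_le := fun c f => AnR.norm_le (by positivity) (f.boundedOnDiscs.smul c) }

instance : IsUltrametricDist (AnR K ε r) :=
  IsUltrametricDist.isUltrametricDist_of_forall_norm_add_le_max_norm AnR.bound_add_le

/-- A Cauchy sequence converges pointwise, and a bound on `F n - F m` survives the pointwise limit
in `m`. -/
instance : CompleteSpace (AnR K ε r) := by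
  refine Metric.complete_of_cauchySeq_tendsto fun F hF => ?_
  have hpt : ∀ y, CauchySeq fun n => (F n).fn y := by
    intro y
    rw [Metric.cauchySeq_iff] at hF ⊢
    intro δ hδ
    obtain ⟨N, hN⟩ := hF δ hδ
    refine ⟨N, fun m hm n hn => ?_⟩
    rw [dist_eq_norm]
    refine lt_of_le_of_lt ?_ (hN m hm n hn)
    rw [dist_eq_norm]
    exact (F m - F n).norm_fn_le y
  choose f hf using fun y => cauchySeq_tendsto_of_complete (hpt y)
  have key : ∀ δ > 0, ∃ N, ∀ n ≥ N, BoundedOnDiscs ((F n).fn - f) r δ := by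
    intro δ hδ
    obtain ⟨N, hN⟩ := Metric.cauchySeq_iff.1 hF δ hδ
    refine ⟨N, fun n hn a => ?_⟩
    refine bddOnDisc_of_tendsto (l := atTop) (F := fun m => (F n - F m).fn) r.2 ?_ fun y _ => ?_
    · filter_upwards [eventually_ge_atTop N] with m hm
      have h1 := hN n hn m hm
      rw [dist_eq_norm] at h1
      exact ((F n - F m).boundedOnDiscs.mono r.2 le_rfl h1.le) a
    · exact (hf y).const_sub ((F n).fn y)
  have hmem : ∃ g : AnR K ε r, g.fn = f := by
    obtain ⟨N, hN⟩ := key 1 one_pos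
    refine ⟨F N - AnR.mk _ zero_le_one (hN N le_rfl), ?_⟩
    rw [AnR.fn_sub, AnR.fn_mk, sub_sub_cancel]
  obtain ⟨g, rfl⟩ := hmem
  refine ⟨g, Metric.tendsto_atTop.2 fun δ hδ => ?_⟩
  obtain ⟨N, hN⟩ := key (δ / 2) (half_pos hδ)
  refine ⟨N, fun n hn => ?_⟩
  rw [dist_eq_norm]
  exact (AnR.norm_le (half_pos hδ).le (hN n hn)).trans_lt (half_lt_self hδ)

theorem AnR.norm_one_le : ‖(1 : AnR K ε r)‖ ≤ 1 :=
  AnR.norm_le zero_le_one fun a => by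
    have h := bddOnDisc_const (a := a) (r := r.1) (1 : K)
    rw [norm_one] at h
    exact h

/-- Evaluation at a point. -/
noncomputable def AnR.evalCLM (y : Ball K ε) : AnR K ε r →L[K] K :=
  LinearMap.mkContinuous ⟨⟨fun f => f.fn y, fun _ _ => rfl⟩, fun _ _ => rfl⟩ 1 fun f => by
    rw [one_mul]
    exact f.norm_fn_le y

theorem AnR.evalCLM_apply (y : Ball K ε) (f : AnR K ε r) : AnR.evalCLM y f = f.fn y := rfl

/-- The inclusion of `AnR K ε r` into `AnR K ε s` for `s ≤ r`. -/
noncomputable def AnR.res (h : s.1 ≤ r.1) : AnR K ε r →L[K] AnR K ε s :=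
  LinearMap.mkContinuous
    ⟨⟨fun f => AnR.mk f.fn (norm_nonneg f) (f.boundedOnDiscs.mono s.2 h le_rfl),
      fun _ _ => rfl⟩, fun _ _ => rfl⟩ 1 fun f => by
    rw [one_mul]
    exact AnR.norm_le (norm_nonneg f) (f.boundedOnDiscs.mono s.2 h le_rfl)

/-- The coefficients of the power series about `a` of an element of `AnR K ε r`. -/
noncomputable def AnR.taylor (f : AnR K ε r) (a : Ball K ε) : ℕ → K := (f.boundedOnDiscs a).choose

theorem AnR.norm_taylor_mul_le (f : AnR K ε r) (a : Ball K ε) (k : ℕ) :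
    ‖f.taylor a k‖ * r.1 ^ k ≤ ‖f‖ := (f.boundedOnDiscs a).choose_spec.1 k

theorem AnR.hasSum_taylor (f : AnR K ε r) (a y : Ball K ε) (hy : ‖(y : K) - a‖ < r) :
    HasSum (fun k => f.taylor a k * ((y : K) - a) ^ k) (f.fn y) :=
  (f.boundedOnDiscs a).choose_spec.2 y hy

theorem AnR.norm_taylor_le (f : AnR K ε r) (a : Ball K ε) (k : ℕ) :
    ‖f.taylor a k‖ ≤ (r.1 ^ k)⁻¹ * ‖f‖ := by
  rw [← div_eq_inv_mul, le_div_iff₀ (pow_pos r.2 k)]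
  exact f.norm_taylor_mul_le a k

theorem AnR.taylor_add (f g : AnR K ε r) (a : Ball K ε) :
    (f + g).taylor a = f.taylor a + g.taylor a :=
  coeff_unique (f := (f + g).fn) r.2 ((f + g).hasSum_taylor a) fun y hy => by
    simpa [add_mul, AnR.fn_add] using (f.hasSum_taylor a y hy).add (g.hasSum_taylor a y hy)

theorem AnR.taylor_smul (c : K) (f : AnR K ε r) (a : Ball K ε) :
    (c • f).taylor a = c • f.taylor a :=
  coeff_unique (f := (c • f).fn) r.2 ((c • f).hasSum_taylor a) fun y hy => by
    exact hasSum_congr_term ((f.hasSum_taylor a y hy).mul_left c) fun k => mul_assoc _ _ _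

/-- A map that is constant on the discs of radius `s`. -/
def DiscConst (b : Ball K ε → Ball K ε) (s : ℝ) : Prop :=
  ∀ x y : Ball K ε, ‖(x : K) - y‖ < s → b x = b y

theorem DiscConst.boundedOnDiscs {b : Ball K ε → Ball K ε} {s : ℝ} (hb : DiscConst b s)
    (hs : 0 < s) (φ : Ball K ε → K) {M : ℝ} (hM : ∀ x, ‖φ x‖ ≤ M) :
    BoundedOnDiscs (fun y => φ (b y)) s M := fun a =>
  ((bddOnDisc_const (φ (b a))).mono hs le_rfl (hM _)).congr fun y hy => by rw [hb y a hy]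

/-- The `k`-th coefficients of the power series of a function about the points `b y`. -/
noncomputable def coeffCLM {b : Ball K ε → Ball K ε} (hb : DiscConst b s.1) (k : ℕ) :
    AnR K ε r →L[K] AnR K ε s :=
  LinearMap.mkContinuous
    ⟨⟨fun f => AnR.mk (fun y => f.taylor (b y) k)
      (mul_nonneg (inv_nonneg.2 (pow_nonneg r.2.le k)) (norm_nonneg f))
      (hb.boundedOnDiscs s.2 (fun a => f.taylor a k) fun a => f.norm_taylor_le a k),
      fun f g => AnR.fn_injective (funext fun y => by
        simp only [AnR.fn_mk, AnR.fn_add, AnR.taylor_add, Pi.add_apply])⟩,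
      fun c f => AnR.fn_injective (funext fun y => by
        simp only [AnR.fn_mk, AnR.fn_smul, AnR.taylor_smul, Pi.smul_apply, RingHom.id_apply])⟩
    ((r.1 ^ k)⁻¹) fun f => AnR.norm_le
      (mul_nonneg (inv_nonneg.2 (pow_nonneg r.2.le k)) (norm_nonneg f))
      (hb.boundedOnDiscs s.2 (fun a => f.taylor a k) fun a => f.norm_taylor_le a k)

theorem fn_coeffCLM {b : Ball K ε → Ball K ε} (hb : DiscConst b s.1) (k : ℕ) (f : AnR K ε r)
    (y : Ball K ε) : (coeffCLM hb k f).fn y = f.taylor (b y) k := rfl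

theorem norm_coeffCLM_le {b : Ball K ε → Ball K ε} (hb : DiscConst b s.1) (k : ℕ) :
    ‖(coeffCLM hb k : AnR K ε r →L[K] AnR K ε s)‖ ≤ (r.1 ^ k)⁻¹ :=
  LinearMap.mkContinuous_norm_le _ (inv_nonneg.2 (pow_nonneg r.2.le k)) _

/-- The coefficient `x ↦ (f ↦ x ^ k * coeffCLM hb k f)` of the power series `substSeries`, as a
linear map in `x ^ k`. -/
noncomputable def substTerm (r : {r : ℝ // 0 < r}) {b : Ball K ε → Ball K ε}
    (hb : DiscConst b s.1) (k : ℕ) : AnR K ε s →L[K] (AnR K ε r →L[K] AnR K ε s) :=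
  ((ContinuousLinearMap.compL K (AnR K ε r) (AnR K ε s) (AnR K ε s)).flip (coeffCLM hb k)).comp
    (ContinuousLinearMap.mul K (AnR K ε s))

theorem substTerm_apply {b : Ball K ε → Ball K ε} (hb : DiscConst b s.1) (k : ℕ) (x : AnR K ε s)
    (f : AnR K ε r) : substTerm r hb k x f = x * coeffCLM hb k f := rfl

theorem norm_substTerm_le {b : Ball K ε → Ball K ε} (hb : DiscConst b s.1) (k : ℕ) :
    ‖(substTerm r hb k : AnR K ε s →L[K] (AnR K ε r →L[K] AnR K ε s))‖ ≤ (r.1 ^ k)⁻¹ := by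
  have h0 : (0 : ℝ) ≤ (r.1 ^ k)⁻¹ := inv_nonneg.2 (pow_nonneg r.2.le k)
  refine ContinuousLinearMap.opNorm_le_bound _ h0 fun x => ?_
  refine ContinuousLinearMap.opNorm_le_bound _ (by positivity) fun f => ?_
  rw [substTerm_apply]
  calc ‖x * coeffCLM hb k f‖ ≤ ‖x‖ * ‖coeffCLM hb k f‖ := norm_mul_le _ _
    _ ≤ ‖x‖ * ((r.1 ^ k)⁻¹ * ‖f‖) := by
      gcongr
      exact (coeffCLM hb k).le_of_opNorm_le (norm_coeffCLM_le hb k) f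
    _ = (r.1 ^ k)⁻¹ * ‖x‖ * ‖f‖ := by ring

/-- The power series in `x` of the substitution operator `f ↦ f ∘ (b + x)`. -/
noncomputable def substSeries (r : {r : ℝ // 0 < r}) {b : Ball K ε → Ball K ε}
    (hb : DiscConst b s.1) :
    FormalMultilinearSeries K (AnR K ε s) (AnR K ε r →L[K] AnR K ε s) := fun k =>
  (substTerm r hb k).compContinuousMultilinearMap
    (ContinuousMultilinearMap.mkPiAlgebraFin K k (AnR K ε s))

/-- Taylor coefficients of order k are at most r^(-k) times the norm of the function, so the k-th
term of the series has norm at most r^(-k). -/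
theorem le_radius_substSeries {b : Ball K ε → Ball K ε} (hb : DiscConst b s.1) :
    ((Real.toNNReal r.1 : ℝ≥0) : ENNReal) ≤ (substSeries r hb).radius := by
  refine FormalMultilinearSeries.le_radius_of_bound _ 1 fun k => ?_
  rw [Real.coe_toNNReal _ r.2.le]
  have h0 : (0 : ℝ) < r.1 ^ k := pow_pos r.2 k
  have h1 : ‖substSeries r hb k‖ ≤ (r.1 ^ k)⁻¹ * 1 := by
    refine (ContinuousLinearMap.norm_compContinuousMultilinearMap_le _ _).trans ?_
    gcongr
    · exact norm_substTerm_le hb k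
    · exact ContinuousMultilinearMap.norm_mkPiAlgebraFin_le.trans (max_le le_rfl AnR.norm_one_le)
  calc ‖substSeries r hb k‖ * r.1 ^ k ≤ (r.1 ^ k)⁻¹ * 1 * r.1 ^ k := by gcongr
    _ = 1 := by field_simp

/-- The operator `f ↦ f ∘ (b + x)`. -/
noncomputable def subst (r : {r : ℝ // 0 < r}) {b : Ball K ε → Ball K ε} (hb : DiscConst b s.1)
    (x : AnR K ε s) : AnR K ε r →L[K] AnR K ε s := (substSeries r hb).sum x

theorem hasFPowerSeriesOnBall_subst {b : Ball K ε → Ball K ε} (hb : DiscConst b s.1) :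
    HasFPowerSeriesOnBall (subst r hb) (substSeries r hb) 0 (substSeries r hb).radius := by
  refine (substSeries r hb).hasFPowerSeriesOnBall (lt_of_lt_of_le ?_ (le_radius_substSeries hb))
  simpa using r.2

theorem mem_eball_substSeries {b : Ball K ε → Ball K ε} (hb : DiscConst b s.1) {x : AnR K ε s}
    (hx : ‖x‖ < r.1) : x ∈ Metric.eball (0 : AnR K ε s) (substSeries r hb).radius := by
  refine lt_of_lt_of_le ?_ (le_radius_substSeries hb)
  rw [edist_zero_right, ← ofReal_norm]
  exact (ENNReal.ofReal_lt_ofReal_iff r.2).2 hx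

theorem analyticAt_subst {b : Ball K ε → Ball K ε} (hb : DiscConst b s.1) {x : AnR K ε s}
    (hx : ‖x‖ < r.1) : AnalyticAt K (subst r hb) x :=
  (hasFPowerSeriesOnBall_subst hb).analyticAt_of_mem (mem_eball_substSeries hb hx)

/-- Application to `f` and evaluation at `y` are continuous and linear, and they turn the operator
series into the Taylor series of `f` about `b y`. Since `b` is constant on discs, the Taylor
coefficients at `b y` are again functions in `AnR K ε s`. -/
theorem fn_subst {b : Ball K ε → Ball K ε} (hb : DiscConst b s.1) {x : AnR K ε s}
    (hx : ‖x‖ < r.1) (f : AnR K ε r) {u : Ball K ε → Ball K ε}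
    (hu : ∀ y, (u y : K) = b y + x.fn y) (y : Ball K ε) :
    (subst r hb x f).fn y = f.fn (u y) := by
  have h1 := (hasFPowerSeriesOnBall_subst hb).hasSum (mem_eball_substSeries hb hx)
  rw [zero_add] at h1
  have h2 := h1.mapL (ContinuousLinearMap.apply K (AnR K ε s) f)
  have h3 := h2.mapL (AnR.evalCLM y)
  have h4 := f.hasSum_taylor (b y) (u y) (by
    rw [hu, add_sub_cancel_left]
    exact (x.norm_fn_le y).trans_lt hx)
  refine h3.unique (hasSum_congr_term h4 fun k => ?_)
  rw [hu, add_sub_cancel_left]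
  simp only [ContinuousLinearMap.apply_apply, AnR.evalCLM_apply, substSeries,
    ContinuousLinearMap.compContinuousMultilinearMap_coe, Function.comp_apply,
    ContinuousMultilinearMap.mkPiAlgebraFin_apply, List.ofFn_const, List.prod_replicate,
    substTerm_apply, AnR.fn_mul, Pi.mul_apply, fn_coeffCLM, AnR.fn_pow, Pi.pow_apply]
  ring

end BanachAlgebra


/-! ### Factorization through a Banach step, and base points for substitution. -/

section Factorization

variable {K : Type u} [NontriviallyNormedField K] {ε : ℝ}
variable [IsUltrametricDist K] [ProperSpace K] {r s : {r : ℝ // 0 < r}}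

theorem continuous_toFun_apply (hε : 0 < ε) (y : Ball K ε) :
    Continuous fun f : LocAn K ε => f.toFun y := by
  let φ : LocAn K ε →+ K := AddMonoidHom.mk' (fun f => f.toFun y) fun _ _ => rfl
  refine continuous_of_continuousAt_zero φ ?_
  rw [ContinuousAt, map_zero, Metric.tendsto_nhds]
  intro η hη
  let V : AddSubgroup (LocAn K ε) :=
    { carrier := {f | ‖f.toFun y‖ ≤ η / 2}
      add_mem' := fun {f g} hf hg =>
        (IsUltrametricDist.norm_add_le_max (f.toFun y) (g.toFun y)).trans (max_le hf hg)
      zero_mem' := by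
        show ‖(0 : K)‖ ≤ η / 2
        rw [norm_zero]
        positivity
      neg_mem' := fun {f} hf => by
        show ‖-(f.toFun y)‖ ≤ η / 2
        rw [norm_neg]
        exact hf }
  have hV : (V : Set (LocAn K ε)) ∈ 𝓝 0 := by
    refine mem_nhds_zero_of_absorbing hε V (fun c hc f hf => ?_) fun r hr => ?_
    · show ‖c * f.toFun y‖ ≤ η / 2
      rw [norm_mul]
      exact (mul_le_of_le_one_left (norm_nonneg _) hc).trans hf
    · obtain ⟨c, hc0, hc⟩ := NormedField.exists_norm_lt K (half_pos hη)
      refine ⟨c, norm_pos_iff.1 hc0, fun f hf => ?_⟩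
      show ‖c * f.toFun y‖ ≤ η / 2
      rw [norm_mul]
      exact (mul_le_of_le_one_right (norm_nonneg _) (hf.norm_le hr y)).trans hc.le
  filter_upwards [hV] with f hf
  rw [dist_zero_right]
  exact lt_of_le_of_lt hf (half_lt_self hη)

theorem continuous_zfn (hε : 0 < ε) : Continuous (zfn : LocAnZero K ε → Ball K ε → K) :=
  continuous_pi fun y => (continuous_toFun_apply hε y).comp continuous_subtype_val

theorem t2Space_locAnZero (hε : 0 < ε) : T2Space (LocAnZero K ε) :=
  T2Space.of_injective_continuous zfn_injective (continuous_zfn hε)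

/-- The map from `AnR K ε r` to the locally analytic functions that vanish at `0`. -/
noncomputable def AnR.toLocAnZero (z₀ : Ball K ε) (hz₀ : (z₀ : K) = 0) :
    AnR K ε r →L[K] LocAnZero K ε where
  toFun w := ⟨LocAn.mk (fun y => w.fn y - w.fn z₀)
    ((w.boundedOnDiscs.sub_const r.2 z₀).locallyAnalytic r.2), fun x hx => by
      rw [show x = z₀ from Subtype.ext (hx.trans hz₀.symm), LocAn.toFun_mk, sub_self]⟩
  map_add' f g := zfn_injective (funext fun y => by
    show (f + g).fn y - (f + g).fn z₀ = (f.fn y - f.fn z₀) + (g.fn y - g.fn z₀)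
    rw [AnR.fn_add, Pi.add_apply, Pi.add_apply]
    ring)
  map_smul' c f := zfn_injective (funext fun y => (mul_sub c _ _).symm)
  cont := by
    refine Continuous.subtype_mk (f := fun w : AnR K ε r =>
      LocAn.mk (fun y => w.fn y - w.fn z₀)
        ((w.boundedOnDiscs.sub_const r.2 z₀).locallyAnalytic r.2)) ?_ _
    refine continuous_iff_continuousAt.2 fun w => ?_
    rw [ContinuousAt, withSeminorms_indLimSeminormFamily.tendsto_nhds]
    rintro ⟨q, hq, hqC⟩ η hη
    obtain ⟨C, hC⟩ := hqC r r.2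
    have h1 : Tendsto (fun w' : AnR K ε r => C * ‖w' - w‖) (𝓝 w) (𝓝 0) := by
      have h2 : Continuous fun w' : AnR K ε r => C * ‖w' - w‖ := by fun_prop
      simpa using h2.tendsto w
    filter_upwards [h1.eventually (gt_mem_nhds hη)] with w' hw'
    refine lt_of_le_of_lt (hC _ _ ?_) hw'
    refine fun a => BddOnDisc.congr (((w' - w).boundedOnDiscs.sub_const r.2 z₀) a) fun y _ => ?_
    show (w'.fn y - w.fn y) - (w'.fn z₀ - w.fn z₀) = (w'.fn y - w'.fn z₀) - (w.fn y - w.fn z₀)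
    ring

theorem zfn_toLocAnZero (z₀ : Ball K ε) (hz₀ : (z₀ : K) = 0) (w : AnR K ε r) (y : Ball K ε) :
    zfn (w.toLocAnZero z₀ hz₀) y = w.fn y - w.fn z₀ := rfl

/-- A continuous linear map from a Banach space to the space of locally analytic functions factors
through one of the Banach spaces `AnR K ε r`. -/
theorem exists_factorization (hε : 0 < ε) {V : Type u} [NormedAddCommGroup V] [NormedSpace K V]
    [CompleteSpace V] (i : V →L[K] LocAnZero K ε) :
    ∃ r : {r : ℝ // 0 < r}, ∃ φ : V →L[K] AnR K ε r, ∀ v, (φ v).fn = zfn (i v) := by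
  -- These sets are closed, because bounded sets are compact for pointwise convergence, and they
  -- cover `V`. By Baire one has an interior point; being closed under subtraction, it then contains
  -- a ball about 0.
  let S : ℕ → Set V := fun n => {v | BoundedOnDiscs (zfn (i v)) (1 / ((n : ℝ) + 1)) n}
  have hpos : ∀ n : ℕ, (0 : ℝ) < 1 / ((n : ℝ) + 1) := fun n => by positivity
  have hS : ∀ n, IsClosed (S n) := fun n =>
    ((isCompact_setOf_boundedOnDiscs (K := K) (ε := ε) (M := n) (hpos n)).isClosed).preimage
      ((continuous_zfn hε).comp i.continuous)
  have hcover : ⋃ n, S n = Set.univ := by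
    refine Set.eq_univ_of_forall fun v => Set.mem_iUnion.2 ?_
    obtain ⟨r, hr, M, hM⟩ := (i v).1.locallyAnalytic.exists_boundedOnDiscs
    obtain ⟨n, hn⟩ := exists_nat_ge (max (1 / r) M)
    refine ⟨n, hM.mono (hpos n) ?_ ((le_max_right _ _).trans hn)⟩
    rw [one_div_le (by positivity) hr]
    exact ((le_max_left _ _).trans hn).trans (by simp)
  obtain ⟨n, x, hx⟩ := nonempty_interior_of_iUnion_of_closed hS hcover
  obtain ⟨δ, hδ, hball⟩ := Metric.isOpen_iff.1 isOpen_interior x hx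
  have hsmall : ∀ v : V, ‖v‖ < δ → v ∈ S n := by
    intro v hv
    have h1 : x + v ∈ S n := interior_subset (hball (by simpa using hv))
    have h2 : x ∈ S n := interior_subset hx
    intro a
    refine (BddOnDisc.sub (hpos n) (h1 a) (h2 a)).congr fun y _ => ?_
    rw [map_add, zfn_add, Pi.sub_apply, Pi.add_apply, add_sub_cancel_left]
  obtain ⟨k, hk⟩ := NormedField.exists_one_lt_norm K
  have hbound : ∀ v : V, BoundedOnDiscs (zfn (i v)) (1 / ((n : ℝ) + 1)) (δ⁻¹ * ‖k‖ * n * ‖v‖) := by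
    intro v
    rcases eq_or_ne v 0 with rfl | hv
    · rw [map_zero]
      exact fun a => (bddOnDisc_const (0 : K)).mono (hpos n) le_rfl (by simp)
    · obtain ⟨d, hd, h1, -, h2⟩ := rescale_to_shell hk hδ hv
      have h3 : BoundedOnDiscs (d⁻¹ • zfn (i (d • v))) (1 / ((n : ℝ) + 1)) (‖d⁻¹‖ * n) :=
        (hsmall _ h1).smul d⁻¹
      have h4 : d⁻¹ • zfn (i (d • v)) = zfn (i v) := by
        rw [map_smul]
        show d⁻¹ • d • zfn (i v) = zfn (i v)
        rw [inv_smul_smul₀ hd]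
      rw [h4] at h3
      refine h3.mono (hpos n) le_rfl ?_
      rw [norm_inv, mul_right_comm]
      gcongr
  refine ⟨⟨_, hpos n⟩, LinearMap.mkContinuous
    ⟨⟨fun v => AnR.mk (zfn (i v)) (by positivity) (hbound v), fun v w => ?_⟩, fun c v => ?_⟩
    (δ⁻¹ * ‖k‖ * n) fun v => AnR.norm_le (by positivity) (hbound v), fun v => rfl⟩
  · exact AnR.fn_injective (by simp only [AnR.fn_mk, AnR.fn_add, map_add, zfn_add])
  · refine AnR.fn_injective ?_
    simp only [AnR.fn_mk, AnR.fn_smul, map_smul, RingHom.id_apply]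
    rfl

theorem LocallyAnalytic.exists_anR (hε : 0 < ε) {f : Ball K ε → K} (hf : LocallyAnalytic f) :
    ∃ r : {r : ℝ // 0 < r}, ∀ s : {r : ℝ // 0 < r}, s.1 ≤ r.1 →
      ∃ f' : AnR K ε s, f'.fn = f := by
  obtain ⟨r, hr, M, hM⟩ := hf.exists_boundedOnDiscs
  exact ⟨⟨r, hr⟩, fun s hs => ⟨AnR.mk f (hM.nonneg hε hr) (hM.mono s.2 hs le_rfl), rfl⟩⟩

/-- A choice of a point in each disc of radius `s`. -/
theorem exists_discConst (K : Type u) [NontriviallyNormedField K] [IsUltrametricDist K] (ε : ℝ)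
    {s : ℝ} (hs : 0 < s) :
    ∃ b : Ball K ε → Ball K ε, DiscConst b s ∧ ∀ y : Ball K ε, ‖(y : K) - b y‖ < s := by
  let S : Setoid (Ball K ε) :=
    { r := fun x y => ‖(x : K) - y‖ < s
      iseqv := ⟨fun x => by simpa using hs, fun {x y} h => by rwa [norm_sub_rev],
        fun {x y z} h1 h2 => by
          rw [← sub_add_sub_cancel (x : K) y z]
          exact (IsUltrametricDist.norm_add_le_max _ _).trans_lt (max_lt h1 h2)⟩ }
  refine ⟨fun y => (Quotient.mk S y).out, fun x y hxy => ?_, fun y => ?_⟩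
  · show (Quotient.mk S x).out = (Quotient.mk S y).out
    rw [show Quotient.mk S x = Quotient.mk S y from Quotient.sound hxy]
  · exact S.symm (Quotient.mk_out (s := S) y)

/-- Choose one point in each disc of radius s and let b be τ at that point. As τ is an isometry with
slope bound s, the remainder τ - b has norm at most s, which puts τ in the form required by `subst`.
-/
theorem exists_base {τ : Equiv.Perm (Ball K ε)} (hτ : IsContr (disp τ))
    (hs : SlopeBdd (disp τ) s) :
    ∃ b : Ball K ε → Ball K ε, DiscConst b s ∧ ∃ x : AnR K ε s, ‖x‖ ≤ s ∧
      ∀ y, (τ y : K) = b y + x.fn y := by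
  obtain ⟨b, hb, hbs⟩ := exists_discConst K ε s.2
  have hbd : BoundedOnDiscs (fun y => (τ y : K) - τ (b y)) s s := by
    intro a
    have h1 : BddOnDisc (fun y => (τ y : K) - τ a) a s s := by
      simpa only [← coe_apply_eq_add_disp] using hs.add_id s.2 a
    have h2 : BddOnDisc (fun _ : Ball K ε => (τ a : K) - τ (b a)) a s s :=
      (bddOnDisc_const _).mono s.2 le_rfl (by
        rw [hτ.norm_apply_sub_apply]
        exact (hbs a).le)
    refine (h1.add s.2 h2).congr fun y hy => ?_
    simp only [Pi.add_apply, hb y a hy]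
    ring
  refine ⟨fun y => τ (b y), fun x y hxy => by simp only [hb x y hxy], AnR.mk _ s.2.le hbd,
    AnR.norm_le s.2.le hbd, fun y => ?_⟩
  rw [AnR.fn_mk]
  ring

theorem exists_slopeBdd_subtype {f : Ball K ε → K} (hf : IsContr f) (ha : LocallyAnalytic f) :
    ∃ r : {r : ℝ // 0 < r}, ∀ s : {r : ℝ // 0 < r}, s.1 ≤ r.1 → SlopeBdd f s :=
  let ⟨r, hr, h⟩ := exists_slopeBdd hf ha
  ⟨⟨r, hr⟩, fun s hs => h s s.2 hs⟩

theorem exists_lt_radii (r₁ r₂ : {r : ℝ // 0 < r}) :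
    ∃ s : {r : ℝ // 0 < r}, s.1 < r₁.1 ∧ s.1 < r₂.1 :=
  ⟨⟨min r₁.1 r₂.1 / 2, half_pos (lt_min r₁.2 r₂.2)⟩,
    (half_lt_self (lt_min r₁.2 r₂.2)).trans_le (min_le_left _ _),
    (half_lt_self (lt_min r₁.2 r₂.2)).trans_le (min_le_right _ _)⟩

end Factorization


/-! ### Openness of the chart domain and continuity of the group operations. -/

section Operations

variable {K : Type u} [NontriviallyNormedField K] {ε : ℝ}

/-- The functions that are displacements of elements of the group of locally analytic
diffeomorphisms. -/
def contrSet (K : Type u) [NontriviallyNormedField K] (ε : ℝ) : Set (LocAnZero K ε) :=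
  {f | IsContr (zfn f)}

theorem locallyAnalytic_zfn (f : LocAnZero K ε) : LocallyAnalytic (zfn f) := f.1.2

theorem norm_apply_sub_apply_le {f : Ball K ε → K} (hf : IsContr f) (x y : Ball K ε) :
    ‖f x - f y‖ ≤ ‖(x : K) - y‖ := by
  obtain ⟨⟨L, hL, hLip⟩, -⟩ := hf
  exact (norm_sub_le_of_lipschitzWith hLip x y).trans
    (mul_le_of_le_one_left (norm_nonneg _) (by exact_mod_cast hL.le))

theorem analyticAt_clm_apply {V W E : Type*} [NormedAddCommGroup V] [NormedSpace K V]
    [NormedAddCommGroup W] [NormedSpace K W] [NormedAddCommGroup E] [NormedSpace K E]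
    {A : V → W →L[K] E} {B : V → W} {x : V} (hA : AnalyticAt K A x) (hB : AnalyticAt K B x) :
    AnalyticAt K (fun v => A v (B v)) x :=
  ((ContinuousLinearMap.id K (W →L[K] E)).analyticAt_bilinear (A x, B x)).comp
    (f := fun v => (A v, B v)) (hA.prod hB)

variable [IsUltrametricDist K]

theorem lipschitzWith_of_sub {f g : Ball K ε → K} {L : ℝ≥0} (hf : LipschitzWith L f)
    (hfg : LipschitzWith L (g - f)) : LipschitzWith L g := by
  refine lipschitzWith_of_norm_sub_le fun x y => ?_
  have h1 : g x - g y = ((g - f) x - (g - f) y) + (f x - f y) := by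
    rw [Pi.sub_apply, Pi.sub_apply]
    ring
  rw [h1]
  exact (IsUltrametricDist.norm_add_le_max _ _).trans
    (max_le (norm_sub_le_of_lipschitzWith hfg x y) (norm_sub_le_of_lipschitzWith hf x y))

variable [ProperSpace K]

/-- Functions of Lipschitz constant at most L form a lattice. It absorbs the unit ball of A_r, whose
members have constant at most 1/r: within a disc by the power series, and across discs because the
values are at most 1 while the points are at least r apart. -/
theorem mem_nhds_of_lipschitzWith (hε : 0 < ε) {L : ℝ≥0} (hL : 0 < L) (f : LocAnZero K ε) :
    {g : LocAnZero K ε | LipschitzWith L (zfn g - zfn f)} ∈ 𝓝 f := by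
  let V : AddSubgroup (LocAn K ε) :=
    { carrier := {f | LipschitzWith L f.toFun}
      add_mem' := fun {f g} hf hg => lipschitzWith_of_norm_sub_le fun x y => by
        have h1 : (f + g).toFun x - (f + g).toFun y =
            (f.toFun x - f.toFun y) + (g.toFun x - g.toFun y) := by
          rw [LocAn.toFun_add, Pi.add_apply, Pi.add_apply]
          ring
        rw [h1]
        exact (IsUltrametricDist.norm_add_le_max _ _).trans
          (max_le (norm_sub_le_of_lipschitzWith hf x y) (norm_sub_le_of_lipschitzWith hg x y))
      zero_mem' := (LipschitzWith.const 0).weaken zero_le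
      neg_mem' := fun {f} hf => lipschitzWith_of_norm_sub_le fun x y => by
        rw [LocAn.toFun_neg, Pi.neg_apply, Pi.neg_apply, neg_sub_neg, norm_sub_rev]
        exact norm_sub_le_of_lipschitzWith hf x y }
  have hV : (V : Set (LocAn K ε)) ∈ 𝓝 0 := by
    refine mem_nhds_zero_of_absorbing hε V (fun c hc f hf => ?_) fun r hr => ?_
    · refine lipschitzWith_of_norm_sub_le fun x y => ?_
      show ‖c * f.toFun x - c * f.toFun y‖ ≤ _
      rw [← mul_sub, norm_mul]
      exact (mul_le_of_le_one_left (norm_nonneg _) hc).trans (norm_sub_le_of_lipschitzWith hf x y)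
    · have hLr : 0 < (L : ℝ) * r := mul_pos hL hr
      obtain ⟨c, hc0, hc⟩ := NormedField.exists_norm_lt K hLr
      refine ⟨c, norm_pos_iff.1 hc0, fun f hf => lipschitzWith_of_norm_sub_le fun x y => ?_⟩
      show ‖c * f.toFun x - c * f.toFun y‖ ≤ _
      rw [← mul_sub, norm_mul]
      have h1 : ‖f.toFun x - f.toFun y‖ ≤ 1 / r * ‖(x : K) - y‖ := by
        rcases lt_or_ge ‖(x : K) - y‖ r with h | h
        · exact BddOnDisc.norm_sub_le hr (hf y) h
        · calc ‖f.toFun x - f.toFun y‖ ≤ max ‖f.toFun x‖ ‖f.toFun y‖ :=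
                by simpa [sub_eq_add_neg] using
                  IsUltrametricDist.norm_add_le_max (f.toFun x) (-f.toFun y)
            _ ≤ 1 := max_le (hf.norm_le hr x) (hf.norm_le hr y)
            _ = 1 / r * r := by field_simp
            _ ≤ 1 / r * ‖(x : K) - y‖ := by gcongr
      calc ‖c‖ * ‖f.toFun x - f.toFun y‖ ≤ (L * r) * (1 / r * ‖(x : K) - y‖) := by gcongr
        _ = L * ‖(x : K) - y‖ := by field_simp
  have hsub : Tendsto (fun g : LocAnZero K ε => ((g - f : LocAnZero K ε) : LocAn K ε))
      (𝓝 f) (𝓝 0) := by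
    have h1 : Continuous fun g : LocAnZero K ε => ((g - f : LocAnZero K ε) : LocAn K ε) := by
      fun_prop
    simpa using h1.tendsto f
  exact hsub.eventually hV

theorem isOpen_setOf_lipschitzWith (hε : 0 < ε) {L : ℝ≥0} (hL : 0 < L) :
    IsOpen {f : LocAnZero K ε | LipschitzWith L (zfn f)} := by
  refine isOpen_iff_mem_nhds.2 fun f hf => ?_
  filter_upwards [mem_nhds_of_lipschitzWith hε hL f] with g hg
  exact lipschitzWith_of_sub hf hg

theorem isOpen_contrSet (hε : 0 < ε) : IsOpen (contrSet K ε) := by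
  have h1 : contrSet K ε = ⋃ L : {L : ℝ≥0 // 0 < L ∧ L < 1},
      {f : LocAnZero K ε | LipschitzWith L.1 (zfn f)} := by
    ext f
    rw [Set.mem_iUnion]
    constructor
    · rintro ⟨⟨L, hL, hf⟩, h0⟩
      -- Openness is available only for positive constants, so `L`, which may be 0, is replaced by
      -- its midpoint with 1.
      have h2 : 0 < (1 + L) / 2 := by positivity
      have h3 : (1 + L) / 2 < 1 := by
        rw [div_lt_one two_pos, ← one_add_one_eq_two]
        gcongr
      have h4 : L ≤ (1 + L) / 2 := by
        rw [le_div_iff₀ two_pos, mul_two]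
        gcongr
      exact ⟨⟨_, h2, h3⟩, hf.weaken h4⟩
    · rintro ⟨⟨L, hL0, hL⟩, hf⟩
      exact ⟨⟨L, hL, hf⟩, f.2⟩
  rw [h1]
  exact isOpen_iUnion fun L => isOpen_setOf_lipschitzWith hε L.2.1

theorem exists_perm_of_mem_contrSet {f : LocAnZero K ε} (hf : f ∈ contrSet K ε) :
    ∃ σ : Equiv.Perm (Ball K ε), disp σ = zfn f :=
  IsContr.exists_perm hf

/-- Multiplication of diffeomorphisms is continuous in terms of their displacements. -/
theorem continuousOn_mul (hε : 0 < ε) {F : LocAnZero K ε × LocAnZero K ε → LocAnZero K ε}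
    (hF : ∀ z : LocAnZero K ε × LocAnZero K ε, ∀ σ τ : Equiv.Perm (Ball K ε),
      IsContr (disp σ) → IsContr (disp τ) → disp σ = zfn z.1 → disp τ = zfn z.2 →
      zfn (F z) = disp (σ * τ)) :
    ContinuousOn F {z | z.1 ∈ contrSet K ε ∧ z.2 ∈ contrSet K ε} := by
  refine continuousOn_of_pointwise hε (((isOpen_contrSet hε).preimage continuous_fst).inter
    ((isOpen_contrSet hε).preimage continuous_snd)) ?_
  rintro r hr M z ⟨hz1, hz2⟩ l hl h1 h2
  -- The radius depends only on `r` and `M`, so all the composites lie in one bounded set.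
  obtain ⟨s, hs, hsr, hMs⟩ := exists_radius hr M
  refine tendsto_locAnZero_of_pointwise (M := M) hs ?_ fun y => ?_
  · filter_upwards [hl] with w hw
    obtain ⟨⟨hw1, hw2⟩, hb1, hb2⟩ := hw
    obtain ⟨σ, hσ⟩ := exists_perm_of_mem_contrSet hw1
    obtain ⟨τ, hτ⟩ := exists_perm_of_mem_contrSet hw2
    have hσc : IsContr (disp σ) := by rw [hσ]; exact hw1
    have hτc : IsContr (disp τ) := by rw [hτ]; exact hw2
    rw [hF w σ τ hσc hτc hσ hτ, disp_mul]
    rw [← hσ] at hb1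
    rw [← hτ] at hb2
    exact (hb2.mono hs hsr.le le_rfl).add hs (hb1.comp_perm hs hsr.le hτc
      (hτc.slopeBdd hr hb2 hs hsr.le (hMs s hs le_rfl)))
  · obtain ⟨σ, hσ⟩ := exists_perm_of_mem_contrSet hz1
    obtain ⟨τ, hτ⟩ := exists_perm_of_mem_contrSet hz2
    have hσc : IsContr (disp σ) := by rw [hσ]; exact hz1
    have hτc : IsContr (disp τ) := by rw [hτ]; exact hz2
    have h3 : zfn (F z) y = zfn z.2 y + zfn z.1 (τ y) := by
      rw [hF z σ τ hσc hτc hσ hτ, disp_mul, ← hσ, ← hτ]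
      rfl
    have h4 := h1 (τ y)
    have h5 := h2 y
    rw [h3, tendsto_iff_norm_sub_tendsto_zero]
    rw [tendsto_iff_norm_sub_tendsto_zero] at h4 h5
    refine squeeze_zero' (Eventually.of_forall fun _ => norm_nonneg _) ?_
      (by simpa using h5.max h4)
    filter_upwards [hl] with w hw
    obtain ⟨⟨hw1, hw2⟩, -⟩ := hw
    obtain ⟨σ', hσ'⟩ := exists_perm_of_mem_contrSet hw1
    obtain ⟨τ', hτ'⟩ := exists_perm_of_mem_contrSet hw2
    have hσc' : IsContr (disp σ') := by rw [hσ']; exact hw1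
    have hτc' : IsContr (disp τ') := by rw [hτ']; exact hw2
    -- The middle term of this splitting, the change of the point, is controlled because every `zfn
    -- w.1` in question is 1-Lipschitz.
    have h6 : zfn (F w) y - (zfn z.2 y + zfn z.1 (τ y)) =
        (zfn w.2 y - zfn z.2 y) + ((zfn w.1 (τ' y) - zfn w.1 (τ y)) +
          (zfn w.1 (τ y) - zfn z.1 (τ y))) := by
      rw [hF w σ' τ' hσc' hτc' hσ' hτ', disp_mul, ← hσ', ← hτ', Pi.add_apply]
      ring
    have h7 : ‖zfn w.1 (τ' y) - zfn w.1 (τ y)‖ ≤ ‖zfn w.2 y - zfn z.2 y‖ := by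
      refine (norm_apply_sub_apply_le hw1 _ _).trans_eq ?_
      rw [coe_apply_eq_add_disp, coe_apply_eq_add_disp τ, hτ, hτ', add_sub_add_left_eq_sub]
    rw [h6]
    refine (IsUltrametricDist.norm_add_le_max _ _).trans (max_le (le_max_left _ _) ?_)
    exact (IsUltrametricDist.norm_add_le_max _ _).trans
      (max_le (h7.trans (le_max_left _ _)) (le_max_right _ _))

/-- Inversion of diffeomorphisms is continuous in terms of their displacements. -/
theorem continuousOn_inv (hε : 0 < ε) {F : LocAnZero K ε → LocAnZero K ε}
    (hF : ∀ z : LocAnZero K ε, ∀ σ : Equiv.Perm (Ball K ε), IsContr (disp σ) →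
      disp σ = zfn z → zfn (F z) = disp σ⁻¹) : ContinuousOn F (contrSet K ε) := by
  -- The continuity criterion concerns pairs, so a dummy second coordinate is carried along and
  -- finally set to 0.
  have key : ContinuousOn (fun z : LocAnZero K ε × LocAnZero K ε => F z.1)
      (Prod.fst ⁻¹' contrSet K ε) := by
    refine continuousOn_of_pointwise hε ((isOpen_contrSet hε).preimage continuous_fst) ?_
    rintro r hr M z hz l hl h1 -
    obtain ⟨s, hs, hsr, hMs⟩ := exists_radius hr M
    refine tendsto_locAnZero_of_pointwise (M := max s ε) hs ?_ fun y => ?_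
    · filter_upwards [hl] with w hw
      obtain ⟨hw1, hb1, -⟩ := hw
      obtain ⟨σ, hσ⟩ := exists_perm_of_mem_contrSet hw1
      have hσc : IsContr (disp σ) := by rw [hσ]; exact hw1
      rw [hF w.1 σ hσc hσ]
      rw [← hσ] at hb1
      exact boundedOnDiscs_disp_inv hs hσc (hσc.slopeBdd hr hb1 hs hsr.le (hMs s hs le_rfl))
    · obtain ⟨σ, hσ⟩ := exists_perm_of_mem_contrSet hz
      have hσc : IsContr (disp σ) := by rw [hσ]; exact hz
      have h4 := h1 (σ⁻¹ y)
      rw [tendsto_iff_norm_sub_tendsto_zero] at h4 ⊢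
      refine squeeze_zero' (Eventually.of_forall fun _ => norm_nonneg _) ?_ h4
      filter_upwards [hl] with w hw
      obtain ⟨hw1, -⟩ := hw
      obtain ⟨σ', hσ'⟩ := exists_perm_of_mem_contrSet hw1
      have hσc' : IsContr (disp σ') := by rw [hσ']; exact hw1
      rw [hF w.1 σ' hσc' hσ', hF z.1 σ hσc hσ, ← hσ, ← hσ']
      -- Applying the isometry σ' turns the distance of the two inverses at y into the difference of
      -- the displacements at the fixed point `σ⁻¹ y`.
      have h5 : disp σ'⁻¹ y - disp σ⁻¹ y =
          ((σ'⁻¹ y : Ball K ε) : K) - (σ⁻¹ y : Ball K ε) := by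
        simp only [disp]
        ring
      have h6 : disp σ' (σ⁻¹ y) - disp σ (σ⁻¹ y) = (σ' (σ⁻¹ y) : K) - σ' (σ'⁻¹ y) := by
        simp only [disp, perm_apply_inv_self]
        ring
      rw [h5, h6, hσc'.norm_apply_sub_apply, norm_sub_rev]
  exact key.comp (f := fun z : LocAnZero K ε => (z, (0 : LocAnZero K ε))) (by fun_prop)
    fun z hz => hz

end Operations


/-! ### Local analyticity of multiplication and inversion in the chart. -/

section LocalAnalyticity

variable {K : Type u} [NontriviallyNormedField K] {ε : ℝ}
variable [IsUltrametricDist K] [ProperSpace K] {r s : {r : ℝ // 0 < r}}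

theorem eventually_norm_add_lt {V : Type*} [NormedAddCommGroup V] {A : Type*}
    [NormedAddCommGroup A] {φ : V → A} (hφ : ContinuousAt φ 0) (hφ0 : φ 0 = 0) {x : A} {ρ : ℝ}
    (hx : ‖x‖ < ρ) : ∀ᶠ v in 𝓝 (0 : V), ‖x + φ v‖ < ρ := by
  have h1 : Tendsto (fun v => ‖x + φ v‖) (𝓝 0) (𝓝 ‖x + φ 0‖) :=
    (tendsto_const_nhds.add hφ).norm
  rw [hφ0, add_zero] at h1
  exact h1.eventually (gt_mem_nhds hx)

/-- After factorization both displacements are affine in v with values in Banach spaces, and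
disp(στ) = disp τ + disp σ ∘ τ. Writing τ as b + x₀ plus its perturbation makes the last term a
substitution operator, analytic in its argument, applied to an affine function of v. -/
theorem locallyAnalyticOn_mul (hε : 0 < ε) {F : LocAnZero K ε × LocAnZero K ε → LocAnZero K ε}
    (hF : ∀ z : LocAnZero K ε × LocAnZero K ε, ∀ σ τ : Equiv.Perm (Ball K ε),
      IsContr (disp σ) → IsContr (disp τ) → disp σ = zfn z.1 → disp τ = zfn z.2 →
      zfn (F z) = disp (σ * τ)) :
    LocallyAnalyticOn K F {z | z.1 ∈ contrSet K ε ∧ z.2 ∈ contrSet K ε} := by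
  have hopen : IsOpen {z : LocAnZero K ε × LocAnZero K ε | z.1 ∈ contrSet K ε ∧
      z.2 ∈ contrSet K ε} := ((isOpen_contrSet hε).preimage continuous_fst).inter
    ((isOpen_contrSet hε).preimage continuous_snd)
  refine ⟨continuousOn_mul hε hF, ?_⟩
  intro x hx V _ _ _ _ i
  obtain ⟨z₀, hz₀⟩ : ∃ z₀ : Ball K ε, (z₀ : K) = 0 := ⟨⟨0, by simpa using hε⟩, rfl⟩
  obtain ⟨r₁, φ₁, hφ₁⟩ :=
    exists_factorization hε ((ContinuousLinearMap.fst K (LocAnZero K ε) (LocAnZero K ε)).comp i)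
  obtain ⟨r₂, φ₂, hφ₂⟩ :=
    exists_factorization hε ((ContinuousLinearMap.snd K (LocAnZero K ε) (LocAnZero K ε)).comp i)
  obtain ⟨r₃, hr₃⟩ := (locallyAnalytic_zfn x.1).exists_anR hε
  obtain ⟨r₄, hr₄⟩ := (locallyAnalytic_zfn x.2).exists_anR hε
  obtain ⟨r₅, hr₅⟩ := exists_slopeBdd_subtype hx.2 (locallyAnalytic_zfn x.2)
  -- The inequality `s < r` has to be strict: the base element has norm at most `s`, and its
  -- perturbations must stay below `r` for the substitution series.
  obtain ⟨r, hrr₁, hrr₃⟩ := exists_lt_radii r₁ r₃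
  obtain ⟨s₁, hs₁, hs₂⟩ := exists_lt_radii r r₂
  obtain ⟨s₂, hs₃, hs₄⟩ := exists_lt_radii r₄ r₅
  obtain ⟨s, hs₅, hs₆⟩ := exists_lt_radii s₁ s₂
  have hsr : s.1 < r.1 := hs₅.trans hs₁
  obtain ⟨f₀, hf₀⟩ := hr₃ r hrr₃.le
  obtain ⟨g₀, hg₀⟩ := hr₄ s (hs₆.trans hs₃).le
  obtain ⟨τ, hτ⟩ := exists_perm_of_mem_contrSet hx.2
  have hτc : IsContr (disp τ) := by rw [hτ]; exact hx.2
  obtain ⟨b, hb, x₀, hx₀, hbx⟩ := exists_base (s := s) hτc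
    (by rw [hτ]; exact hr₅ s (hs₆.trans hs₄).le)
  let ψ₁ : V →L[K] AnR K ε r := (AnR.res hrr₁.le).comp φ₁
  let ψ₂ : V →L[K] AnR K ε s := (AnR.res (hs₅.trans hs₂).le).comp φ₂
  have hψ₁ : ∀ v, (ψ₁ v).fn = zfn (i v).1 := hφ₁
  have hψ₂ : ∀ v, (ψ₂ v).fn = zfn (i v).2 := hφ₂
  let G : V → AnR K ε s := fun v => (g₀ + ψ₂ v) + subst r hb (x₀ + ψ₂ v) (f₀ + ψ₁ v)
  have hGan : AnalyticAt K G 0 := by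
    have h1 : AnalyticAt K (fun v => x₀ + ψ₂ v) 0 := analyticAt_const.add (ψ₂.analyticAt 0)
    have h2 : AnalyticAt K (subst r hb) (x₀ + ψ₂ 0) := analyticAt_subst hb (by
      rw [map_zero, add_zero]
      exact hx₀.trans_lt hsr)
    exact (analyticAt_const.add (ψ₂.analyticAt 0)).add (analyticAt_clm_apply
      (h2.comp (f := fun v => x₀ + ψ₂ v) h1) (analyticAt_const.add (ψ₁.analyticAt 0)))
  have hG : ∀ v, x + i v ∈ {z : LocAnZero K ε × LocAnZero K ε | z.1 ∈ contrSet K ε ∧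
      z.2 ∈ contrSet K ε} → ‖x₀ + ψ₂ v‖ < r.1 → zfn (F (x + i v)) = (G v).fn := by
    intro v hv hvr
    obtain ⟨σ', hσ'⟩ := exists_perm_of_mem_contrSet hv.1
    obtain ⟨τ', hτ'⟩ := exists_perm_of_mem_contrSet hv.2
    have hσc' : IsContr (disp σ') := by rw [hσ']; exact hv.1
    have hτc' : IsContr (disp τ') := by rw [hτ']; exact hv.2
    rw [hF _ σ' τ' hσc' hτc' hσ' hτ', disp_mul]
    have h1 : disp τ' = g₀.fn + (ψ₂ v).fn := by
      rw [hτ', hg₀, hψ₂]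
      rfl
    have h2 : disp σ' = (f₀ + ψ₁ v).fn := by
      rw [hσ', AnR.fn_add, hf₀, hψ₁]
      rfl
    have h3 : ∀ y, (τ' y : K) = b y + (x₀ + ψ₂ v).fn y := by
      intro y
      have h4 := hbx y
      rw [coe_apply_eq_add_disp, hτ, ← hg₀] at h4
      rw [coe_apply_eq_add_disp, h1, AnR.fn_add, Pi.add_apply, Pi.add_apply, ← add_assoc, h4,
        add_assoc]
    funext y
    show disp τ' y + disp σ' (τ' y) = (g₀ + ψ₂ v).fn y + (subst r hb (x₀ + ψ₂ v) (f₀ + ψ₁ v)).fn y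
    rw [fn_subst hb hvr _ h3, h1, h2]
    rfl
  refine ⟨AnR K ε s, inferInstance, inferInstance, inferInstance, inferInstance,
    AnR.toLocAnZero z₀ hz₀, fun v => G v - G 0, hGan.sub analyticAt_const, ?_⟩
  have hev1 : ∀ᶠ v in 𝓝 (0 : V), x + i v ∈ {z : LocAnZero K ε × LocAnZero K ε |
      z.1 ∈ contrSet K ε ∧ z.2 ∈ contrSet K ε} := by
    have h1 : Tendsto (fun v => x + i v) (𝓝 0) (𝓝 x) := by
      have h2 : Continuous fun v => x + i v := by fun_prop
      simpa using h2.tendsto 0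
    exact h1.eventually (hopen.mem_nhds hx)
  have hev2 : ∀ᶠ v in 𝓝 (0 : V), ‖x₀ + ψ₂ v‖ < r.1 :=
    eventually_norm_add_lt ψ₂.continuous.continuousAt (map_zero _) (hx₀.trans_lt hsr)
  filter_upwards [hev1, hev2] with v hv1 hv2
  have h0 := hG 0 hev1.self_of_nhds hev2.self_of_nhds
  have h1 := hG v hv1 hv2
  rw [map_zero, add_zero] at h0
  have hz : ∀ z, zfn (F z) z₀ = 0 := fun z => (F z).2 z₀ hz₀
  refine zfn_injective (funext fun y => ?_)
  rw [zfn_add, Pi.add_apply, zfn_toLocAnZero, AnR.fn_sub, ← h0, ← h1, Pi.sub_apply, Pi.sub_apply,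
    hz, hz]
  ring

/-- Inversion near the identity, as an analytic map between Banach spaces. -/
theorem exists_analytic_inverse {b : Ball K ε → Ball K ε}
    (hb : DiscConst b s.1) {x : AnR K ε s} (hx : ‖x‖ < r.1) :
    ∃ H : AnR K ε r → AnR K ε s, AnalyticAt K H 0 ∧ H 0 = 0 ∧
      ∀ᶠ w in 𝓝 0, H w + subst r hb (x + H w) w = 0 := by
  -- Keeping `w` as first coordinate turns the implicit equation for `H w` into the inversion of Ψ
  -- at `(w, 0)`.
  let Ψ : AnR K ε r × AnR K ε s → AnR K ε r × AnR K ε s :=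
    fun p => (p.1, p.2 + subst r hb (x + p.2) p.1)
  have h2 : AnalyticAt K (fun p : AnR K ε r × AnR K ε s => subst r hb (x + p.2)) 0 := by
    have h1 : AnalyticAt K (subst r hb) (x + (0 : AnR K ε r × AnR K ε s).2) :=
      analyticAt_subst hb (by
        rw [Prod.snd_zero, add_zero]
        exact hx)
    exact h1.comp (f := fun p : AnR K ε r × AnR K ε s => x + p.2)
      (analyticAt_const.add analyticAt_snd)
  have hΨ : AnalyticAt K Ψ 0 :=
    analyticAt_fst.prod (analyticAt_snd.add (analyticAt_clm_apply h2 analyticAt_fst))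
  have hΨ0 : Ψ 0 = 0 := by simp [Ψ]
  let B : AnR K ε r →L[K] AnR K ε s := subst r hb x
  -- The substitution term is linear in `w`, so its derivative in the second variable vanishes at `w
  -- = 0`. The derivative of Ψ is thus unipotent, and its inverse is found by changing the sign of
  -- `B`.
  let e : (AnR K ε r × AnR K ε s) ≃L[K] (AnR K ε r × AnR K ε s) :=
    ContinuousLinearEquiv.equivOfInverse
      ((ContinuousLinearMap.fst K _ _).prod
        (ContinuousLinearMap.snd K _ _ + B.comp (ContinuousLinearMap.fst K _ _)))
      ((ContinuousLinearMap.fst K _ _).prod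
        (ContinuousLinearMap.snd K _ _ - B.comp (ContinuousLinearMap.fst K _ _)))
      (fun p => by simp) (fun p => by simp)
  have hder : HasFDerivAt Ψ (e : AnR K ε r × AnR K ε s →L[K] AnR K ε r × AnR K ε s) 0 := by
    have h3 := h2.differentiableAt.hasFDerivAt.clm_apply
      (hasFDerivAt_fst (𝕜 := K) (p := (0 : AnR K ε r × AnR K ε s)))
    have h4 := (hasFDerivAt_fst (𝕜 := K) (p := (0 : AnR K ε r × AnR K ε s))).prodMk
      ((hasFDerivAt_snd (𝕜 := K) (p := (0 : AnR K ε r × AnR K ε s))).add h3)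
    have heq : (e : AnR K ε r × AnR K ε s →L[K] AnR K ε r × AnR K ε s) =
        (ContinuousLinearMap.fst K _ _).prod (ContinuousLinearMap.snd K _ _ +
          ((subst r hb (x + (0 : AnR K ε r × AnR K ε s).2)).comp (ContinuousLinearMap.fst K _ _) +
          (fderiv K (fun p : AnR K ε r × AnR K ε s => subst r hb (x + p.2)) 0).flip
            (0 : AnR K ε r × AnR K ε s).1)) := by
      refine ContinuousLinearMap.ext fun p => Prod.ext rfl ?_
      rw [Prod.fst_zero, Prod.snd_zero, add_zero, map_zero, add_zero]
      rfl
    rw [heq]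
    exact h4
  have hstrict : HasStrictFDerivAt Ψ
      (e : AnR K ε r × AnR K ε s →L[K] AnR K ε r × AnR K ε s) 0 := by
    have h5 := hΨ.hasStrictFDerivAt
    rwa [hder.fderiv] at h5
  let P := hstrict.toOpenPartialHomeomorph Ψ
  have hPΨ : ∀ p, P p = Ψ p := fun p => rfl
  have hsource : (0 : AnR K ε r × AnR K ε s) ∈ P.source := hstrict.mem_toOpenPartialHomeomorph_source
  have hsymm : AnalyticAt K P.symm 0 := by
    have h6 := P.analyticAt_symm' hsource hΨ hder.fderiv
    rwa [hPΨ, hΨ0] at h6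
  have hsymm0 : P.symm 0 = 0 := by
    have h7 := P.left_inv hsource
    rwa [hPΨ, hΨ0] at h7
  have hin : AnalyticAt K (fun w : AnR K ε r => ((w, 0) : AnR K ε r × AnR K ε s)) 0 :=
    analyticAt_id.prod analyticAt_const
  refine ⟨fun w => (P.symm (w, 0)).2, ?_, ?_, ?_⟩
  · have h8 : AnalyticAt K (fun w : AnR K ε r => P.symm (w, 0)) 0 :=
      AnalyticAt.comp (g := P.symm)
        (f := fun w : AnR K ε r => ((w, 0) : AnR K ε r × AnR K ε s)) hsymm hin
    exact analyticAt_snd.comp h8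
  · show (P.symm 0).2 = 0
    rw [hsymm0]
    rfl
  · have htarget : P.target ∈ 𝓝 (0 : AnR K ε r × AnR K ε s) := by
      refine P.open_target.mem_nhds ?_
      have h9 := P.map_source hsource
      rwa [hPΨ, hΨ0] at h9
    have hev : ∀ᶠ w : AnR K ε r in 𝓝 0, ((w, 0) : AnR K ε r × AnR K ε s) ∈ P.target :=
      hin.continuousAt.eventually (by exact htarget)
    filter_upwards [hev] with w hw
    have h10 : Ψ (P.symm (w, 0)) = (w, 0) := P.right_inv hw
    have h11 : (P.symm (w, 0)).1 = w := congrArg Prod.fst h10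
    have h12 := congrArg Prod.snd h10
    simp only [Ψ, h11] at h12
    exact h12

/-- If σ' has displacement disp σ + φ v, then σ' = (id + w) ∘ σ with w = φ v ∘ σ⁻¹. Hence σ'⁻¹ = σ⁻¹
∘ (id + H w), where H w + w ∘ (id + H w) = 0, and the displacement of σ'⁻¹ is H w + disp σ⁻¹ ∘ (id +
H w). -/
theorem locallyAnalyticOn_inv (hε : 0 < ε) {F : LocAnZero K ε → LocAnZero K ε}
    (hF : ∀ z : LocAnZero K ε, ∀ σ : Equiv.Perm (Ball K ε), IsContr (disp σ) →
      disp σ = zfn z → zfn (F z) = disp σ⁻¹) : LocallyAnalyticOn K F (contrSet K ε) := by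
  refine ⟨continuousOn_inv hε hF, ?_⟩
  intro x hx V _ _ _ _ i
  obtain ⟨z₀, hz₀⟩ : ∃ z₀ : Ball K ε, (z₀ : K) = 0 := ⟨⟨0, by simpa using hε⟩, rfl⟩
  obtain ⟨r, φ, hφ⟩ := exists_factorization hε i
  obtain ⟨σ, hσ⟩ := exists_perm_of_mem_contrSet hx
  have hσc : IsContr (disp σ) := by rw [hσ]; exact hx
  have hσa : LocallyAnalytic (disp σ⁻¹) := locallyAnalytic_disp_inv hσc (by
    rw [hσ]
    exact locallyAnalytic_zfn x)
  obtain ⟨t₁, ht₁⟩ := hσa.exists_anR hε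
  obtain ⟨t₂, ht₂⟩ := exists_slopeBdd_subtype hσc.disp_inv hσa
  obtain ⟨t₃, ht₃⟩ := exists_slopeBdd_subtype (IsContr.disp_one (K := K) (ε := ε))
    (by rw [disp_one]; exact (locAnSubmodule K ε).zero_mem)
  -- Three substitutions follow, each with a strictly smaller target radius: σ⁻¹ into φ v (`r` to
  -- `s₁`), id + H into w (`s₁` to `s₂`), and id + H into the displacement of σ⁻¹ (`s₂` to `s₃`).
  obtain ⟨s₁, hs₁r, hs₁t⟩ := exists_lt_radii r t₂
  obtain ⟨s₁', hs₁', hs₁''⟩ := exists_lt_radii s₁ t₁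
  obtain ⟨s₂, hs₂, hs₂t⟩ := exists_lt_radii s₁' t₃
  obtain ⟨s₃, hs₃, hs₃t⟩ := exists_lt_radii s₂ t₃
  have hs₂₁ : s₂.1 < s₁.1 := hs₂.trans hs₁'
  obtain ⟨h₀, hh₀⟩ := ht₁ s₂ (hs₂.trans hs₁'').le
  obtain ⟨b₁, hb₁, x₁, hx₁, hbx₁⟩ := exists_base (s := s₁) hσc.disp_inv (ht₂ s₁ hs₁t.le)
  obtain ⟨b₂, hb₂, x₂, hx₂, hbx₂⟩ := exists_base (s := s₂) (IsContr.disp_one (K := K) (ε := ε))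
    (ht₃ s₂ hs₂t.le)
  obtain ⟨b₃, hb₃, x₃, hx₃, hbx₃⟩ := exists_base (s := s₃) (IsContr.disp_one (K := K) (ε := ε))
    (ht₃ s₃ hs₃t.le)
  have hx₁' : ‖x₁‖ < r.1 := hx₁.trans_lt hs₁r
  have hx₂' : ‖x₂‖ < s₁.1 := hx₂.trans_lt hs₂₁
  have hx₃' : ‖x₃‖ < s₂.1 := hx₃.trans_lt hs₃
  obtain ⟨H, hHan, hH0, hH⟩ := exists_analytic_inverse hb₂ hx₂'
  let ω : V →L[K] AnR K ε s₁ := (subst r hb₁ x₁).comp φ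
  have hω : ∀ v y, (ω v).fn y = (φ v).fn (σ⁻¹ y) := fun v y => fn_subst hb₁ hx₁' (φ v) hbx₁ y
  have hHω : AnalyticAt K (fun v => H (ω v)) 0 :=
    AnalyticAt.comp (g := H) (f := ω) (by rw [map_zero]; exact hHan) (ω.analyticAt 0)
  have hHω0 : H (ω 0) = 0 := by rw [map_zero, hH0]
  let R : AnR K ε s₂ →L[K] AnR K ε s₃ := AnR.res hs₃.le
  have hRHω : AnalyticAt K (fun v => R (H (ω v))) 0 :=
    AnalyticAt.comp (g := R) (f := fun v => H (ω v)) (R.analyticAt _) hHω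
  have hRHω0 : R (H (ω 0)) = 0 := by rw [hHω0, map_zero]
  let G : V → AnR K ε s₃ := fun v => R (H (ω v)) + subst s₂ hb₃ (x₃ + R (H (ω v))) h₀
  have hGan : AnalyticAt K G 0 := by
    have h1 : AnalyticAt K (subst s₂ hb₃) (x₃ + R (H (ω 0))) := analyticAt_subst hb₃ (by
      rw [hRHω0, add_zero]
      exact hx₃')
    exact hRHω.add (analyticAt_clm_apply
      (h1.comp (f := fun v => x₃ + R (H (ω v))) (analyticAt_const.add hRHω)) analyticAt_const)
  -- The condition with `ε` keeps the points moved by `H (ω v)` inside the ball; its summand 0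
  -- matches the form of `eventually_norm_add_lt`.
  have hG : ∀ v, x + i v ∈ contrSet K ε → ‖x₂ + H (ω v)‖ < s₁.1 →
      ‖x₃ + R (H (ω v))‖ < s₂.1 → ‖0 + H (ω v)‖ < ε →
      H (ω v) + subst s₁ hb₂ (x₂ + H (ω v)) (ω v) = 0 →
      zfn (F (x + i v)) = (G v).fn := by
    intro v hv hv2 hv3 hvε hvH
    rw [zero_add] at hvε
    obtain ⟨σ', hσ'⟩ := exists_perm_of_mem_contrSet hv
    have hσc' : IsContr (disp σ') := by rw [hσ']; exact hv
    rw [hF _ σ' hσc' hσ']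
    let u : Ball K ε → Ball K ε := fun y =>
      ⟨y + (H (ω v)).fn y, add_mem_ball (norm_coe_lt y) (((H (ω v)).norm_fn_le y).trans_lt hvε)⟩
    have hu : ∀ y, (u y : K) = y + (H (ω v)).fn y := fun y => rfl
    have hdisp : ∀ y, disp σ' y = disp σ y + (φ v).fn y := by
      intro y
      rw [hσ', hσ, zfn_add, hφ]
      rfl
    have hu2 : ∀ y, (u y : K) = b₂ y + (x₂ + H (ω v)).fn y := by
      intro y
      rw [AnR.fn_add, Pi.add_apply, ← add_assoc, ← hbx₂, hu]
      rfl
    have hu3 : ∀ y, (u y : K) = b₃ y + (x₃ + R (H (ω v))).fn y := by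
      intro y
      rw [AnR.fn_add, Pi.add_apply, ← add_assoc, ← hbx₃, hu]
      rfl
    have hinv : ∀ y, σ'⁻¹ y = σ⁻¹ (u y) := by
      intro y
      rw [Equiv.Perm.inv_eq_iff_eq]
      refine Subtype.ext ?_
      have h1 : (H (ω v)).fn y + (subst s₁ hb₂ (x₂ + H (ω v)) (ω v)).fn y = 0 :=
        congrFun (congrArg AnR.fn hvH) y
      rw [fn_subst hb₂ hv2 _ hu2, hω] at h1
      rw [coe_apply_eq_add_disp, hdisp, ← add_assoc, ← coe_apply_eq_add_disp, perm_apply_inv_self,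
        hu, add_assoc, h1, add_zero]
    funext y
    show disp σ'⁻¹ y = (H (ω v)).fn y + (subst s₂ hb₃ (x₃ + R (H (ω v))) h₀).fn y
    rw [fn_subst hb₃ hv3 _ hu3, hh₀]
    simp only [disp, hinv, hu]
    ring
  refine ⟨AnR K ε s₃, inferInstance, inferInstance, inferInstance, inferInstance,
    AnR.toLocAnZero z₀ hz₀, fun v => G v - G 0, hGan.sub analyticAt_const, ?_⟩
  have hev1 : ∀ᶠ v in 𝓝 (0 : V), x + i v ∈ contrSet K ε := by
    have h1 : Tendsto (fun v => x + i v) (𝓝 0) (𝓝 x) := by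
      have h2 : Continuous fun v => x + i v := by fun_prop
      simpa using h2.tendsto 0
    exact h1.eventually ((isOpen_contrSet hε).mem_nhds hx)
  have hev2 := eventually_norm_add_lt hHω.continuousAt hHω0 hx₂'
  have hev3 := eventually_norm_add_lt hRHω.continuousAt hRHω0 hx₃'
  have hev4 := eventually_norm_add_lt (x := (0 : AnR K ε s₂)) hHω.continuousAt hHω0
    (by rw [norm_zero]; exact hε)
  have hev5 : ∀ᶠ v in 𝓝 (0 : V), H (ω v) + subst s₁ hb₂ (x₂ + H (ω v)) (ω v) = 0 := by
    have h1 : Tendsto ω (𝓝 0) (𝓝 0) := by simpa using ω.continuous.tendsto 0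
    exact h1.eventually hH
  filter_upwards [hev1, hev2, hev3, hev4, hev5] with v hv1 hv2 hv3 hv4 hv5
  have h0 := hG 0 hev1.self_of_nhds hev2.self_of_nhds hev3.self_of_nhds hev4.self_of_nhds
    hev5.self_of_nhds
  have h1 := hG v hv1 hv2 hv3 hv4 hv5
  rw [map_zero, add_zero] at h0
  have hz : ∀ z, zfn (F z) z₀ = 0 := fun z => (F z).2 z₀ hz₀
  refine zfn_injective (funext fun y => ?_)
  rw [zfn_add, Pi.add_apply, zfn_toLocAnZero, AnR.fn_sub, ← h0, ← h1, Pi.sub_apply, Pi.sub_apply,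
    hz, hz]
  ring

end LocalAnalyticity


/-! ### The strictly differentiable group. -/

section StrictlyDifferentiable

variable {K : Type u} [NontriviallyNormedField K] {ε : ℝ} {f g : Ball K ε → K}
  {σ τ : Equiv.Perm (Ball K ε)} {φ : Ball K ε → K}

theorem eventually_mem_ball (x : Ball K ε) : ∀ᶠ y in 𝓝 (x : K), y ∈ ball (0 : K) ε :=
  isOpen_ball.mem_nhds x.2

theorem extZero_coe_eventuallyEq (x : Ball K ε) :
    extZero (fun y : Ball K ε => (y : K)) =ᶠ[𝓝 (x : K)] id := by
  filter_upwards [eventually_mem_ball x] with y hy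
  exact extZero_apply _ (⟨y, hy⟩ : Ball K ε)

theorem locallyAnalytic_coe : LocallyAnalytic fun x : Ball K ε => (x : K) := fun x hx =>
  analyticAt_id.congr (extZero_coe_eventuallyEq ⟨x, hx⟩).symm

theorem strictlyDifferentiable_coe : StrictlyDifferentiable fun x : Ball K ε => (x : K) :=
  fun x hx => ⟨_, (hasStrictFDerivAt_id (𝕜 := K) x).congr_of_eventuallyEq
    (extZero_coe_eventuallyEq ⟨x, hx⟩).symm⟩

theorem strictlyDifferentiable_zero : StrictlyDifferentiable (0 : Ball K ε → K) := fun x _ =>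
  ⟨0, by
    rw [extZero_zero]
    exact hasStrictFDerivAt_const (0 : K) x⟩

theorem StrictlyDifferentiable.add (hf : StrictlyDifferentiable f)
    (hg : StrictlyDifferentiable g) : StrictlyDifferentiable (f + g) := by
  intro x hx
  obtain ⟨D, hD⟩ := hf x hx
  obtain ⟨D', hD'⟩ := hg x hx
  rw [extZero_add]
  exact ⟨D + D', hD.add hD'⟩

theorem StrictlyDifferentiable.neg (hf : StrictlyDifferentiable f) :
    StrictlyDifferentiable (-f) := by
  intro x hx
  obtain ⟨D, hD⟩ := hf x hx
  rw [← neg_one_smul K f, extZero_smul]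
  exact ⟨_, hD.const_smul (-1 : K)⟩

theorem coe_apply_eq_add (σ : Equiv.Perm (Ball K ε)) :
    (fun x => (σ x : K)) = (fun x : Ball K ε => (x : K)) + disp σ :=
  funext fun x => coe_apply_eq_add_disp σ x

theorem locallyAnalytic_apply (hσ : LocallyAnalytic (disp σ)) :
    LocallyAnalytic fun x => (σ x : K) := by
  rw [coe_apply_eq_add]
  exact (locAnSubmodule K ε).add_mem locallyAnalytic_coe hσ

theorem strictlyDifferentiable_apply (hσ : StrictlyDifferentiable (disp σ)) :
    StrictlyDifferentiable fun x => (σ x : K) := by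
  rw [coe_apply_eq_add]
  exact strictlyDifferentiable_coe.add hσ

theorem StrictlyDifferentiable.comp_perm (hf : StrictlyDifferentiable f)
    (hσ : StrictlyDifferentiable fun x => (σ x : K)) :
    StrictlyDifferentiable fun x => f (σ x) := by
  intro x hx
  lift x to Ball K ε using hx
  obtain ⟨D, hD⟩ := hσ x x.2
  obtain ⟨D', hD'⟩ := hf (σ x) (σ x).2
  rw [← extZero_apply (fun x => (σ x : K)) x] at hD'
  refine ⟨_, (hD'.comp (x : K) hD).congr_of_eventuallyEq ?_⟩
  filter_upwards [eventually_mem_ball x] with y hy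
  lift y to Ball K ε using hy
  rw [extZero_apply, extZero_apply, extZero_apply]

theorem strictlyDifferentiable_disp_mul (hσ : StrictlyDifferentiable (disp σ))
    (hτ : StrictlyDifferentiable (disp τ)) : StrictlyDifferentiable (disp (σ * τ)) := by
  rw [disp_mul]
  exact hτ.add (hσ.comp_perm (strictlyDifferentiable_apply hτ))

variable [IsUltrametricDist K]

theorem continuousAt_extZero_perm (hσ : IsContr (disp σ)) (x : Ball K ε) :
    ContinuousAt (extZero fun y => (σ y : K)) x := by
  rw [ContinuousAt, tendsto_iff_norm_sub_tendsto_zero, extZero_apply]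
  have h1 : Tendsto (fun y : K => ‖y - x‖) (𝓝 (x : K)) (𝓝 0) :=
    tendsto_iff_norm_sub_tendsto_zero.1 tendsto_id
  refine h1.congr' ?_
  filter_upwards [eventually_mem_ball x] with y hy
  lift y to Ball K ε using hy
  rw [extZero_apply, hσ.norm_apply_sub_apply]

/-- The derivative of σ is 1 + D with |D| ≤ L < 1, hence nonzero, and σ⁻¹ is an isometry, hence
continuous. A continuous local inverse at a point of nonzero strict derivative is strictly
differentiable. -/
theorem strictlyDifferentiable_apply_inv (hσ : IsContr (disp σ))
    (hd : StrictlyDifferentiable (disp σ)) :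
    StrictlyDifferentiable fun x => ((σ⁻¹ x : Ball K ε) : K) := by
  intro y hy
  lift y to Ball K ε using hy
  obtain ⟨⟨L, hL, hLip⟩, -⟩ := id hσ
  obtain ⟨D, hD⟩ := hd (σ⁻¹ y : Ball K ε) (σ⁻¹ y).2
  have hD1 : ‖D 1‖ < 1 := by
    have h1 : LipschitzOnWith L (extZero (disp σ)) (ball (0 : K) ε) :=
      LipschitzOnWith.of_dist_le_mul fun a ha b hb => by
        lift a to Ball K ε using ha
        lift b to Ball K ε using hb
        rw [extZero_apply, extZero_apply]
        exact hLip.dist_le_mul a b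
    have h2 : ‖D‖ ≤ L :=
      hD.hasFDerivAt.le_of_lipschitzOn (isOpen_ball.mem_nhds (σ⁻¹ y : Ball K ε).2) h1
    have h3 := D.le_of_opNorm_le h2 1
    rw [norm_one, mul_one] at h3
    exact h3.trans_lt (by exact_mod_cast hL)
  have hne : 1 + D 1 ≠ 0 := by
    intro h
    rw [eq_neg_of_add_eq_zero_right h, norm_neg, norm_one] at hD1
    exact lt_irrefl _ hD1
  have hder : HasStrictDerivAt (extZero fun x => (σ x : K)) (1 + D 1)
      (extZero (fun x => ((σ⁻¹ x : Ball K ε) : K)) y) := by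
    rw [extZero_apply]
    refine ((hasStrictDerivAt_id _).add hD.hasStrictDerivAt).congr_of_eventuallyEq ?_
    filter_upwards [eventually_mem_ball (σ⁻¹ y)] with z hz
    lift z to Ball K ε using hz
    rw [Pi.add_apply, extZero_apply, extZero_apply, coe_apply_eq_add_disp, id_eq]
  refine ⟨_, (HasStrictDerivAt.of_local_left_inverse (continuousAt_extZero_perm hσ.disp_inv y)
    hder hne ?_).hasStrictFDerivAt⟩
  filter_upwards [eventually_mem_ball y] with z hz
  lift z to Ball K ε using hz
  rw [extZero_apply, extZero_apply, perm_apply_inv_self]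

theorem strictlyDifferentiable_disp_inv (hσ : IsContr (disp σ))
    (hd : StrictlyDifferentiable (disp σ)) : StrictlyDifferentiable (disp σ⁻¹) := by
  rw [disp_inv]
  exact (hd.comp_perm (strictlyDifferentiable_apply_inv hσ hd)).neg

/-- The group of strictly differentiable diffeomorphisms `id + f`. -/
def oneSubgroup (K : Type u) [NontriviallyNormedField K] [IsUltrametricDist K] (ε : ℝ) :
    Subgroup (Equiv.Perm (Ball K ε)) :=
  diffSubgroup StrictlyDifferentiable strictlyDifferentiable_zero
    (fun _ _ _ _ h h' => strictlyDifferentiable_disp_mul h h')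
    fun _ hσ h => strictlyDifferentiable_disp_inv hσ h

/-- Links the K-valued maps in `DiffAn` and `DiffOne` with groups of permutations; the content is
`IsContr.exists_perm`. -/
theorem exists_perm_iff [CompleteSpace K] (P : (Ball K ε → K) → Prop) :
    (∃ f : Ball K ε → K, P f ∧ (∃ L : ℝ≥0, L < 1 ∧ LipschitzWith L f) ∧
      (∀ x : Ball K ε, (x : K) = 0 → f x = 0) ∧ ∀ x, φ x = x + f x) ↔
    ∃ σ : Equiv.Perm (Ball K ε), (IsContr (disp σ) ∧ P (disp σ)) ∧ ∀ x, φ x = (σ x : K) := by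
  constructor
  · rintro ⟨f, hP, hL, h0, hφ⟩
    obtain ⟨σ, rfl⟩ := IsContr.exists_perm (f := f) ⟨hL, h0⟩
    exact ⟨σ, ⟨⟨hL, h0⟩, hP⟩, fun x => (hφ x).trans (coe_apply_eq_add_disp σ x).symm⟩
  · rintro ⟨σ, ⟨⟨hL, h0⟩, hP⟩, hφ⟩
    exact ⟨disp σ, hP, hL, h0, fun x => (hφ x).trans (coe_apply_eq_add_disp σ x)⟩

end StrictlyDifferentiable


/-! ### The global chart and the Lie group structure. -/

section Chart

variable {K : Type u} [NontriviallyNormedField K] {ε : ℝ}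

theorem locallyAnalytic_polynomial (p : Polynomial K) :
    LocallyAnalytic fun x : Ball K ε => (x : K) * p.eval (x : K) := by
  intro x hx
  have h1 : AnalyticAt K (fun y => y * p.eval y) x := by
    have h2 : AnalyticAt K (fun y : K => Polynomial.aeval y p) x := analyticAt_id.aeval_polynomial p
    simp only [Polynomial.coe_aeval_eq_eval] at h2
    exact analyticAt_id.mul h2
  refine h1.congr ?_
  filter_upwards [isOpen_ball.mem_nhds hx] with y hy
  exact (extZero_apply (fun x : Ball K ε => (x : K) * p.eval (x : K)) ⟨y, hy⟩).symm

/-- The locally analytic functions on the ball given by the polynomials without constant term. -/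
def polynomialToLocAnZero (K : Type u) [NontriviallyNormedField K] (ε : ℝ) :
    Polynomial K →ₗ[K] LocAnZero K ε where
  toFun p := ⟨⟨fun x => (x : K) * p.eval (x : K), locallyAnalytic_polynomial p⟩,
    fun x hx => by
      show (x : K) * p.eval (x : K) = 0
      rw [hx, zero_mul]⟩
  map_add' p q := zfn_injective (funext fun x => by
    show (x : K) * (p + q).eval (x : K) = x * p.eval (x : K) + x * q.eval (x : K)
    rw [Polynomial.eval_add, mul_add])
  map_smul' c p := zfn_injective (funext fun x => by
    show (x : K) * (c • p).eval (x : K) = c * (x * p.eval (x : K))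
    rw [Polynomial.eval_smul, smul_eq_mul, mul_left_comm])

/-- The functions x p(x) form an injective image of the polynomial ring, because a polynomial is
determined by its values on the infinite ball. -/
theorem not_finiteDimensional_locAnZero (hε : 0 < ε) :
    ¬ FiniteDimensional K (LocAnZero K ε) := by
  intro h
  refine Polynomial.not_finite (R := K)
    (Module.Finite.of_injective (polynomialToLocAnZero K ε) fun p q hpq => ?_)
  refine mul_left_cancel₀ Polynomial.X_ne_zero (Polynomial.eq_of_infinite_eval_eq _ _
    ((infinite_of_mem_nhds (0 : K) (ball_mem_nhds _ hε)).mono fun x hx => ?_))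
  have h1 := congrFun (congrArg zfn hpq) ⟨x, hx⟩
  show (Polynomial.X * p).eval x = (Polynomial.X * q).eval x
  rw [Polynomial.eval_mul, Polynomial.eval_mul, Polynomial.eval_X]
  exact h1

variable [IsUltrametricDist K] [ProperSpace K]

/-- The displacement of a locally analytic diffeomorphism. -/
def anChart (K : Type u) [NontriviallyNormedField K] [IsUltrametricDist K] [ProperSpace K]
    (ε : ℝ) (σ : anSubgroup K ε) : LocAnZero K ε :=
  ⟨⟨disp σ.1, σ.2.2⟩, σ.2.1.2⟩

theorem zfn_anChart (σ : anSubgroup K ε) : zfn (anChart K ε σ) = disp σ.1 := rfl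

theorem anChart_injective : Function.Injective (anChart K ε) := fun _ _ h =>
  Subtype.ext (disp_injective (congrArg zfn h))

theorem range_anChart : Set.range (anChart K ε) = contrSet K ε := by
  ext f
  constructor
  · rintro ⟨σ, rfl⟩
    exact σ.2.1
  · intro hf
    obtain ⟨σ, hσ⟩ := exists_perm_of_mem_contrSet hf
    have h1 : IsContr (disp σ) ∧ LocallyAnalytic (disp σ) := by
      rw [hσ]
      exact ⟨hf, locallyAnalytic_zfn f⟩
    exact ⟨⟨σ, h1⟩, zfn_injective hσ⟩

/-- The topology that makes the displacement a homeomorphism onto its image. -/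
noncomputable instance : TopologicalSpace (anSubgroup K ε) :=
  TopologicalSpace.induced (anChart K ε) inferInstance

theorem isOpenEmbedding_anChart (hε : 0 < ε) : IsOpenEmbedding (anChart K ε) where
  eq_induced := rfl
  injective := anChart_injective
  isOpen_range := by
    rw [range_anChart]
    exact isOpen_contrSet hε

/-- The displacement as a global chart. -/
noncomputable def globalChart (K : Type u) [NontriviallyNormedField K] [IsUltrametricDist K]
    [ProperSpace K] (ε : ℝ) (hε : 0 < ε) : OpenPartialHomeomorph (anSubgroup K ε) (LocAnZero K ε) :=
  (isOpenEmbedding_anChart hε).toOpenPartialHomeomorph (anChart K ε)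

theorem globalChart_apply (hε : 0 < ε) (σ : anSubgroup K ε) :
    globalChart K ε hε σ = anChart K ε σ := rfl

theorem globalChart_source (hε : 0 < ε) : (globalChart K ε hε).source = Set.univ := rfl

theorem globalChart_target (hε : 0 < ε) : (globalChart K ε hε).target = contrSet K ε :=
  ((isOpenEmbedding_anChart hε).toOpenPartialHomeomorph_target _).trans range_anChart

theorem globalChart_symm_apply (hε : 0 < ε) {z : LocAnZero K ε} {σ : Equiv.Perm (Ball K ε)}
    (hσ : IsContr (disp σ)) (h : disp σ = zfn z) :
    ((globalChart K ε hε).symm z).1 = σ := by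
  have hz : z ∈ (globalChart K ε hε).target := by
    rw [globalChart_target]
    show IsContr (zfn z)
    rwa [← h]
  have h1 := congrArg zfn ((globalChart K ε hε).right_inv hz)
  rw [globalChart_apply, zfn_anChart, ← h] at h1
  exact disp_injective h1

/-- With one chart the only transition map is the identity of `contrSet K ε`, and the group
operations in the chart are the operations on displacements. The Hausdorff property and continuity
are transported along the open embedding. -/
theorem isAnalyticLieGroup_anSubgroup (hε : 0 < ε) :
    letI := (globalChart K ε hε).singletonChartedSpace (globalChart_source hε)
    IsAnalyticLieGroup K (LocAnZero K ε) (anSubgroup K ε) := by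
  let _ := (globalChart K ε hε).singletonChartedSpace (globalChart_source hε)
  have hatlas : ∀ e ∈ atlas (LocAnZero K ε) (anSubgroup K ε), e = globalChart K ε hε :=
    fun e he => he
  have hemb := isOpenEmbedding_anChart (K := K) hε
  have := t2Space_locAnZero (K := K) hε
  let Fm : LocAnZero K ε × LocAnZero K ε → LocAnZero K ε := fun z =>
    globalChart K ε hε ((globalChart K ε hε).symm z.1 * (globalChart K ε hε).symm z.2)
  have hFm : ∀ z σ τ, IsContr (disp σ) → IsContr (disp τ) → disp σ = zfn z.1 →
      disp τ = zfn z.2 → zfn (Fm z) = disp (σ * τ) := by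
    intro z σ τ hσ hτ hσz hτz
    show zfn (globalChart K ε hε
      ((globalChart K ε hε).symm z.1 * (globalChart K ε hε).symm z.2)) = _
    rw [globalChart_apply, zfn_anChart, Subgroup.coe_mul, globalChart_symm_apply hε hσ hσz,
      globalChart_symm_apply hε hτ hτz]
  let Fi : LocAnZero K ε → LocAnZero K ε := fun z =>
    globalChart K ε hε ((globalChart K ε hε).symm z)⁻¹
  have hFi : ∀ z σ, IsContr (disp σ) → disp σ = zfn z → zfn (Fi z) = disp σ⁻¹ := by
    intro z σ hσ hσz
    show zfn (globalChart K ε hε ((globalChart K ε hε).symm z)⁻¹) = _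
    rw [globalChart_apply, zfn_anChart, Subgroup.coe_inv, globalChart_symm_apply hε hσ hσz]
  have hsymm : ∀ σ, (globalChart K ε hε).symm (anChart K ε σ) = σ := fun σ =>
    (globalChart K ε hε).left_inv (Set.mem_univ σ)
  have hmem : ∀ σ, anChart K ε σ ∈ contrSet K ε := fun σ => σ.2.1
  refine ⟨hemb.isEmbedding.t2Space, ?_, ?_, ?_, ?_⟩
  · have hmul : Continuous fun p : anSubgroup K ε × anSubgroup K ε => p.1 * p.2 := by
      rw [hemb.isInducing.continuous_iff]
      have h1 := (continuousOn_mul hε hFm).comp_continuous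
        (hemb.continuous.prodMap hemb.continuous) fun p => ⟨hmem p.1, hmem p.2⟩
      refine h1.congr fun p => ?_
      show anChart K ε ((globalChart K ε hε).symm (anChart K ε p.1) *
        (globalChart K ε hε).symm (anChart K ε p.2)) = anChart K ε (p.1 * p.2)
      rw [hsymm, hsymm]
    have hinv : Continuous fun σ : anSubgroup K ε => σ⁻¹ := by
      rw [hemb.isInducing.continuous_iff]
      refine ((continuousOn_inv hε hFi).comp_continuous hemb.continuous hmem).congr fun σ => ?_
      show anChart K ε ((globalChart K ε hε).symm (anChart K ε σ))⁻¹ = anChart K ε σ⁻¹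
      rw [hsymm]
    exact { continuous_mul := hmul, continuous_inv := hinv }
  · intro e₁ he₁ e₂ he₂
    obtain rfl := hatlas e₁ he₁
    obtain rfl := hatlas e₂ he₂
    have hid : ∀ z ∈ contrSet K ε,
        globalChart K ε hε ((globalChart K ε hε).symm z) = z := fun z hz =>
      (globalChart K ε hε).right_inv (by rwa [globalChart_target])
    have hset : {z | z ∈ (globalChart K ε hε).target ∧
        (globalChart K ε hε).symm z ∈ (globalChart K ε hε).source} = contrSet K ε := by
      rw [globalChart_target, globalChart_source]
      simp
    rw [hset]
    refine ⟨continuousOn_id.congr hid, fun x hx V _ _ _ _ i =>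
      ⟨V, inferInstance, inferInstance, inferInstance, inferInstance, i, id, analyticAt_id, ?_⟩⟩
    have h1 : Tendsto (fun v => x + i v) (𝓝 0) (𝓝 x) := by
      have h2 : Continuous fun v => x + i v := by fun_prop
      simpa using h2.tendsto 0
    filter_upwards [h1.eventually ((isOpen_contrSet hε).mem_nhds hx)] with v hv
    rw [hid _ hv, hid _ hx, id_eq]
  · intro e₁ he₁ e₂ he₂ e₃ he₃
    obtain rfl := hatlas e₁ he₁
    obtain rfl := hatlas e₂ he₂
    obtain rfl := hatlas e₃ he₃
    have hset : {z : LocAnZero K ε × LocAnZero K ε | z.1 ∈ (globalChart K ε hε).target ∧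
        z.2 ∈ (globalChart K ε hε).target ∧ (globalChart K ε hε).symm z.1 *
          (globalChart K ε hε).symm z.2 ∈ (globalChart K ε hε).source} =
        {z | z.1 ∈ contrSet K ε ∧ z.2 ∈ contrSet K ε} := by
      rw [globalChart_target, globalChart_source]
      simp
    rw [hset]
    exact locallyAnalyticOn_mul hε hFm
  · intro e₁ he₁ e₂ he₂
    obtain rfl := hatlas e₁ he₁
    obtain rfl := hatlas e₂ he₂
    have hset : {z | z ∈ (globalChart K ε hε).target ∧
        ((globalChart K ε hε).symm z)⁻¹ ∈ (globalChart K ε hε).source} = contrSet K ε := by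
      rw [globalChart_target, globalChart_source]
      simp
    rw [hset]
    exact locallyAnalyticOn_inv hε hFi

end Chart

end PadicDiff

/-! ### Assembly of the analytic and the strictly differentiable statements. -/

theorem mainTheorem1 {K : Type u} [NontriviallyNormedField K] [IsUltrametricDist K] [ProperSpace K]
    (ε : ℝ) (hε : 0 < ε) :
    (∃ G : Subgroup (Equiv.Perm (PadicDiff.Ball K ε)),
      (∀ φ : PadicDiff.Ball K ε → K,
        φ ∈ PadicDiff.DiffAn K ε ↔ ∃ σ ∈ G, ∀ x, φ x = (σ x : K)) ∧
      (∀ σ ∈ G, PadicDiff.LocallyAnalytic (fun x => (σ x : K)) ∧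
        PadicDiff.LocallyAnalytic (fun x => (σ.symm x : K))) ∧
      ¬ FiniteDimensional K (PadicDiff.LocAnZero K ε) ∧
      (∃ (_ : TopologicalSpace G) (_ : ChartedSpace (PadicDiff.LocAnZero K ε) G)
        (chart : OpenPartialHomeomorph G (PadicDiff.LocAnZero K ε)),
        PadicDiff.IsAnalyticLieGroup K (PadicDiff.LocAnZero K ε) G ∧
        atlas (PadicDiff.LocAnZero K ε) G = {chart} ∧
        chart.source = Set.univ ∧
        (∀ (σ : G) (x : PadicDiff.Ball K ε), (chart σ).1.toFun x = (σ.1 x : K) - x) ∧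
        (∀ L : ℝ≥0, 0 < L → L < 1 → ∃ H : Subgroup G, IsOpen (H : Set G) ∧
          ∀ σ : G, σ ∈ H ↔ LipschitzWith L (fun x => (σ.1 x : K) - x)))) ∧
    (∃ G : Subgroup (Equiv.Perm (PadicDiff.Ball K ε)),
      (∀ φ : PadicDiff.Ball K ε → K,
        φ ∈ PadicDiff.DiffOne K ε ↔ ∃ σ ∈ G, ∀ x, φ x = (σ x : K)) ∧
      (∀ σ ∈ G, PadicDiff.StrictlyDifferentiable (fun x => (σ x : K)) ∧
        PadicDiff.StrictlyDifferentiable (fun x => (σ.symm x : K))) ∧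
      (∀ L : ℝ≥0, L < 1 → ∃ H : Subgroup G,
        ∀ σ : G, σ ∈ H ↔ LipschitzWith L (fun x => (σ.1 x : K) - x))) := by
  refine ⟨⟨PadicDiff.anSubgroup K ε, fun φ => PadicDiff.exists_perm_iff _, fun σ hσ =>
    ⟨PadicDiff.locallyAnalytic_apply hσ.2,
      PadicDiff.locallyAnalytic_apply ((PadicDiff.anSubgroup K ε).inv_mem hσ).2⟩,
    PadicDiff.not_finiteDimensional_locAnZero hε, inferInstance,
    (PadicDiff.globalChart K ε hε).singletonChartedSpace (PadicDiff.globalChart_source hε),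
    PadicDiff.globalChart K ε hε, PadicDiff.isAnalyticLieGroup_anSubgroup hε, rfl, rfl,
    fun _ _ => rfl, fun L hL0 hL => ⟨PadicDiff.lipSubgroup _ L hL, ?_, fun _ => Iff.rfl⟩⟩,
    PadicDiff.oneSubgroup K ε, fun φ => PadicDiff.exists_perm_iff _, fun σ hσ =>
    ⟨PadicDiff.strictlyDifferentiable_apply hσ.2,
      PadicDiff.strictlyDifferentiable_apply ((PadicDiff.oneSubgroup K ε).inv_mem hσ).2⟩,
    fun L hL => ⟨PadicDiff.lipSubgroup _ L hL, fun _ => Iff.rfl⟩⟩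
  exact (PadicDiff.isOpen_setOf_lipschitzWith hε hL0).preimage
    (PadicDiff.isOpenEmbedding_anChart hε).continuous
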